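/- **Theorem 6.4 (Hecke stability of the Maass space).** Let $K\subset\mathbb C$ be an imaginary quadratic field of discriminant $-D$ with ring of integers $\mathfrak o_K$, let $N\ge 1$ be an integer and let $k\ge 0$ be an integer divisible by $|\mathfrak o_K^\times|$. Let $$\mathbb H_2=\{Z\in M_2(\mathbb C) : -i(Z-Z^*)\text{ is Hermitian positive definite}\},\qquad J=\begin{pmatrix}0&-I_2\\ I_2&0\end{pmatrix},$$ where $Z^*=\overline{Z}^{\,t}$. For $g=\begin{pmatrix}A&B\\ C&E\end{pmatrix}\in GL_4(\mathbb C)$ with $g^*Jg=\mu J$, $\mu>0$, and $F:\mathbb H_2\to\mathbb C$ put $$(F|_k g)(Z)=\det(CZ+E)^{-k}\,F\big((AZ+B)(CZ+E)^{-1}\big).$$ Let $\Gamma=\Gamma_{0,2}(N)$ be the group of $g=\begin{pmatrix}A&B\\ C&E\end{pmatrix}\in GL_4(\mathfrak o_K)$ with $g^*Jg=J$ and $C\equiv 0 \bmod N\mathfrak o_K$, and let $\mathfrak M_{k,2}(N)$ be the space of holomorphic $F:\mathbb H_2\to\mathbb C$ with $F|_kg=F$ for all $g\in\Gamma$. Each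 such $F$ has a Fourier expansion $F(Z)=\sum_{T\in S_2}c_F(T)e^{2\pi i\operatorname{Tr}(TZ)}$, where $$S_2=\Big\{\begin{pmatrix}\ell&t\\ \overline t&m\end{pmatrix} : \ell,m\in\mathbb Z,\ t\in\tfrac1{\sqrt{-D}}\mathfrak o_K\Big\}.$$ For $0\ne T\in S_2$ let $\epsilon(T)=\max\{q\in\mathbb Z_{>0} : \tfrac1qT\in S_2\}$. The Maass space $\mathfrak M_k^*(N)$ is the space of $F\in\mathfrak M_{k,2}(N)$ for which there is a function $\alpha_F:\mathbb Z_{\ge0}\to\mathbb C$ such that $$c_F(T)=\sum_{d\mid\epsilon(T),\ \gcd(d,N)=1}d^{k-1}\alpha_F\Big(\frac{D\det T}{d^2}\Big)$$ for all $T\in S_2$, $T\ge0$, $T\neq0$, the sum being over positive integers $d$. Let $p$ be a prime that is inert in $K$ with $p\nmid N$. Then the double coset $T_p=\Gamma\begin{pmatrix}I_2&0\\0&pI_2\end{pmatrix}\Gamma$ is a finite union of right cosets $\Gamma g$, and $\mathfrak M_k^*(N)$ is stable under the Hecke operator $$F\longmapsto F|_kT_p=\sum_{g\in\Gamma\backslash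 T_p}F|_kg ,$$ that is, $F\in\mathfrak M_k^*(N)$ implies $F|_kT_p\in\mathfrak M_k^*(N)$. -/

import Mathlib

namespace HermitianMaass

open scoped Matrix MatrixGroups ComplexOrder
open Matrix

noncomputable section

/-! ### The hermitian upper half-plane and the group `G_n⁺(ℝ)` -/

/-- The hermitian upper half-plane of degree `n`: complex matrices `Z` such that
`-i (Z - Z^*)` is (hermitian) positive definite. -/
def upperHalf (n : ℕ) : Set (Matrix (Fin n) (Fin n) ℂ) :=
  {Z | ((-Complex.I) • (Z - Zᴴ)).PosDef}

/-- The hermitian upper half-plane as a type. -/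
abbrev HH (n : ℕ) : Type := upperHalf n

/-- `G_n⁺(ℝ)`: the matrices `g ∈ GL_{2n}(ℂ)` with `g^* J g = μ J` for a real `μ > 0`, where
`J = [0, -I_n; I_n, 0]`. -/
def GUPos (n : ℕ) : Subgroup (GL (Fin n ⊕ Fin n) ℂ) where
  carrier := {g | ∃ μ : ℝ, 0 < μ ∧
    (g.val)ᴴ * Matrix.J (Fin n) ℂ * g.val = (μ : ℂ) • Matrix.J (Fin n) ℂ}
  one_mem' := ⟨1, one_pos, by simp⟩
  mul_mem' := by
    rintro g h ⟨μ, hμ, hg⟩ ⟨ν, hν, hh⟩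
    refine ⟨μ * ν, mul_pos hμ hν, ?_⟩
    calc (g * h).valᴴ * Matrix.J (Fin n) ℂ * (g * h).val
        = h.valᴴ * (g.valᴴ * Matrix.J (Fin n) ℂ * g.val) * h.val := by
          simp only [Units.val_mul, conjTranspose_mul, Matrix.mul_assoc]
      _ = ((μ * ν : ℝ) : ℂ) • Matrix.J (Fin n) ℂ := by
          rw [hg, Matrix.mul_smul, Matrix.smul_mul, hh, smul_smul]; push_cast; rfl
  inv_mem' := by
    rintro g ⟨μ, hμ, hg⟩
    refine ⟨μ⁻¹, inv_pos.mpr hμ, ?_⟩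
    have h1 : g.val * (g⁻¹).val = 1 := by rw [← Units.val_mul]; simp
    have h2 : (g⁻¹).valᴴ * g.valᴴ = 1 := by rw [← conjTranspose_mul, h1]; simp
    have h3 : (μ : ℂ) ≠ 0 := by exact_mod_cast hμ.ne'
    have h4 : Matrix.J (Fin n) ℂ = (μ : ℂ)⁻¹ • (g.valᴴ * Matrix.J (Fin n) ℂ * g.val) := by
      rw [hg, smul_smul, inv_mul_cancel₀ h3, one_smul]
    calc (g⁻¹).valᴴ * Matrix.J (Fin n) ℂ * (g⁻¹).val
        = (μ : ℂ)⁻¹ • (((g⁻¹).valᴴ * g.valᴴ) * Matrix.J (Fin n) ℂ * (g.val * (g⁻¹).val)) := by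
          conv_lhs => rw [h4]
          simp only [Matrix.mul_smul, Matrix.smul_mul, Matrix.mul_assoc]
      _ = ((μ⁻¹ : ℝ) : ℂ) • Matrix.J (Fin n) ℂ := by rw [h1, h2]; simp

/-- `A Z + B` for `g = [A, B; C, D]`. -/
def num {n : ℕ} (g : GUPos n) (Z : Matrix (Fin n) (Fin n) ℂ) : Matrix (Fin n) (Fin n) ℂ :=
  g.val.val.toBlocks₁₁ * Z + g.val.val.toBlocks₁₂

/-- `C Z + D` for `g = [A, B; C, D]`. -/
def denom {n : ℕ} (g : GUPos n) (Z : Matrix (Fin n) (Fin n) ℂ) : Matrix (Fin n) (Fin n) ℂ :=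
  g.val.val.toBlocks₂₁ * Z + g.val.val.toBlocks₂₂

/-- The factor of automorphy `j(g; Z) = det (C Z + D)`. -/
def autFactor {n : ℕ} (g : GUPos n) (Z : Matrix (Fin n) (Fin n) ℂ) : ℂ := (denom g Z).det

theorem denom_num {n : ℕ} (g : GUPos n) (Z : Matrix (Fin n) (Fin n) ℂ) :
    ∃ μ : ℝ, 0 < μ ∧
      (denom g Z)ᴴ * num g Z - (num g Z)ᴴ * denom g Z = (μ : ℂ) • (Z - Zᴴ) := by
  obtain ⟨g, μ, hμ, hg⟩ := g
  refine ⟨μ, hμ, ?_⟩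
  have key : ∀ P Q : Matrix (Fin n) (Fin n) ℂ,
      (fromRows P Q)ᴴ * Matrix.J (Fin n) ℂ * fromRows P Q = Qᴴ * P - Pᴴ * Q := by
    intro P Q
    rw [conjTranspose_fromRows_eq_fromCols_conjTranspose, Matrix.J, fromCols_mul_fromBlocks,
      fromCols_mul_fromRows]
    simp [sub_eq_add_neg]
  have h1 : (g.val : Matrix _ _ ℂ) * (fromRows Z 1 : Matrix (Fin n ⊕ Fin n) (Fin n) ℂ) = fromRows (num ⟨g, μ, hμ, hg⟩ Z) (denom ⟨g, μ, hμ, hg⟩ Z) := by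
    conv_lhs => rw [← fromBlocks_toBlocks g.val]
    rw [fromBlocks_mul_fromRows]
    simp [num, denom]
  rw [← key, ← h1, conjTranspose_mul]
  have h2 := key Z 1
  have h3 : ∀ (W : Matrix (Fin n ⊕ Fin n) (Fin n) ℂ) (M j : Matrix (Fin n ⊕ Fin n) (Fin n ⊕ Fin n) ℂ),
      Wᴴ * Mᴴ * j * (M * W) = Wᴴ * (Mᴴ * j * M) * W := fun W M j => by
    simp only [Matrix.mul_assoc]
  have h4 : ∀ (W : Matrix (Fin n ⊕ Fin n) (Fin n) ℂ) (j : Matrix (Fin n ⊕ Fin n) (Fin n ⊕ Fin n) ℂ),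
      Wᴴ * ((μ : ℂ) • j) * W = (μ : ℂ) • (Wᴴ * j * W) := fun W j => by
    rw [Matrix.mul_smul, Matrix.smul_mul]
  rw [h3, hg, h4, h2]
  simp

theorem autFactor_ne_zero {n : ℕ} (g : GUPos n) (Z : HH n) : autFactor g Z.val ≠ 0 := by
  intro h0
  obtain ⟨v, hv, hv0⟩ := Matrix.exists_mulVec_eq_zero_iff.mpr h0
  obtain ⟨μ, hμ, h⟩ := denom_num g Z.val
  have hpos := (show ((-Complex.I) • (Z.val - Z.valᴴ)).PosDef from Z.2).dotProduct_mulVec_pos hv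
  have h1 : star v ⬝ᵥ ((denom g Z.val)ᴴ * num g Z.val - (num g Z.val)ᴴ * denom g Z.val) *ᵥ v
      = 0 := by
    rw [sub_mulVec, ← mulVec_mulVec, ← mulVec_mulVec, hv0, mulVec_zero, sub_zero,
      dotProduct_mulVec, ← star_mulVec, hv0]
    simp
  rw [h, smul_mulVec, dotProduct_smul, smul_eq_mul] at h1
  have h2 : star v ⬝ᵥ (Z.val - Z.valᴴ) *ᵥ v = 0 :=
    (mul_eq_zero.mp h1).resolve_left (by exact_mod_cast hμ.ne')
  rw [smul_mulVec, dotProduct_smul, h2] at hpos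
  simp at hpos

theorem mobius_mem {n : ℕ} (g : GUPos n) (Z : HH n) :
    num g Z.val * (denom g Z.val)⁻¹ ∈ upperHalf n := by
  have hdet : IsUnit (denom g Z.val).det := isUnit_iff_ne_zero.mpr (autFactor_ne_zero g Z)
  obtain ⟨μ, hμ, h⟩ := denom_num g Z.val
  set P := num g Z.val
  set Q := denom g Z.val
  have hQ : Q * Q⁻¹ = 1 := Matrix.mul_nonsing_inv _ hdet
  have hQ' : (Q⁻¹)ᴴ * Qᴴ = 1 := by rw [← conjTranspose_mul, hQ]; simp
  have hpos : ((-Complex.I) • (Z.val - Z.valᴴ)).PosDef := Z.2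
  have e : (-Complex.I) • (P * Q⁻¹ - (P * Q⁻¹)ᴴ)
      = μ • ((Q⁻¹)ᴴ * ((-Complex.I) • (Z.val - Z.valᴴ)) * Q⁻¹) := by
    have e1 : P * Q⁻¹ - (P * Q⁻¹)ᴴ = (Q⁻¹)ᴴ * (Qᴴ * P - Pᴴ * Q) * Q⁻¹ := by
      have a1 : (Q⁻¹)ᴴ * (Qᴴ * P) * Q⁻¹ = P * Q⁻¹ := by
        rw [← Matrix.mul_assoc, hQ', Matrix.one_mul]
      have a2 : (Q⁻¹)ᴴ * (Pᴴ * Q) * Q⁻¹ = (Q⁻¹)ᴴ * Pᴴ := by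
        rw [Matrix.mul_assoc, Matrix.mul_assoc, hQ, Matrix.mul_one]
      rw [Matrix.mul_sub, Matrix.sub_mul, a1, a2, conjTranspose_mul]
    rw [e1, h]
    ext i j
    simp only [Matrix.mul_smul, Matrix.smul_mul, Matrix.smul_apply, smul_eq_mul,
      Complex.real_smul]
    ring
  change ((-Complex.I) • (P * Q⁻¹ - (P * Q⁻¹)ᴴ)).PosDef
  rw [e]
  refine PosDef.smul (hpos.conjTranspose_mul_mul_same ?_) hμ
  exact Matrix.mulVec_injective_iff_isUnit.mpr
    ((Matrix.isUnit_iff_isUnit_det _).mpr (Matrix.isUnit_nonsing_inv_det _ hdet))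

/-- The action `g Z = (A Z + B) (C Z + D)⁻¹` on the hermitian upper half-plane. -/
def mobius {n : ℕ} (g : GUPos n) (Z : HH n) : HH n :=
  ⟨num g Z.val * (denom g Z.val)⁻¹, mobius_mem g Z⟩

/-- `(F |_k g)(Z) = j(g; Z)^{-k} F(g Z)`, without any normalizing power of `μ(g)` or `det g`. -/
def slash {n : ℕ} (k : ℕ) (g : GUPos n) (F : HH n → ℂ) : HH n → ℂ :=
  fun Z => autFactor g Z.val ^ (-(k : ℤ)) * F (mobius g Z)

open Classical in
/-- Holomorphy of a function on the hermitian upper half-plane, which is open in `ℂ^{n × n}`. -/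
def IsHolomorphic {n : ℕ} (F : HH n → ℂ) : Prop :=
  DifferentiableOn ℂ
    (fun z : Fin n → Fin n → ℂ => if h : Matrix.of z ∈ upperHalf n then F ⟨Matrix.of z, h⟩ else 0)
    {z | Matrix.of z ∈ upperHalf n}

/-- The space `𝔐_k(Γ)` of hermitian modular forms of weight `k` for `Γ`. -/
def modularForms {n : ℕ} (k : ℕ) (Γ : Subgroup (GUPos n)) : Submodule ℂ (HH n → ℂ) where
  carrier := {F | IsHolomorphic F ∧ ∀ g ∈ Γ, slash k g F = F}
  zero_mem' := by
    refine ⟨?_, fun g _ => by ext Z; simp [slash]⟩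
    simp only [IsHolomorphic, Pi.zero_apply, dite_eq_ite, ite_self]
    exact differentiableOn_const 0
  add_mem' := by
    rintro F G ⟨hF, hF'⟩ ⟨hG, hG'⟩
    refine ⟨?_, fun g hg => ?_⟩
    · refine (DifferentiableOn.add hF hG).congr fun z hz => ?_
      have hz' : Matrix.of z ∈ upperHalf n := hz
      simp [hz']
    · ext Z
      have h1 := congrFun (hF' g hg) Z
      have h2 := congrFun (hG' g hg) Z
      simp only [slash, Pi.add_apply, mul_add] at h1 h2 ⊢
      rw [h1, h2]
  smul_mem' := by
    rintro a F ⟨hF, hF'⟩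
    refine ⟨?_, fun g hg => ?_⟩
    · refine (DifferentiableOn.const_smul hF a).congr fun z hz => ?_
      have hz' : Matrix.of z ∈ upperHalf n := hz
      simp [hz']
    · ext Z
      have h1 := congrFun (hF' g hg) Z
      simp only [slash, Pi.smul_apply, smul_eq_mul] at h1 ⊢
      rw [mul_left_comm, h1]

/-! ### Hecke operators -/

/-- The set `Γ \ Γ α Γ` of right cosets `Γ g` contained in the double coset `Γ α Γ`. -/
def heckeCosets {n : ℕ} (Γ : Subgroup (GUPos n)) (α : GUPos n) :
    Set (Quotient (QuotientGroup.rightRel Γ)) :=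
  (fun g => Quotient.mk (QuotientGroup.rightRel Γ) g) ''
    DoubleCoset.doubleCoset α (Γ : Set (GUPos n)) (Γ : Set (GUPos n))

/-- `F |_k Γ α Γ = ∑ F |_k g`, the sum running over representatives `g` of the right cosets in
`Γ \ Γ α Γ`. For `F ∈ 𝔐_k(Γ)` it does not depend on the representatives. As a `finsum` it is
meaningful when `heckeCosets Γ α` is finite. -/
def heckeOperator {n : ℕ} (k : ℕ) (Γ : Subgroup (GUPos n)) (α : GUPos n) (F : HH n → ℂ) :
    HH n → ℂ :=
  ∑ᶠ c ∈ heckeCosets Γ α, slash k (Quotient.out c) F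

theorem diag_mem (n : ℕ) {p : ℕ} (hp : 0 < p)
    (h : (fromBlocks 1 0 0 ((p : ℂ) • 1) : Matrix (Fin n ⊕ Fin n) (Fin n ⊕ Fin n) ℂ).det ≠ 0) :
    Matrix.GeneralLinearGroup.mkOfDetNeZero
      (fromBlocks 1 0 0 ((p : ℂ) • 1) : Matrix (Fin n ⊕ Fin n) (Fin n ⊕ Fin n) ℂ) h ∈ GUPos n := by
  refine ⟨p, by exact_mod_cast hp, ?_⟩
  simp [Matrix.GeneralLinearGroup.mkOfDetNeZero, Matrix.J, fromBlocks_conjTranspose,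
    fromBlocks_multiply, fromBlocks_smul]

theorem diag_det (n : ℕ) {p : ℕ} (hp : 0 < p) :
    (fromBlocks 1 0 0 ((p : ℂ) • 1) : Matrix (Fin n ⊕ Fin n) (Fin n ⊕ Fin n) ℂ).det ≠ 0 := by
  have : (p : ℂ) ≠ 0 := by exact_mod_cast hp.ne'
  simp [this]

/-- The element `diag(I_n, p I_n)` of `G_n⁺(ℝ)`. -/
def diagElt (n : ℕ) {p : ℕ} (hp : 0 < p) : GUPos n :=
  ⟨Matrix.GeneralLinearGroup.mkOfDetNeZero
    (fromBlocks 1 0 0 ((p : ℂ) • 1)) (diag_det n hp), diag_mem n hp _⟩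

/-! ### The imaginary quadratic field -/

section Field

open NumberField

variable {K : Type*} [Field K] [NumberField K]

/-- The ring of integers of `K`, viewed in `ℂ` through the embedding `φ : K → ℂ`. -/
def intRing (φ : K →+* ℂ) : Subring ℂ := (φ.comp (algebraMap (𝓞 K) K)).range

/-- The positive integer `D` such that `-D` is the discriminant of the imaginary quadratic
field `K`. -/
def absDisc (K : Type*) [Field K] [NumberField K] : ℕ := (NumberField.discr K).natAbs

theorem conj_mem_intRing [Algebra.IsQuadraticExtension ℚ K] (φ : K →+* ℂ) {x : ℂ}
    (hx : x ∈ intRing φ) : star x ∈ intRing φ := by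
  obtain ⟨a, rfl⟩ := hx
  let _ : Algebra K ℂ := φ.toAlgebra
  let f : ℂ →ₐ[ℚ] ℂ := (starRingEnd ℂ).toRatAlgHom
  have hf : φ (f.restrictNormal K (a : K)) = star (φ (a : K)) := f.restrictNormal_commutes K (a : K)
  have hint : IsIntegral ℤ (f.restrictNormal K (a : K)) :=
    (RingOfIntegers.isIntegral_coe a).map ((f.restrictNormal K).restrictScalars ℤ)
  exact ⟨⟨f.restrictNormal K (a : K), hint⟩, hf⟩

/-- `Γ_{0,n}(N)`: the matrices `[A, B; C, D]` with entries in the ring of integers of `K` such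
that `g^* J g = J` and `C ≡ 0 mod N`. -/
def Gamma0 [Algebra.IsQuadraticExtension ℚ K] (φ : K →+* ℂ) (n N : ℕ) : Subgroup (GUPos n) where
  carrier := {g | (∀ i j, g.val.val i j ∈ intRing φ) ∧
    (g.val.val)ᴴ * Matrix.J (Fin n) ℂ * g.val.val = Matrix.J (Fin n) ℂ ∧
    ∀ i j, ∃ c ∈ intRing φ, g.val.val (Sum.inr i) (Sum.inl j) = (N : ℂ) * c}
  one_mem' := by
    refine ⟨fun i j => ?_, by simp, fun i j => ⟨0, zero_mem _, by simp⟩⟩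
    by_cases h : i = j <;> simp [h, zero_mem, one_mem]
  mul_mem' := by
    rintro g h ⟨hg, hg', hg''⟩ ⟨hh, hh', hh''⟩
    refine ⟨fun i j => ?_, ?_, fun i j => ?_⟩
    · have e : (g * h).val.val i j = ∑ l, g.val.val i l * h.val.val l j := rfl
      rw [e]
      exact sum_mem fun l _ => mul_mem (hg i l) (hh l j)
    · calc (g * h).val.valᴴ * Matrix.J (Fin n) ℂ * (g * h).val.val
          = h.val.valᴴ * (g.val.valᴴ * Matrix.J (Fin n) ℂ * g.val.val) * h.val.val := by
            simp only [Subgroup.coe_mul, Units.val_mul, conjTranspose_mul, Matrix.mul_assoc]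
        _ = Matrix.J (Fin n) ℂ := by rw [hg', hh']
    · choose c hc hc' using hg''
      choose d hd hd' using hh''
      refine ⟨∑ l, c i l * h.val.val (Sum.inl l) (Sum.inl j)
          + ∑ l, g.val.val (Sum.inr i) (Sum.inr l) * d l j,
        add_mem (sum_mem fun l _ => mul_mem (hc i l) (hh _ _))
          (sum_mem fun l _ => mul_mem (hg _ _) (hd l j)), ?_⟩
      have : (g * h).val.val (Sum.inr i) (Sum.inl j)
          = ∑ l, g.val.val (Sum.inr i) l * h.val.val l (Sum.inl j) := rfl
      rw [this, Fintype.sum_sum_type, mul_add, Finset.mul_sum, Finset.mul_sum]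
      congr 1
      · exact Finset.sum_congr rfl fun l _ => by rw [hc']; ring
      · exact Finset.sum_congr rfl fun l _ => by rw [hd']; ring
  inv_mem' := by
    rintro g ⟨hg, hg', hg''⟩
    have h1 : g.val.val * (g⁻¹).val.val = 1 := by
      rw [← Units.val_mul, ← Subgroup.coe_mul]; simp
    have h2 : ((g⁻¹).val.val)ᴴ * (g.val.val)ᴴ = 1 := by rw [← conjTranspose_mul, h1]; simp
    have h3 : (g⁻¹).val.val = -(Matrix.J (Fin n) ℂ * (g.val.val)ᴴ * Matrix.J (Fin n) ℂ) := by
      have e : Matrix.J (Fin n) ℂ * (Matrix.J (Fin n) ℂ * (g⁻¹).val.val)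
          = Matrix.J (Fin n) ℂ * ((g.val.val)ᴴ * Matrix.J (Fin n) ℂ) := by
        congr 1
        calc Matrix.J (Fin n) ℂ * (g⁻¹).val.val
            = (g.val.valᴴ * Matrix.J (Fin n) ℂ * g.val.val) * (g⁻¹).val.val := by rw [hg']
          _ = _ := by rw [Matrix.mul_assoc, h1, Matrix.mul_one]
      rw [← Matrix.mul_assoc, Matrix.J_squared, neg_mul, Matrix.one_mul] at e
      rw [← neg_eq_iff_eq_neg, e, Matrix.mul_assoc]
    have h4 : (g⁻¹).val.val = fromBlocks (g.val.val.toBlocks₂₂)ᴴ (-(g.val.val.toBlocks₁₂)ᴴ)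
        (-(g.val.val.toBlocks₂₁)ᴴ) (g.val.val.toBlocks₁₁)ᴴ := by
      rw [h3]
      conv_lhs => rw [← fromBlocks_toBlocks g.val.val]
      simp [Matrix.J, fromBlocks_conjTranspose, fromBlocks_multiply, fromBlocks_neg]
    refine ⟨fun i j => ?_, ?_, fun i j => ?_⟩
    · rw [h4]
      rcases i with i | i <;> rcases j with j | j <;>
        simp only [fromBlocks_apply₁₁, fromBlocks_apply₁₂, fromBlocks_apply₂₁,
          fromBlocks_apply₂₂, Matrix.neg_apply, conjTranspose_apply]
      · exact conj_mem_intRing φ (hg _ _)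
      · exact neg_mem (conj_mem_intRing φ (hg _ _))
      · exact neg_mem (conj_mem_intRing φ (hg _ _))
      · exact conj_mem_intRing φ (hg _ _)
    · calc ((g⁻¹).val.val)ᴴ * Matrix.J (Fin n) ℂ * (g⁻¹).val.val
          = ((g⁻¹).val.val)ᴴ * (g.val.valᴴ * Matrix.J (Fin n) ℂ * g.val.val) * (g⁻¹).val.val := by
            rw [hg']
        _ = (((g⁻¹).val.val)ᴴ * g.val.valᴴ) * Matrix.J (Fin n) ℂ
              * (g.val.val * (g⁻¹).val.val) := by simp only [Matrix.mul_assoc]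
        _ = _ := by rw [h1, h2]; simp
    · obtain ⟨c, hc, hc'⟩ := hg'' j i
      refine ⟨-star c, neg_mem (conj_mem_intRing φ hc), ?_⟩
      rw [h4, fromBlocks_apply₂₁, Matrix.neg_apply, conjTranspose_apply]
      simp only [toBlocks₂₁, of_apply, hc']
      simp

/-- The lattice `S_2` of half-integral hermitian matrices `[ℓ, t; conj t, m]`, where `ℓ, m ∈ ℤ`
and `t` lies in the inverse different `𝔬_K / √-D`. -/
def S2 (φ : K →+* ℂ) : Set (Matrix (Fin 2) (Fin 2) ℂ) :=
  {T | ∃ (l m : ℤ) (t : ℂ),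
    (∃ a ∈ intRing φ, t = a / (Complex.I * (Real.sqrt (absDisc K) : ℂ))) ∧
    T = !![(l : ℂ), t; star t, (m : ℂ)]}

/-- `ε(T) = max {q ∈ ℤ_{>0} | (1/q) T ∈ S_2}`, for `T ∈ S_2` nonzero. -/
def epsilon (φ : K →+* ℂ) (T : Matrix (Fin 2) (Fin 2) ℂ) : ℕ :=
  sSup {q : ℕ | 0 < q ∧ ((q : ℂ)⁻¹) • T ∈ S2 φ}

/-- The number `D det(T) / d²`; it is a nonnegative integer for positive semidefinite `T ∈ S_2`
and `d` with `(1/d) T ∈ S_2`. -/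
def discIndex (K : Type*) [Field K] [NumberField K] (T : Matrix (Fin 2) (Fin 2) ℂ) (d : ℕ) : ℕ :=
  ⌊((absDisc K : ℂ) * T.det / (d : ℂ) ^ 2).re⌋₊

theorem discIndex_spec [Algebra.IsQuadraticExtension ℚ K] [IsTotallyComplex K] (φ : K →+* ℂ)
    {T : Matrix (Fin 2) (Fin 2) ℂ} (hT : T.PosSemidef) {d : ℕ}
    (hd : ((d : ℂ)⁻¹) • T ∈ S2 φ) :
    (discIndex K T d : ℂ) = (absDisc K : ℂ) * T.det / (d : ℂ) ^ 2 := by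
  obtain ⟨l, m, t, ⟨a, ⟨x, rfl⟩, ht⟩, hU⟩ := hd
  have hdet : T.det / (d : ℂ) ^ 2 = l * m - t * star t := by
    have := congrArg Matrix.det hU
    rw [det_smul, det_fin_two_of] at this
    rw [← this]
    simp only [Fintype.card_fin]
    ring
  have hnn : 0 ≤ T.det / (d : ℂ) ^ 2 := by
    have h2 : (0 : ℂ) ≤ ((d : ℂ) ^ 2)⁻¹ := by
      have h3 : (0 : ℝ) ≤ ((d : ℝ) ^ 2)⁻¹ := by positivity
      have e : ((d : ℂ) ^ 2)⁻¹ = (((d : ℝ) ^ 2)⁻¹ : ℝ) := by push_cast; rfl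
      rw [e]
      exact Complex.zero_le_real.mpr h3
    rw [div_eq_mul_inv]
    exact mul_nonneg hT.det_nonneg h2
  have hD : (0 : ℝ) < absDisc K := by
    exact_mod_cast Int.natAbs_pos.mpr (NumberField.discr_ne_zero K)
  have hnorm : ∃ r : ℤ, φ x * star (φ x) = r := by
    have hc : Fintype.card (InfinitePlace K) = 1 := by
      have h1 := InfinitePlace.card_eq_nrRealPlaces_add_nrComplexPlaces K
      have h2 := IsTotallyComplex.finrank (K := K)
      have h3 := IsTotallyComplex.nrRealPlaces_eq_zero K
      rw [Algebra.IsQuadraticExtension.finrank_eq_two ℚ K] at h2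
      omega
    have : Subsingleton (InfinitePlace K) := Fintype.card_le_one_iff_subsingleton.mp hc.le
    have hp := InfinitePlace.prod_eq_abs_norm (x : K)
    rw [Fintype.prod_subsingleton _ (InfinitePlace.mk φ), IsTotallyComplex.mult_eq,
      InfinitePlace.apply, ← Algebra.coe_norm_int] at hp
    refine ⟨|Algebra.norm ℤ x|, ?_⟩
    have h3 : φ x * star (φ x) = ((‖φ x‖ ^ 2 : ℝ) : ℂ) := by
      have := Complex.mul_conj (φ x)
      rw [Complex.normSq_eq_norm_sq] at this
      exact this
    rw [h3, hp, ← Int.cast_abs, Rat.cast_intCast, Complex.ofReal_intCast]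
  obtain ⟨r, hr⟩ := hnorm
  have key : (absDisc K : ℂ) * T.det / (d : ℂ) ^ 2 = ((absDisc K * l * m - r : ℤ) : ℂ) := by
    have hs : (Real.sqrt (absDisc K) : ℂ) ^ 2 = absDisc K := by
      exact_mod_cast Real.sq_sqrt hD.le
    have hs0 : (Real.sqrt (absDisc K) : ℂ) ≠ 0 := by
      exact_mod_cast (Real.sqrt_pos.mpr hD).ne'
    have htt : (absDisc K : ℂ) * (t * star t) = r := by
      rw [ht, ← hr, ← hs]
      simp only [RingHom.comp_apply, star_div₀, star_mul', Complex.star_def, Complex.conj_I,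
        Complex.conj_ofReal]
      field_simp
      rw [Complex.I_sq]
      simp
    rw [mul_div_assoc, hdet, mul_sub, htt]
    push_cast
    ring
  have hz : (0 : ℤ) ≤ absDisc K * l * m - r := by
    have h0 : 0 ≤ (absDisc K : ℂ) * (T.det / (d : ℂ) ^ 2) :=
      mul_nonneg (by exact_mod_cast hD.le) hnn
    rw [← mul_div_assoc, key] at h0
    exact_mod_cast h0
  obtain ⟨w, hw⟩ := Int.eq_ofNat_of_zero_le hz
  rw [discIndex, key, hw]
  simp

/-- `F(Z) = ∑_{T ∈ S_2} c(T) e^{2πi Tr(T Z)}` on the hermitian upper half-plane of degree two, with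
(unconditional, hence absolute) convergence; `F` determines the coefficients `c(T)`. -/
def HasFourierExpansion (φ : K →+* ℂ) (F : HH 2 → ℂ) (c : S2 φ → ℂ) : Prop :=
  ∀ Z : HH 2, HasSum
    (fun T : S2 φ => c T * Complex.exp (2 * Real.pi * Complex.I * (T.val * Z.val).trace)) (F Z)

/-- The condition on the Fourier coefficients that defines the Maass space. -/
def MaassRelation (φ : K →+* ℂ) (k N : ℕ) (c : S2 φ → ℂ) (α : ℕ → ℂ) : Prop :=
  ∀ T : S2 φ, T.val.PosSemidef → T.val ≠ 0 →
    c T = ∑ d ∈ (epsilon φ T.val).divisors with d.Coprime N,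
      (d : ℂ) ^ ((k : ℤ) - 1) * α (discIndex K T.val d)

/-- The Maass space of weight `k` and level `N`, inside the space of hermitian modular forms of
degree two, weight `k` and level `Γ_{0,2}(N)`. -/
def maassSpace [Algebra.IsQuadraticExtension ℚ K] (φ : K →+* ℂ) (k N : ℕ) :
    Submodule ℂ (HH 2 → ℂ) where
  carrier := {F | F ∈ modularForms k (Gamma0 φ 2 N) ∧
    ∃ (c : S2 φ → ℂ) (α : ℕ → ℂ), HasFourierExpansion φ F c ∧ MaassRelation φ k N c α}
  zero_mem' := ⟨zero_mem _, 0, 0, fun Z => by simp [hasSum_zero],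
    fun T _ _ => by simp⟩
  add_mem' := by
    rintro F G ⟨hF, c, α, hc, hα⟩ ⟨hG, d, β, hd, hβ⟩
    refine ⟨add_mem hF hG, c + d, α + β, fun Z => ?_, fun T h0 h1 => ?_⟩
    · simpa [add_mul] using (hc Z).add (hd Z)
    · simp [hα T h0 h1, hβ T h0 h1, mul_add, Finset.sum_add_distrib]
  smul_mem' := by
    rintro a F ⟨hF, c, α, hc, hα⟩
    refine ⟨Submodule.smul_mem _ a hF, a • c, a • α, fun Z => ?_, fun T h0 h1 => ?_⟩
    · simpa [mul_assoc] using (hc Z).mul_left a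
    · simp [hα T h0 h1, Finset.mul_sum, mul_left_comm]

end Field

end

end HermitianMaass

namespace HermitianMaass

open scoped Matrix MatrixGroups ComplexOrder
open Matrix

noncomputable section

set_option linter.unusedSectionVars false

/-! ### The slash action and Hecke operators -/

section Slash

variable {n : ℕ}

/-! The operator is computed on Fourier coefficients by means of upper triangular coset
representatives [A, B; 0, E] with A^*E = p. As p is inert, 𝔬_K/p is the field with p² elements and
conjugation acts on it as Frobenius (`red_conjInt`). The coset of diag(1, p)γ depends only on the
upper blocks (a, b) of γ modulo p, and these satisfy ab^* = ba^*. The rank of a modulo p separates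
three families: A = 1, E = p with B hermitian modulo p; A = p, E = 1, B = 0; and, for each of the p²
+ 1 lines of (𝔬_K/p)², spanned by the second column of a unimodular V, A = diag(1, p)V⁻¹ with p
choices of B (`bijOn_mk_rep`).

Summation over B is a character sum that removes the indices outside S_2. So F | T_p has the
coefficients p^{4-2k} c(pT) + c(T/p) + p^{1-k} Σ c(T_o), the sum running over the lines o, where T_o
arises from V^*TV = [ℓ, t; *, m] by passing to [pℓ, t; *, m/p] (`hasFourierExpansion_sum_slash`). In
particular det T_o = det T.

Put Δ = D det T, q = p^{k-1}, and let f(x) be x^{k-1} α(p²Δ/x²) for x prime to N and 0 otherwise.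
After multiplication by q², the Maass relations for pT, T_o and T/p are sums of values of this
single f, at d, pd and p²d. The same holds for the required relation with `heckeAlpha` in place of
α. It remains to compare, for each x, how often f(x) occurs on the two sides.

This is a count of lines. Let U = T/d be in S_2 and n = D det U. Modulo p the hermitian form U has
p² + 1 isotropic lines if U ≡ 0, one if U is nonzero and p divides n, and p + 1 otherwise
(`card_isotropic`). If p does not divide U, then p divides U_o for one line o if p² divides n and
for none otherwise (`card_divisible`). Thus the counts depend on n alone, up to corrections in the
divisibility of U by p, and these cancel against the terms of c(pT), c(T/p) and α(p²n)
(`divInd_identity_of_coprime`, `divInd_identity_mul`).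

Modularity of F | T_p holds because right translation by Γ permutes the cosets, and holomorphy
because the representatives act by affine maps. -/

theorem isUnit_det_denom (g : GUPos n) (Z : HH n) : IsUnit (denom g Z.val).det :=
  isUnit_iff_ne_zero.mpr (autFactor_ne_zero g Z)

theorem mul_val_eq_fromBlocks (g h : GUPos n) :
    (g * h).val.val = fromBlocks
      (g.val.val.toBlocks₁₁ * h.val.val.toBlocks₁₁ + g.val.val.toBlocks₁₂ * h.val.val.toBlocks₂₁)
      (g.val.val.toBlocks₁₁ * h.val.val.toBlocks₁₂ + g.val.val.toBlocks₁₂ * h.val.val.toBlocks₂₂)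
      (g.val.val.toBlocks₂₁ * h.val.val.toBlocks₁₁ + g.val.val.toBlocks₂₂ * h.val.val.toBlocks₂₁)
      (g.val.val.toBlocks₂₁ * h.val.val.toBlocks₁₂
        + g.val.val.toBlocks₂₂ * h.val.val.toBlocks₂₂) := by
  rw [← fromBlocks_multiply, fromBlocks_toBlocks, fromBlocks_toBlocks]
  rfl

theorem num_mul (g h : GUPos n) (Z : HH n) :
    num (g * h) Z.val = num g (mobius h Z).val * denom h Z.val := by
  have hQ : (num h Z.val * (denom h Z.val)⁻¹) * denom h Z.val = num h Z.val := by
    rw [Matrix.mul_assoc, Matrix.nonsing_inv_mul _ (isUnit_det_denom h Z), Matrix.mul_one]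
  change _ = (g.val.val.toBlocks₁₁ * (num h Z.val * (denom h Z.val)⁻¹) + g.val.val.toBlocks₁₂)
    * denom h Z.val
  rw [Matrix.add_mul, Matrix.mul_assoc, hQ]
  unfold num denom
  rw [mul_val_eq_fromBlocks, toBlocks_fromBlocks₁₁, toBlocks_fromBlocks₁₂]
  noncomm_ring

theorem denom_mul (g h : GUPos n) (Z : HH n) :
    denom (g * h) Z.val = denom g (mobius h Z).val * denom h Z.val := by
  have hQ : (num h Z.val * (denom h Z.val)⁻¹) * denom h Z.val = num h Z.val := by
    rw [Matrix.mul_assoc, Matrix.nonsing_inv_mul _ (isUnit_det_denom h Z), Matrix.mul_one]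
  change _ = (g.val.val.toBlocks₂₁ * (num h Z.val * (denom h Z.val)⁻¹) + g.val.val.toBlocks₂₂)
    * denom h Z.val
  rw [Matrix.add_mul, Matrix.mul_assoc, hQ]
  unfold num denom
  rw [mul_val_eq_fromBlocks, toBlocks_fromBlocks₂₁, toBlocks_fromBlocks₂₂]
  noncomm_ring

theorem autFactor_mul (g h : GUPos n) (Z : HH n) :
    autFactor (g * h) Z.val = autFactor g (mobius h Z).val * autFactor h Z.val := by
  rw [autFactor, denom_mul, det_mul, autFactor, autFactor]

theorem mobius_mul (g h : GUPos n) (Z : HH n) :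
    mobius (g * h) Z = mobius g (mobius h Z) := by
  apply Subtype.ext
  change num (g * h) Z.val * (denom (g * h) Z.val)⁻¹
    = num g (mobius h Z).val * (denom g (mobius h Z).val)⁻¹
  rw [num_mul, denom_mul, Matrix.mul_inv_rev, Matrix.mul_assoc, ← Matrix.mul_assoc (denom h Z.val),
    Matrix.mul_nonsing_inv _ (isUnit_det_denom h Z), Matrix.one_mul]

theorem slash_mul (k : ℕ) (g h : GUPos n) (F : HH n → ℂ) :
    slash k (g * h) F = slash k h (slash k g F) := by
  ext Z
  simp only [slash, autFactor_mul, mobius_mul, mul_zpow]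
  ring

theorem slash_finset_sum {ι : Type*} (k : ℕ) (g : GUPos n) (s : Finset ι) (f : ι → HH n → ℂ) :
    slash k g (∑ i ∈ s, f i) = ∑ i ∈ s, slash k g (f i) := by
  ext Z
  simp [slash, Finset.sum_apply, Finset.mul_sum]

variable {k : ℕ} {Γ : Subgroup (GUPos n)} {F : HH n → ℂ}

theorem slash_eq_of_mk_eq (hF : ∀ g ∈ Γ, slash k g F = F) {g h : GUPos n}
    (hgh : Quotient.mk (QuotientGroup.rightRel Γ) g = Quotient.mk (QuotientGroup.rightRel Γ) h) :
    slash k g F = slash k h F := by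
  have h1 : h * g⁻¹ ∈ Γ := QuotientGroup.rightRel_apply.mp (Quotient.exact hgh)
  have h2 := hF _ h1
  conv_lhs => rw [← h2, ← slash_mul]
  simp

theorem slash_out (hF : ∀ g ∈ Γ, slash k g F = F) (g : GUPos n) :
    slash k (Quotient.out (Quotient.mk (QuotientGroup.rightRel Γ) g)) F = slash k g F :=
  slash_eq_of_mk_eq hF (Quotient.out_eq _)

theorem mk_mem_heckeCosets_iff {α g : GUPos n} :
    Quotient.mk (QuotientGroup.rightRel Γ) g ∈ heckeCosets Γ α ↔
      ∃ a ∈ Γ, ∃ b ∈ Γ, g = a * α * b := by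
  constructor
  · rintro ⟨h, hh, e⟩
    obtain ⟨a, ha, b, hb, rfl⟩ := DoubleCoset.mem_doubleCoset.mp hh
    have h1 : g * (a * α * b)⁻¹ ∈ Γ := QuotientGroup.rightRel_apply.mp (Quotient.exact e)
    exact ⟨g * (a * α * b)⁻¹ * a, mul_mem h1 ha, b, hb, by group⟩
  · rintro ⟨a, ha, b, hb, rfl⟩
    exact ⟨_, DoubleCoset.mem_doubleCoset.mpr ⟨a, ha, b, hb, rfl⟩, rfl⟩

/-- Right translation of a right coset. -/
def cosetMulRight (Γ : Subgroup (GUPos n)) (γ : GUPos n) :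
    Quotient (QuotientGroup.rightRel Γ) → Quotient (QuotientGroup.rightRel Γ) :=
  Quotient.map (· * γ) fun x y h => by
    have h1 : y * x⁻¹ ∈ Γ := QuotientGroup.rightRel_apply.mp h
    exact QuotientGroup.rightRel_apply.mpr (by simpa [mul_assoc] using h1)

theorem cosetMulRight_mk (γ g : GUPos n) :
    cosetMulRight Γ γ (Quotient.mk _ g) = Quotient.mk _ (g * γ) := rfl

theorem bijOn_cosetMulRight {α γ : GUPos n} (hγ : γ ∈ Γ) :
    Set.BijOn (cosetMulRight Γ γ) (heckeCosets Γ α) (heckeCosets Γ α) := by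
  refine ⟨?_, ?_, ?_⟩
  · intro c hc
    induction c using Quotient.inductionOn with | _ g =>
    obtain ⟨a, ha, b, hb, rfl⟩ := mk_mem_heckeCosets_iff.mp hc
    rw [cosetMulRight_mk]
    exact mk_mem_heckeCosets_iff.mpr ⟨a, ha, b * γ, mul_mem hb hγ, by group⟩
  · intro c _ d _ h
    induction c using Quotient.inductionOn with | _ g =>
    induction d using Quotient.inductionOn with | _ g' =>
    rw [cosetMulRight_mk, cosetMulRight_mk] at h
    have h1 : g' * γ * (g * γ)⁻¹ ∈ Γ := QuotientGroup.rightRel_apply.mp (Quotient.exact h)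
    refine Quotient.sound (QuotientGroup.rightRel_apply.mpr ?_)
    simpa [mul_assoc] using h1
  · intro c hc
    induction c using Quotient.inductionOn with | _ g =>
    obtain ⟨a, ha, b, hb, rfl⟩ := mk_mem_heckeCosets_iff.mp hc
    refine ⟨Quotient.mk _ (a * α * (b * γ⁻¹)), mk_mem_heckeCosets_iff.mpr
      ⟨a, ha, b * γ⁻¹, mul_mem hb (inv_mem hγ), rfl⟩, ?_⟩
    rw [cosetMulRight_mk]
    congr 1
    group

/-- Right multiplication by γ permutes the right cosets in the double coset, so slashing with γ only
permutes the summands. -/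
theorem slash_heckeOperator {α γ : GUPos n} (hfin : (heckeCosets Γ α).Finite)
    (hF : ∀ g ∈ Γ, slash k g F = F) (hγ : γ ∈ Γ) :
    slash k γ (heckeOperator k Γ α F) = heckeOperator k Γ α F := by
  have h1 : slash k γ (heckeOperator k Γ α F)
      = ∑ᶠ c ∈ heckeCosets Γ α, slash k γ (slash k (Quotient.out c) F) := by
    rw [heckeOperator, finsum_mem_eq_finite_toFinset_sum _ hfin, slash_finset_sum,
      finsum_mem_eq_finite_toFinset_sum _ hfin]
  rw [h1]
  refine finsum_mem_eq_of_bijOn (cosetMulRight Γ γ) (bijOn_cosetMulRight hγ) fun c _ => ?_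
  rw [← slash_mul]
  refine slash_eq_of_mk_eq hF ?_
  conv_rhs => rw [Quotient.out_eq, ← Quotient.out_eq c, cosetMulRight_mk]

/-- The Hecke operator as a sum over an explicit system of representatives. -/
theorem heckeOperator_eq_sum {ι : Type*} [Fintype ι] {α : GUPos n} (rep : ι → GUPos n)
    (hrep : Set.BijOn (fun i => Quotient.mk (QuotientGroup.rightRel Γ) (rep i)) Set.univ
      (heckeCosets Γ α))
    (hF : ∀ g ∈ Γ, slash k g F = F) :
    heckeOperator k Γ α F = ∑ i, slash k (rep i) F := by
  rw [heckeOperator, ← finsum_mem_eq_of_bijOn (f := fun i => slash k (rep i) F) _ hrep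
    fun i _ => (slash_out hF _).symm]
  simp [finsum_eq_sum_of_fintype]

end Slash

/-! ### Similitudes -/

section Similitude

variable {n : ℕ}

theorem J_mul_J : Matrix.J (Fin n) ℂ * Matrix.J (Fin n) ℂ = -1 := Matrix.J_squared _ _

/-- The element of `G_n⁺(ℝ)` given by a similitude. -/
def mkGU (M : Matrix (Fin n ⊕ Fin n) (Fin n ⊕ Fin n) ℂ) (μ : ℝ) (hμ : 0 < μ)
    (h : Mᴴ * Matrix.J (Fin n) ℂ * M = (μ : ℂ) • Matrix.J (Fin n) ℂ) : GUPos n :=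
  ⟨Matrix.GeneralLinearGroup.mkOfDetNeZero M (by
    intro h0
    have h1 := congrArg Matrix.det h
    rw [det_mul, h0, mul_zero, det_smul] at h1
    have h2 : (μ : ℂ) ≠ 0 := by exact_mod_cast hμ.ne'
    exact mul_ne_zero (pow_ne_zero _ h2) (Matrix.isUnit_det_J _ _).ne_zero h1.symm), μ, hμ, h⟩

/-- Only three of the four block equations are needed: the fourth is the adjoint of `h1`, because μ
is real. -/
theorem similitude_fromBlocks {A B C E : Matrix (Fin n) (Fin n) ℂ} {μ : ℂ}
    (h1 : Aᴴ * E - Cᴴ * B = μ • 1) (h2 : Cᴴ * A = Aᴴ * C) (h3 : Eᴴ * B = Bᴴ * E) (hμ : star μ = μ) :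
    (fromBlocks A B C E)ᴴ * Matrix.J (Fin n) ℂ * fromBlocks A B C E
      = μ • Matrix.J (Fin n) ℂ := by
  have h4 : Eᴴ * A - Bᴴ * C = μ • 1 := by
    have := congrArg conjTranspose h1
    simpa [conjTranspose_mul, hμ] using this
  rw [Matrix.J, fromBlocks_conjTranspose, fromBlocks_multiply, fromBlocks_multiply, fromBlocks_smul]
  congr 1
  · simp [h2]
  · simp only [Matrix.mul_zero, Matrix.mul_one, zero_add, Matrix.mul_neg, add_zero, neg_mul,
      smul_neg]
    rw [← h1]; abel
  · simp only [Matrix.mul_zero, Matrix.mul_one, zero_add, Matrix.mul_neg, add_zero, neg_mul]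
    rw [← h4]; abel
  · simp [h3]

/-- `g` has multiplier `μ`. -/
def HasMultiplier (g : GUPos n) (μ : ℂ) : Prop :=
  g.val.valᴴ * Matrix.J (Fin n) ℂ * g.val.val = μ • Matrix.J (Fin n) ℂ

theorem HasMultiplier.mul {g h : GUPos n} {μ ν : ℂ} (hg : HasMultiplier g μ)
    (hh : HasMultiplier h ν) : HasMultiplier (g * h) (μ * ν) := by
  unfold HasMultiplier at *
  calc (g * h).val.valᴴ * Matrix.J (Fin n) ℂ * (g * h).val.val
      = h.val.valᴴ * (g.val.valᴴ * Matrix.J (Fin n) ℂ * g.val.val) * h.val.val := by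
        simp only [Subgroup.coe_mul, Units.val_mul, conjTranspose_mul, Matrix.mul_assoc]
    _ = _ := by rw [hg, Matrix.mul_smul, Matrix.smul_mul, hh, smul_smul]

theorem mul_inv_val (g : GUPos n) : g.val.val * (g⁻¹).val.val = 1 := by
  rw [← Units.val_mul, ← Subgroup.coe_mul]; simp

/-- Since J² = -1, the relation g^*Jg = μJ gives g⁻¹ = -μ⁻¹Jg^*J. Integrality of a quotient of two
similitudes thereby becomes divisibility by μ of explicit products of blocks. -/
theorem HasMultiplier.inv_val {g : GUPos n} {μ : ℂ} (hμ : μ ≠ 0) (hg : HasMultiplier g μ) :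
    (g⁻¹).val.val = μ⁻¹ • fromBlocks (g.val.val.toBlocks₂₂)ᴴ (-(g.val.val.toBlocks₁₂)ᴴ)
        (-(g.val.val.toBlocks₂₁)ᴴ) (g.val.val.toBlocks₁₁)ᴴ := by
  have h1 := mul_inv_val g
  unfold HasMultiplier at hg
  have h3 : μ • (g⁻¹).val.val = -(Matrix.J (Fin n) ℂ * (g.val.val)ᴴ * Matrix.J (Fin n) ℂ) := by
    have e : Matrix.J (Fin n) ℂ * ((μ • Matrix.J (Fin n) ℂ) * (g⁻¹).val.val)
        = Matrix.J (Fin n) ℂ * ((g.val.val)ᴴ * Matrix.J (Fin n) ℂ) := by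
      rw [← hg, Matrix.mul_assoc (_ * _), h1, Matrix.mul_one]
    rw [Matrix.smul_mul, Matrix.mul_smul, ← Matrix.mul_assoc, J_mul_J, neg_mul,
      Matrix.one_mul, smul_neg] at e
    rw [← neg_eq_iff_eq_neg, e, Matrix.mul_assoc]
  rw [eq_inv_smul_iff₀ hμ, h3]
  conv_lhs => rw [← fromBlocks_toBlocks g.val.val]
  simp [Matrix.J, fromBlocks_conjTranspose, fromBlocks_multiply, fromBlocks_neg]

theorem HasMultiplier.inv {g : GUPos n} {μ : ℂ} (hμ : μ ≠ 0) (hg : HasMultiplier g μ) :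
    HasMultiplier g⁻¹ μ⁻¹ := by
  have h1 := mul_inv_val g
  have h2 : ((g⁻¹).val.val)ᴴ * (g.val.val)ᴴ = 1 := by rw [← conjTranspose_mul, h1]; simp
  unfold HasMultiplier at *
  have h4 : Matrix.J (Fin n) ℂ = μ⁻¹ • (g.val.valᴴ * Matrix.J (Fin n) ℂ * g.val.val) := by
    rw [hg, smul_smul, inv_mul_cancel₀ hμ, one_smul]
  calc (g⁻¹).val.valᴴ * Matrix.J (Fin n) ℂ * (g⁻¹).val.val
      = μ⁻¹ • (((g⁻¹).val.valᴴ * g.val.valᴴ) * Matrix.J (Fin n) ℂ * (g.val.val * (g⁻¹).val.val)) := by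
        conv_lhs => rw [h4]
        simp only [Matrix.mul_smul, Matrix.smul_mul, Matrix.mul_assoc]
    _ = _ := by rw [h1, h2]; simp

/-- The matrix of `g h⁻¹` for an upper triangular `g`. -/
theorem HasMultiplier.mul_inv_val {g h : GUPos n} {μ : ℂ} (hμ : μ ≠ 0) (hh : HasMultiplier h μ)
    {A B E A' B' C' E' : Matrix (Fin n) (Fin n) ℂ}
    (hg : g.val.val = fromBlocks A B 0 E) (hh' : h.val.val = fromBlocks A' B' C' E') :
    (g * h⁻¹).val.val = μ⁻¹ • fromBlocks (A * E'ᴴ - B * C'ᴴ) (B * A'ᴴ - A * B'ᴴ)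
      (-(E * C'ᴴ)) (E * A'ᴴ) := by
  have h1 : (g * h⁻¹).val.val = g.val.val * (h⁻¹).val.val := rfl
  rw [h1, hh.inv_val hμ, hg, hh', Matrix.mul_smul, fromBlocks_multiply]
  simp [sub_eq_add_neg, add_comm]

end Similitude

/-! ### Arithmetic of the ring of integers -/

section Arithmetic

open NumberField

variable {K : Type*} [Field K] [NumberField K] (φ : K →+* ℂ)

variable (K) in
/-- The square root `√-D` of the discriminant. -/
def sqrtDisc : ℂ := Complex.I * (Real.sqrt (absDisc K) : ℂ)

theorem absDisc_pos : 0 < absDisc K := Int.natAbs_pos.mpr (NumberField.discr_ne_zero K)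

theorem sqrtDisc_ne_zero : sqrtDisc K ≠ 0 := by
  have : (0 : ℝ) < absDisc K := by exact_mod_cast absDisc_pos
  exact mul_ne_zero Complex.I_ne_zero (by exact_mod_cast (Real.sqrt_pos.mpr this).ne')

theorem sqrtDisc_sq : sqrtDisc K ^ 2 = -(absDisc K : ℂ) := by
  have hs : (Real.sqrt (absDisc K) : ℂ) ^ 2 = absDisc K := by
    exact_mod_cast Real.sq_sqrt (Nat.cast_nonneg (absDisc K))
  rw [sqrtDisc, mul_pow, Complex.I_sq, hs]; ring

theorem star_sqrtDisc : star (sqrtDisc K) = -sqrtDisc K := by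
  simp [sqrtDisc]

variable [Algebra.IsQuadraticExtension ℚ K] [IsTotallyComplex K]

theorem ne_conjugate : φ ≠ ComplexEmbedding.conjugate φ := by
  intro h
  have h1 := IsTotallyComplex.isComplex (InfinitePlace.mk φ)
  rw [← InfinitePlace.not_isReal_iff_isComplex, InfinitePlace.isReal_mk_iff,
    ComplexEmbedding.isReal_iff] at h1
  exact h1 h.symm

open Classical in
theorem univ_embeddings :
    (Finset.univ : Finset (K →+* ℂ)) = {φ, ComplexEmbedding.conjugate φ} := by
  symm
  apply Finset.eq_univ_of_card
  rw [Finset.card_pair (ne_conjugate φ), Embeddings.card,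
    Algebra.IsQuadraticExtension.finrank_eq_two ℚ K]

theorem coe_trace (x : 𝓞 K) : ((Algebra.trace ℤ (𝓞 K) x : ℤ) : ℂ) = φ x + star (φ x) := by
  have h1 : ((Algebra.trace ℤ (𝓞 K) x : ℤ) : ℚ) = Algebra.trace ℚ K x := Algebra.coe_trace_int x
  have h2 := trace_eq_sum_embeddings (K := ℚ) ℂ (x := (x : K))
  rw [← h1, ← Equiv.sum_comp (RingHom.equivRatAlgHom K ℂ)] at h2
  simp only [RingHom.equivRatAlgHom_apply] at h2
  simp only [eq_ratCast, Rat.cast_intCast] at h2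
  classical
  rw [h2, univ_embeddings φ, Finset.sum_pair (ne_conjugate φ)]
  rfl

/-- The determinant of the trace form in an integral basis is (ω₁ω̄₂ - ω̄₁ω₂)², so this number is a
square root of the discriminant, and exchanging the basis vectors adjusts its sign. Consequently (xȳ
- x̄y)/√-D is an integral unimodular alternating form on the ring of integers. -/
theorem exists_basis : ∃ ω₁ ∈ intRing φ, ∃ ω₂ ∈ intRing φ,
    (∀ x ∈ intRing φ, ∃ a b : ℤ, x = a * ω₁ + b * ω₂) ∧
    ω₁ * star ω₂ - star ω₁ * ω₂ = sqrtDisc K := by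
  have hcard : Fintype.card (Module.Free.ChooseBasisIndex ℤ (𝓞 K)) = Fintype.card (Fin 2) := by
    rw [← Module.finrank_eq_card_basis (RingOfIntegers.basis K), RingOfIntegers.rank,
      Algebra.IsQuadraticExtension.finrank_eq_two ℚ K, Fintype.card_fin]
  let b := (RingOfIntegers.basis K).reindex (Fintype.equivOfCardEq hcard)
  set x : ℂ := φ (b 0) with hx
  set y : ℂ := φ (b 1) with hy
  have hxm : x ∈ intRing φ := ⟨b 0, rfl⟩
  have hym : y ∈ intRing φ := ⟨b 1, rfl⟩
  have hspan : ∀ z ∈ intRing φ, ∃ m n : ℤ, z = m * x + n * y := by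
    rintro _ ⟨z, rfl⟩
    refine ⟨b.repr z 0, b.repr z 1, ?_⟩
    have h := congrArg (φ.comp (algebraMap (𝓞 K) K)) (b.sum_repr z)
    rw [← h, Fin.sum_univ_two]
    simp [hx, hy]
  have hd : (x * star y - star x * y) ^ 2 = (discr K : ℂ) := by
    rw [← discr_eq_discr K b, Algebra.discr_def, det_fin_two]
    simp only [Algebra.traceMatrix_apply, Algebra.traceForm_apply]
    push_cast
    simp only [coe_trace φ, map_mul, star_mul']
    rw [← hx, ← hy]
    ring
  have hI : star (x * star y - star x * y) = -(x * star y - star x * y) := by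
    simp only [star_sub, star_mul', star_star]; ring
  -- The number is purely imaginary, so its square is not positive; this decides that the
  -- discriminant is -D and not D.
  have hneg : (x * star y - star x * y) ^ 2 = sqrtDisc K ^ 2 := by
    have h1 : (x * star y - star x * y) ^ 2 = -((Complex.normSq (x * star y - star x * y) : ℝ) : ℂ) := by
      rw [← Complex.mul_conj]
      change _ = -(_ * star _)
      rw [hI]; ring
    have h2 : (discr K : ℝ) = -Complex.normSq (x * star y - star x * y) := by
      rw [hd] at h1; exact_mod_cast h1
    have h3 : (discr K : ℝ) ≤ 0 := by rw [h2]; exact neg_nonpos.mpr (Complex.normSq_nonneg _)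
    have h4 : discr K ≤ 0 := by exact_mod_cast h3
    rw [hd, sqrtDisc_sq, absDisc]
    have h5 : discr K = -((discr K).natAbs : ℤ) := by omega
    exact_mod_cast h5
  rcases sq_eq_sq_iff_eq_or_eq_neg.mp hneg with h | h
  · exact ⟨x, hxm, y, hym, hspan, h⟩
  · refine ⟨y, hym, x, hxm, fun z hz => ?_, ?_⟩
    · obtain ⟨m, n, e⟩ := hspan z hz
      exact ⟨n, m, by rw [e]; ring⟩
    · linear_combination -h

theorem exists_mul_star_eq_intCast {x : ℂ} (hx : x ∈ intRing φ) : ∃ r : ℤ, x * star x = r := by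
  obtain ⟨x, rfl⟩ := hx
  have h3 : ((Algebra.norm ℚ (x : K) : ℚ) : ℂ) = φ x * star (φ x) := by
    have h4 := Algebra.norm_eq_prod_embeddings ℚ ℂ (x : K)
    rw [← Equiv.prod_comp (RingHom.equivRatAlgHom K ℂ)] at h4
    simp only [RingHom.equivRatAlgHom_apply, eq_ratCast] at h4
    rw [h4]
    classical
    rw [univ_embeddings φ, Finset.prod_pair (ne_conjugate φ)]
    rfl
  refine ⟨Algebra.norm ℤ x, ?_⟩
  rw [RingHom.comp_apply, ← h3, ← Algebra.coe_norm_int, Rat.cast_intCast]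

theorem exists_add_star_eq_intCast {x : ℂ} (hx : x ∈ intRing φ) : ∃ r : ℤ, x + star x = r := by
  obtain ⟨x, rfl⟩ := hx
  exact ⟨_, (coe_trace φ x).symm⟩

theorem exists_alternating {x y : ℂ} (hx : x ∈ intRing φ) (hy : y ∈ intRing φ) :
    ∃ s : ℤ, x * star y - star x * y = s * sqrtDisc K := by
  obtain ⟨ω₁, -, ω₂, -, hspan, h⟩ := exists_basis φ
  obtain ⟨a, b, rfl⟩ := hspan x hx
  obtain ⟨c, d, rfl⟩ := hspan y hy
  refine ⟨a * d - b * c, ?_⟩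
  rw [← h]
  simp only [star_add, star_mul', star_intCast]
  push_cast
  ring

theorem sqrtDisc_mem : sqrtDisc K ∈ intRing φ := by
  obtain ⟨ω₁, h1, ω₂, h2, -, h⟩ := exists_basis φ
  rw [← h]
  exact sub_mem (mul_mem h1 (conj_mem_intRing φ h2)) (mul_mem (conj_mem_intRing φ h1) h2)

/-- Pairing with the oriented basis reads off the coordinates of x, which are therefore divisible by
n. This is the unimodularity of the alternating form, and it later detects trivial characters of
𝔬_K/p. -/
theorem natCast_dvd_of_alternating {x : ℂ} (hx : x ∈ intRing φ) (n : ℕ)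
    (h : ∀ y ∈ intRing φ, ∃ s : ℤ, x * star y - star x * y = n * s * sqrtDisc K) :
    ∃ z ∈ intRing φ, x = n * z := by
  obtain ⟨ω₁, h1, ω₂, h2, hspan, hω⟩ := exists_basis φ
  obtain ⟨a, b, rfl⟩ := hspan x hx
  obtain ⟨s, hs⟩ := h ω₁ h1
  obtain ⟨t, ht⟩ := h ω₂ h2
  have hδ := sqrtDisc_ne_zero (K := K)
  have hb : (b : ℂ) = -(n * s) := by
    apply mul_right_cancel₀ hδ
    simp only [star_add, star_mul', star_intCast] at hs
    rw [← hω] at hs ⊢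
    linear_combination -hs
  have ha : (a : ℂ) = n * t := by
    apply mul_right_cancel₀ hδ
    simp only [star_add, star_mul', star_intCast] at ht
    rw [← hω] at ht ⊢
    linear_combination ht
  refine ⟨t * ω₁ + (-s) * ω₂, add_mem (mul_mem (intCast_mem _ _) h1)
    (mul_mem (neg_mem (intCast_mem _ _)) h2), ?_⟩
  rw [ha, hb]; ring

end Arithmetic

/-! ### Finite fields with `p²` elements -/

section FiniteField

variable {k : Type*} [CommRing k] [IsDomain k] [Fintype k] {p : ℕ} [hp : Fact p.Prime] [CharP k p]

theorem natCast_injOn_range : Set.InjOn (fun n : ℕ => (n : k)) (Finset.range p) := by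
  intro a ha b hb h
  have ha' : a < p := by simpa using ha
  have hb' : b < p := by simpa using hb
  exact CharP.natCast_injOn_Iio k p ha' hb' h

-- The polynomial X^p - X has at most p roots, and the natural numbers below p already supply p of
-- them.
open Classical Polynomial in
theorem filter_pow_eq_self :
    (Finset.univ.filter fun y : k => y ^ p = y) = (Finset.range p).image (fun n : ℕ => (n : k)) := by
  symm
  apply Finset.eq_of_subset_of_card_le
  · intro y hy
    obtain ⟨n, -, rfl⟩ := Finset.mem_image.mp hy
    rw [Finset.mem_filter]
    refine ⟨Finset.mem_univ _, ?_⟩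
    have := map_natCast (frobenius k p) n
    rwa [frobenius_def] at this
  · rw [Finset.card_image_of_injOn natCast_injOn_range, Finset.card_range]
    have hne : (X ^ p - X : k[X]) ≠ 0 := by
      intro h0
      have h1 := congrArg (fun f => coeff f p) h0
      simp [coeff_X, hp.out.ne_one.symm] at h1
    calc (Finset.univ.filter fun y : k => y ^ p = y).card
        ≤ (X ^ p - X : k[X]).roots.toFinset.card := by
          apply Finset.card_le_card
          intro y hy
          rw [Multiset.mem_toFinset, mem_roots hne, IsRoot.def]
          simp [(Finset.mem_filter.mp hy).2]
      _ ≤ Multiset.card (X ^ p - X : k[X]).roots := Multiset.toFinset_card_le _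
      _ ≤ (X ^ p - X : k[X]).natDegree := card_roots' _
      _ ≤ p := by
        refine (natDegree_sub_le _ _).trans ?_
        rw [natDegree_X_pow, natDegree_X]
        exact max_le le_rfl hp.out.one_lt.le

theorem exists_natCast_of_pow_eq_self {y : k} (hy : y ^ p = y) : ∃ n : ℕ, y = n := by
  classical
  have h : y ∈ Finset.univ.filter fun y : k => y ^ p = y := by simp [hy]
  rw [filter_pow_eq_self] at h
  obtain ⟨n, -, rfl⟩ := Finset.mem_image.mp h
  exact ⟨n, rfl⟩

theorem exists_mul_eq_one {y : k} (hy : y ≠ 0) : ∃ z : k, y * z = 1 :=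
  (Finite.isField_of_domain k).mul_inv_cancel hy

-- The p² - 1 nonzero elements are distributed by y ↦ y^{p+1} over the p - 1 nonzero elements of the
-- prime field, and no fibre has more than p + 1 elements. So every fibre has exactly p + 1.
open Classical in
theorem card_filter_pow_succ_eq (hcard : Fintype.card k = p ^ 2) {c : k} (hc : c ≠ 0)
    (hcp : c ^ p = c) : (Finset.univ.filter fun y : k => y ^ (p + 1) = c).card = p + 1 := by
  have hp0 : 0 < p := hp.out.pos
  have hfix : ∀ y : k, y ^ p ^ 2 = y := by
    let _ := Fintype.fieldOfDomain k
    intro y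
    rw [← hcard]; exact FiniteField.pow_card y
  set S : Finset k := Finset.univ.filter fun c : k => c ^ p = c ∧ c ≠ 0 with hS
  set T : Finset k := Finset.univ.filter fun y : k => y ≠ 0 with hT
  have hTcard : T.card = (p - 1) * (p + 1) := by
    have h1 : T = Finset.univ.erase 0 := by ext; simp [hT]
    rw [h1, Finset.card_erase_of_mem (Finset.mem_univ _), Finset.card_univ, hcard]
    obtain ⟨q, rfl⟩ : ∃ q, p = q + 1 := ⟨p - 1, by omega⟩
    simp only [Nat.add_sub_cancel]
    apply Nat.sub_eq_of_eq_add
    ring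
  have hScard : S.card = p - 1 := by
    have h1 : S = (Finset.univ.filter fun y : k => y ^ p = y).erase 0 := by
      ext; simp [hS, and_comm]
    rw [h1, Finset.card_erase_of_mem (by simp [hp0.ne']), filter_pow_eq_self,
      Finset.card_image_of_injOn natCast_injOn_range, Finset.card_range]
  have hmaps : ∀ y ∈ T, y ^ (p + 1) ∈ S := by
    intro y hy
    have hy0 : y ≠ 0 := (Finset.mem_filter.mp hy).2
    refine Finset.mem_filter.mpr ⟨Finset.mem_univ _, ?_, pow_ne_zero _ hy0⟩
    rw [← pow_mul]
    have : (p + 1) * p = p ^ 2 + p := by ring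
    rw [this, pow_add, hfix, pow_succ, mul_comm]
  have hle : ∀ c ∈ S, (T.filter fun y => y ^ (p + 1) = c).card ≤ p + 1 := by
    intro c _
    calc (T.filter fun y => y ^ (p + 1) = c).card
        ≤ (Polynomial.nthRoots (p + 1) c).toFinset.card := by
          apply Finset.card_le_card
          intro y hy
          rw [Multiset.mem_toFinset, Polynomial.mem_nthRoots (Nat.succ_pos p)]
          exact (Finset.mem_filter.mp hy).2
      _ ≤ Multiset.card (Polynomial.nthRoots (p + 1) c) := Multiset.toFinset_card_le _
      _ ≤ p + 1 := Polynomial.card_nthRoots _ _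
  have hsum : ∑ c ∈ S, (T.filter fun y => y ^ (p + 1) = c).card = ∑ _c ∈ S, (p + 1) := by
    rw [← Finset.card_eq_sum_card_fiberwise hmaps, hTcard, Finset.sum_const, hScard, smul_eq_mul]
  have hcS : c ∈ S := Finset.mem_filter.mpr ⟨Finset.mem_univ _, hcp, hc⟩
  refine Eq.trans ?_ ((Finset.sum_eq_sum_iff_of_le hle).mp hsum c hcS)
  congr 1
  ext y
  simp only [Finset.mem_filter, Finset.mem_univ, true_and, hT]
  refine ⟨fun h => ⟨?_, h⟩, fun h => h.2⟩
  rintro rfl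
  exact hc (by rw [← h, zero_pow (Nat.succ_ne_zero p)])

end FiniteField

/-! ### The residue field at an inert prime -/

section Residue

open NumberField

variable {K : Type*} [Field K] [NumberField K] [Algebra.IsQuadraticExtension ℚ K]
  (φ : K →+* ℂ) (p : ℕ)

/-- Complex conjugation on the ring of integers. -/
def conjInt : intRing φ →+* intRing φ where
  toFun x := ⟨star x.val, conj_mem_intRing φ x.2⟩
  map_one' := by ext; simp
  map_mul' x y := by ext; simp
  map_zero' := by ext; simp
  map_add' x y := by ext; simp

@[simp] theorem coe_conjInt (x : intRing φ) : (conjInt φ x : ℂ) = star (x : ℂ) := rfl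

/-- The residue ring `𝔬_K / p`. -/
abbrev ResidueRing {K : Type*} [Field K] [NumberField K] (φ : K →+* ℂ) (p : ℕ) : Type :=
  intRing φ ⧸ Ideal.span {(p : intRing φ)}

/-- Reduction modulo `p`. -/
abbrev red : intRing φ →+* ResidueRing φ p := Ideal.Quotient.mk _

/-- A representative of a residue class. -/
def lift (x : ResidueRing φ p) : intRing φ := Quotient.out x

@[simp] theorem red_lift (x : ResidueRing φ p) : red φ p (lift φ p x) = x := Quotient.out_eq x

theorem red_eq_zero_iff (x : intRing φ) : red φ p x = 0 ↔ ∃ y ∈ intRing φ, (x : ℂ) = p * y := by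
  rw [Ideal.Quotient.eq_zero_iff_mem, Ideal.mem_span_singleton]
  constructor
  · rintro ⟨y, hy⟩
    exact ⟨y, y.2, by rw [hy]; simp⟩
  · rintro ⟨y, hy, e⟩
    exact ⟨⟨y, hy⟩, by ext; simpa using e⟩

theorem red_eq_iff (x y : intRing φ) :
    red φ p x = red φ p y ↔ ∃ z ∈ intRing φ, (x : ℂ) = y + p * z := by
  rw [← sub_eq_zero, ← map_sub, red_eq_zero_iff]
  constructor
  · rintro ⟨z, hz, e⟩
    exact ⟨z, hz, by rw [← e]; simp⟩
  · rintro ⟨z, hz, e⟩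
    exact ⟨z, hz, by rw [AddSubgroupClass.coe_sub, e]; ring⟩

/-- The ring of integers and its image in `ℂ`. -/
def intRingEquiv : 𝓞 K ≃+* intRing φ :=
  RingEquiv.ofBijective (φ.comp (algebraMap (𝓞 K) K)).rangeRestrict
    ⟨fun x y h => by
      have h1 : φ x = φ y := congrArg Subtype.val h
      exact RingOfIntegers.ext (φ.injective h1), RingHom.rangeRestrict_surjective _⟩

theorem natCast_prime (hp : p ≠ 0) (h : (Ideal.span {(p : 𝓞 K)}).IsPrime) :
    Prime (p : intRing φ) := by
  have h1 : (p : 𝓞 K) ≠ 0 := by exact_mod_cast hp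
  have h2 := (Ideal.span_singleton_prime h1).mp h
  have h3 := (MulEquiv.prime_iff (intRingEquiv φ)).mpr h2
  simpa using h3

theorem card_residueRing (p : ℕ) : Nat.card (ResidueRing φ p) = p ^ 2 := by
  have e : (𝓞 K ⧸ Ideal.span {(p : 𝓞 K)}) ≃+* ResidueRing φ p :=
    Ideal.quotientEquiv _ _ (intRingEquiv φ) (by rw [Ideal.map_span]; simp)
  rw [← Nat.card_congr e.toEquiv, ← Submodule.cardQuot_apply, ← Ideal.absNorm_apply,
    Ideal.absNorm_span_singleton]
  have : (p : 𝓞 K) = algebraMap ℤ (𝓞 K) p := by simp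
  rw [this, Algebra.norm_algebraMap, RingOfIntegers.rank,
    Algebra.IsQuadraticExtension.finrank_eq_two ℚ K]
  simp [Int.natAbs_pow]

theorem finite_residueRing [hp : Fact p.Prime] : Finite (ResidueRing φ p) := by
  apply Nat.finite_of_card_ne_zero
  rw [card_residueRing]
  exact pow_ne_zero _ hp.out.ne_zero

instance [hp : Fact p.Prime] : Fintype (ResidueRing φ p) :=
  @Fintype.ofFinite _ (finite_residueRing φ p)

theorem fintype_card_residueRing [Fact p.Prime] : Fintype.card (ResidueRing φ p) = p ^ 2 := by
  rw [← Nat.card_eq_fintype_card, card_residueRing]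

theorem isDomain_residueRing (h : Prime (p : intRing φ)) : IsDomain (ResidueRing φ p) := by
  have : (Ideal.span {(p : intRing φ)}).IsPrime := (Ideal.span_singleton_prime h.ne_zero).mpr h
  exact Ideal.Quotient.isDomain _

theorem charP_residueRing [Fact p.Prime] (h : Prime (p : intRing φ)) :
    CharP (ResidueRing φ p) p :=
  CharP.quotient _ _ h.not_isUnit

variable {φ p} [IsTotallyComplex K] [hpf : Fact p.Prime]

/-- The class y of x is a root of X² - tX + n, with trace t and norm n in the prime field, so y^p is
a root as well and equals y or the class z of x̄. If y^p = y, then x is congruent to a rational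
integer, which conjugation fixes, so z = y. -/
theorem red_conjInt (h : Prime (p : intRing φ)) (x : intRing φ) :
    red φ p (conjInt φ x) = red φ p x ^ p := by
  have := isDomain_residueRing φ p h
  have := charP_residueRing φ p h
  obtain ⟨t, ht⟩ := exists_add_star_eq_intCast φ x.2
  obtain ⟨n, hn⟩ := exists_mul_star_eq_intCast φ x.2
  have ht' : x + conjInt φ x = (t : intRing φ) := by ext; simpa using ht
  have hn' : x * conjInt φ x = (n : intRing φ) := by ext; simpa using hn
  have ht2 := congrArg (red φ p) ht'
  have hn2 := congrArg (red φ p) hn'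
  rw [map_add, map_intCast] at ht2
  rw [map_mul, map_intCast] at hn2
  set y := red φ p x
  set z := red φ p (conjInt φ x) with hz
  have ht3 : y ^ p + z ^ p = t := by
    have := map_intCast (frobenius (ResidueRing φ p) p) t
    rw [← ht2, frobenius_def, add_pow_char] at this
    rw [this, ht2]
  have hn3 : y ^ p * z ^ p = n := by
    have := map_intCast (frobenius (ResidueRing φ p) p) n
    rw [← hn2, frobenius_def, mul_pow] at this
    rw [this, hn2]
  have h1 : (y ^ p - y) * (y ^ p - z) = 0 := by
    linear_combination y ^ p * ht3 - hn3 - y ^ p * ht2 + hn2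
  rcases mul_eq_zero.mp h1 with h2 | h2
  · obtain ⟨m, hm⟩ := exists_natCast_of_pow_eq_self (sub_eq_zero.mp h2)
    have h3 : y = red φ p (m : intRing φ) := by rw [hm, map_natCast]
    obtain ⟨w, hw, e⟩ := (red_eq_iff φ p _ _).mp h3
    have h4 : z = red φ p (m : intRing φ) := by
      refine (red_eq_iff φ p _ _).mpr ⟨star w, conj_mem_intRing φ hw, ?_⟩
      rw [coe_conjInt, e]; simp
    rw [sub_eq_zero.mp h2, h4, h3]
  · exact (sub_eq_zero.mp h2).symm

theorem exists_natCast_of_conj_eq (h : Prime (p : intRing φ)) {x : intRing φ}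
    (hx : red φ p (conjInt φ x) = red φ p x) : ∃ n : ℕ, red φ p x = red φ p (n : intRing φ) := by
  have := isDomain_residueRing φ p h
  have := charP_residueRing φ p h
  rw [red_conjInt h] at hx
  obtain ⟨n, hn⟩ := exists_natCast_of_pow_eq_self hx
  exact ⟨n, by rw [hn, map_natCast]⟩

/-- The difference ȳ - y is always an integral multiple of √-D. If p divided √-D, Frobenius would
fix all p² residue classes, but it fixes at most p. -/
theorem red_sqrtDisc_ne_zero (h : Prime (p : intRing φ)) :
    red φ p ⟨sqrtDisc K, sqrtDisc_mem φ⟩ ≠ 0 := by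
  have := isDomain_residueRing φ p h
  have := charP_residueRing φ p h
  intro h0
  obtain ⟨w, hw, e⟩ := (red_eq_zero_iff φ p _).mp h0
  have hall : ∀ y : ResidueRing φ p, y ^ p = y := by
    intro y
    rw [← red_lift φ p y, ← red_conjInt h]
    obtain ⟨s, hs⟩ := exists_alternating φ (one_mem _) (lift φ p y).2
    refine (red_eq_iff φ p _ _).mpr ⟨s * w, mul_mem (intCast_mem _ _) hw, ?_⟩
    change sqrtDisc K = p * w at e
    rw [e] at hs
    rw [coe_conjInt]
    simp only [star_one, one_mul] at hs
    linear_combination hs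
  have h1 : (Finset.univ : Finset (ResidueRing φ p)).card ≤ p := by
    classical
    have h2 : (Finset.univ.filter fun y : ResidueRing φ p => y ^ p = y) = Finset.univ := by
      ext y; simp [hall y]
    rw [← h2, filter_pow_eq_self]
    exact Finset.card_image_le.trans (by simp)
  rw [Finset.card_univ, fintype_card_residueRing, pow_two] at h1
  have := hpf.out.one_lt
  nlinarith

theorem intCast_red_eq_zero_iff (h : Prime (p : intRing φ)) (a : ℤ) :
    red φ p (a : intRing φ) = 0 ↔ (p : ℤ) ∣ a := by
  have := charP_residueRing φ p h
  rw [map_intCast, CharP.intCast_eq_zero_iff (ResidueRing φ p) p]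

theorem not_dvd_absDisc (h : Prime (p : intRing φ)) : ¬ (p : ℤ) ∣ absDisc K := by
  have := isDomain_residueRing φ p h
  rw [← intCast_red_eq_zero_iff h]
  have e : ((absDisc K : ℤ) : intRing φ) = -(⟨sqrtDisc K, sqrtDisc_mem φ⟩ ^ 2) := by
    ext
    simp [sqrtDisc_sq]
  rw [e, map_neg, neg_eq_zero, map_pow]
  exact pow_ne_zero _ (red_sqrtDisc_ne_zero h)

end Residue

/-! ### Reduction of integral matrices modulo `p` -/

section Reduction

open NumberField

variable {K : Type*} [Field K] [NumberField K] [Algebra.IsQuadraticExtension ℚ K]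
  (φ : K →+* ℂ) (p : ℕ)

/-- Complex conjugation on `𝔬_K / p`. -/
instance starRingResidueRing : StarRing (ResidueRing φ p) where
  star := Ideal.quotientMap _ (conjInt φ) (by
    rw [Ideal.span_singleton_le_iff_mem, Ideal.mem_comap, map_natCast]
    exact Ideal.mem_span_singleton_self _)
  star_involutive := by
    intro x
    obtain ⟨x, rfl⟩ := Ideal.Quotient.mk_surjective x
    simp only [Ideal.quotientMap_mk]
    congr 1
    ext
    simp
  star_mul x y := by
    rw [mul_comm]
    exact map_mul _ _ _
  star_add x y := map_add _ _ _

/-- Matrices with entries in the ring of integers. -/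
def IsInt {m n : Type*} (M : Matrix m n ℂ) : Prop := ∀ i j, M i j ∈ intRing φ

/-- Matrices with entries divisible by `q` in the ring of integers. -/
def DvdInt (q : ℕ) {m n : Type*} (M : Matrix m n ℂ) : Prop :=
  ∀ i j, ∃ c ∈ intRing φ, M i j = (q : ℂ) * c

variable {φ}

section IsInt

variable {l m n : Type*} [Fintype m]

theorem IsInt.mul {M : Matrix l m ℂ} {M' : Matrix m n ℂ} (h : IsInt φ M) (h' : IsInt φ M') :
    IsInt φ (M * M') := fun i j => by
  rw [mul_apply]
  exact sum_mem fun x _ => mul_mem (h i x) (h' x j)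

theorem IsInt.sub {M M' : Matrix l n ℂ} (h : IsInt φ M) (h' : IsInt φ M') :
    IsInt φ (M - M') := fun i j => sub_mem (h i j) (h' i j)

theorem IsInt.conjTranspose {M : Matrix l n ℂ} (h : IsInt φ M) : IsInt φ Mᴴ :=
  fun i j => conj_mem_intRing φ (h j i)

theorem IsInt.natCast_smul {M : Matrix l n ℂ} (h : IsInt φ M) (q : ℕ) : IsInt φ ((q : ℂ) • M) :=
  fun i j => mul_mem (natCast_mem _ q) (h i j)

theorem isInt_zero : IsInt φ (0 : Matrix l n ℂ) := fun _ _ => zero_mem _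

theorem isInt_diagonal [DecidableEq l] {d : l → ℂ} (h : ∀ i, d i ∈ intRing φ) :
    IsInt φ (diagonal d) := fun i j => by
  by_cases e : i = j
  · subst e; simpa using h i
  · rw [diagonal_apply_ne _ e]; exact zero_mem _

theorem isInt_one [DecidableEq l] : IsInt φ (1 : Matrix l l ℂ) := by
  rw [← diagonal_one]
  exact isInt_diagonal fun _ => one_mem _

theorem IsInt.fromBlocks {l' n' : Type*} {A : Matrix l n ℂ} {B : Matrix l n' ℂ}
    {C : Matrix l' n ℂ} {E : Matrix l' n' ℂ} (hA : IsInt φ A) (hB : IsInt φ B) (hC : IsInt φ C)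
    (hE : IsInt φ E) : IsInt φ (fromBlocks A B C E) := by
  rintro (i | i) (j | j)
  exacts [hA i j, hB i j, hC i j, hE i j]

theorem isInt_of_fin_two {a b c d : ℂ} (ha : a ∈ intRing φ) (hb : b ∈ intRing φ)
    (hc : c ∈ intRing φ) (hd : d ∈ intRing φ) : IsInt φ !![a, b; c, d] := by
  intro i j
  fin_cases i <;> fin_cases j <;> assumption

theorem IsInt.dvdInt_natCast_smul {M : Matrix l n ℂ} (h : IsInt φ M) (q : ℕ) :
    DvdInt φ q ((q : ℂ) • M) := fun i j => ⟨M i j, h i j, rfl⟩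

theorem DvdInt.isInt_inv_smul {M : Matrix l n ℂ} {q : ℕ} (hq : q ≠ 0) (h : DvdInt φ q M) :
    IsInt φ ((q : ℂ)⁻¹ • M) := fun i j => by
  obtain ⟨c, hc, e⟩ := h i j
  have hq' : (q : ℂ) ≠ 0 := by exact_mod_cast hq
  rw [Matrix.smul_apply, e, smul_eq_mul, inv_mul_cancel_left₀ hq']
  exact hc

theorem IsInt.dvdInt_of_inv_smul {M : Matrix l n ℂ} {q : ℕ} (hq : q ≠ 0)
    (h : IsInt φ ((q : ℂ)⁻¹ • M)) : DvdInt φ q M := fun i j => by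
  have hq' : (q : ℂ) ≠ 0 := by exact_mod_cast hq
  exact ⟨_, h i j, by rw [Matrix.smul_apply, smul_eq_mul, mul_inv_cancel_left₀ hq']⟩

theorem DvdInt.neg {M : Matrix l n ℂ} {q : ℕ} (h : DvdInt φ q M) : DvdInt φ q (-M) := fun i j => by
  obtain ⟨c, hc, e⟩ := h i j
  exact ⟨-c, neg_mem hc, by rw [Matrix.neg_apply, e]; ring⟩

theorem DvdInt.conjTranspose {M : Matrix l n ℂ} {q : ℕ} (h : DvdInt φ q M) : DvdInt φ q Mᴴ :=
  fun i j => by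
  obtain ⟨c, hc, e⟩ := h j i
  exact ⟨star c, conj_mem_intRing φ hc, by rw [conjTranspose_apply, e]; simp⟩

theorem DvdInt.mul_left {M : Matrix l m ℂ} {M' : Matrix m n ℂ} {q : ℕ} (h : IsInt φ M)
    (h' : DvdInt φ q M') : DvdInt φ q (M * M') := fun i j => by
  choose c hc e using h'
  refine ⟨∑ x, M i x * c x j, sum_mem fun x _ => mul_mem (h i x) (hc x j), ?_⟩
  rw [mul_apply, Finset.mul_sum]
  exact Finset.sum_congr rfl fun x _ => by rw [e]; ring

/-- A Bézout relation for q and N combines the two divisibilities. It preserves the level condition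
when the lower left block is divided by p. -/
theorem DvdInt.inv_smul_of_coprime {M : Matrix l n ℂ} {q N : ℕ} (hq : q ≠ 0)
    (hqN : Nat.Coprime q N) (h : DvdInt φ q M) (h' : DvdInt φ N M) :
    DvdInt φ N ((q : ℂ)⁻¹ • M) := fun i j => by
  obtain ⟨c, hc, e⟩ := h i j
  obtain ⟨d, hd, e'⟩ := h' i j
  have hq' : (q : ℂ) ≠ 0 := by exact_mod_cast hq
  have hb : ((q.gcdA N : ℂ)) * q + (q.gcdB N : ℂ) * N = 1 := by
    have := Nat.gcd_eq_gcd_ab q N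
    rw [hqN.gcd_eq_one] at this
    have h2 : ((1 : ℕ) : ℂ) = ((q * q.gcdA N + N * q.gcdB N : ℤ) : ℂ) := by
      rw [← this]; simp
    push_cast at h2
    linear_combination -h2
  refine ⟨q.gcdA N * d + q.gcdB N * c, add_mem (mul_mem (intCast_mem _ _) hd)
    (mul_mem (intCast_mem _ _) hc), ?_⟩
  rw [Matrix.smul_apply, e, smul_eq_mul, inv_mul_cancel_left₀ hq']
  linear_combination (-c) * hb + (q.gcdA N : ℂ) * (-e + e')

end IsInt

variable (φ)

open Classical in
/-- Reduction modulo `p` of complex numbers in the ring of integers. -/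
def redC (x : ℂ) : ResidueRing φ p := if h : x ∈ intRing φ then red φ p ⟨x, h⟩ else 0

/-- Reduction modulo `p` of integral matrices. -/
def redM {m n : Type*} (M : Matrix m n ℂ) : Matrix m n (ResidueRing φ p) := M.map (redC φ p)

variable {φ p}

theorem redC_of_mem {x : ℂ} (h : x ∈ intRing φ) : redC φ p x = red φ p ⟨x, h⟩ := dif_pos h

theorem redC_coe (x : intRing φ) : redC φ p x = red φ p x := redC_of_mem x.2

theorem redC_add {x y : ℂ} (hx : x ∈ intRing φ) (hy : y ∈ intRing φ) :
    redC φ p (x + y) = redC φ p x + redC φ p y := by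
  rw [redC_of_mem hx, redC_of_mem hy, redC_of_mem (add_mem hx hy), ← map_add]; rfl

theorem redC_sub {x y : ℂ} (hx : x ∈ intRing φ) (hy : y ∈ intRing φ) :
    redC φ p (x - y) = redC φ p x - redC φ p y := by
  rw [redC_of_mem hx, redC_of_mem hy, redC_of_mem (sub_mem hx hy), ← map_sub]; rfl

theorem redC_mul {x y : ℂ} (hx : x ∈ intRing φ) (hy : y ∈ intRing φ) :
    redC φ p (x * y) = redC φ p x * redC φ p y := by
  rw [redC_of_mem hx, redC_of_mem hy, redC_of_mem (mul_mem hx hy), ← map_mul]; rfl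

theorem redC_star {x : ℂ} (hx : x ∈ intRing φ) : redC φ p (star x) = star (redC φ p x) := by
  rw [redC_of_mem hx, redC_of_mem (conj_mem_intRing φ hx)]; rfl

@[simp] theorem redC_natCast (n : ℕ) : redC φ p (n : ℂ) = n := by
  have := redC_coe (φ := φ) (p := p) (n : intRing φ)
  simpa using this

@[simp] theorem redC_zero : redC φ p 0 = 0 := by
  have := redC_natCast (φ := φ) (p := p) 0
  simpa using this

@[simp] theorem redC_one : redC φ p 1 = 1 := by
  have := redC_natCast (φ := φ) (p := p) 1
  simpa using this

@[simp] theorem redC_lift (x : ResidueRing φ p) : redC φ p (lift φ p x) = x := by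
  rw [redC_coe, red_lift]

theorem redC_neg {x : ℂ} (hx : x ∈ intRing φ) : redC φ p (-x) = -redC φ p x := by
  have := redC_sub (p := p) (zero_mem (intRing φ)) hx
  simpa using this

theorem redC_eq_zero_iff {x : ℂ} (hx : x ∈ intRing φ) :
    redC φ p x = 0 ↔ ∃ c ∈ intRing φ, x = p * c := by
  rw [redC_of_mem hx, red_eq_zero_iff]

@[simp] theorem natCast_self_residueRing : (p : ResidueRing φ p) = 0 := by
  rw [← redC_natCast, redC_eq_zero_iff (natCast_mem _ _)]
  exact ⟨1, one_mem _, by simp⟩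

section redM

variable {l m n : Type*} [Fintype m]

theorem redM_mul {M : Matrix l m ℂ} {M' : Matrix m n ℂ} (h : IsInt φ M) (h' : IsInt φ M') :
    redM φ p (M * M') = redM φ p M * redM φ p M' := by
  classical
  ext i j
  simp only [redM, map_apply, mul_apply]
  have key : ∀ s : Finset m, redC φ p (∑ x ∈ s, M i x * M' x j)
      = ∑ x ∈ s, redC φ p (M i x) * redC φ p (M' x j) := by
    intro s
    induction s using Finset.induction_on with
    | empty => simp
    | insert a s ha ih =>
      rw [Finset.sum_insert ha, Finset.sum_insert ha, redC_add (mul_mem (h _ _) (h' _ _))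
        (sum_mem fun x _ => mul_mem (h _ _) (h' _ _)), ih, redC_mul (h _ _) (h' _ _)]
  exact key _

theorem redM_sub {M M' : Matrix l n ℂ} (h : IsInt φ M) (h' : IsInt φ M') :
    redM φ p (M - M') = redM φ p M - redM φ p M' := by
  ext i j
  exact redC_sub (h i j) (h' i j)

theorem redM_conjTranspose {M : Matrix l n ℂ} (h : IsInt φ M) :
    redM φ p Mᴴ = (redM φ p M)ᴴ := by
  ext i j
  exact redC_star (h j i)

theorem redM_diagonal [DecidableEq l] (d : l → ℂ) :
    redM φ p (diagonal d) = diagonal fun i => redC φ p (d i) := by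
  ext i j
  by_cases e : i = j
  · subst e; simp [redM]
  · simp [redM, e]

theorem redM_one [DecidableEq l] : redM φ p (1 : Matrix l l ℂ) = 1 := by
  rw [← diagonal_one, redM_diagonal]; simp

theorem dvdInt_iff {M : Matrix l n ℂ} (h : IsInt φ M) : DvdInt φ p M ↔ redM φ p M = 0 := by
  constructor
  · intro h1
    ext i j
    exact (redC_eq_zero_iff (h i j)).mpr (h1 i j)
  · intro h1 i j
    exact (redC_eq_zero_iff (h i j)).mp (congrFun (congrFun h1 i) j)

end redM

end Reduction

/-! ### Representatives of the right cosets -/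

section Representatives

open NumberField

variable {K : Type*} [Field K] [NumberField K] [Algebra.IsQuadraticExtension ℚ K]
  (φ : K →+* ℂ) (p : ℕ)

/-- Representatives of the lines in `(𝔬_K / p)²`, as second columns of unimodular matrices. -/
def lineMat : Option (ResidueRing φ p) → Matrix (Fin 2) (Fin 2) ℂ
  | none => !![0, 1; -1, 0]
  | some x => !![1, (lift φ p x : ℂ); 0, 1]

/-- The inverse of `lineMat`. -/
def lineMatInv : Option (ResidueRing φ p) → Matrix (Fin 2) (Fin 2) ℂ
  | none => !![0, -1; 1, 0]
  | some x => !![1, -(lift φ p x : ℂ); 0, 1]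

theorem lineMatInv_mul (o : Option (ResidueRing φ p)) : lineMatInv φ p o * lineMat φ p o = 1 := by
  cases o <;> simp [lineMat, lineMatInv, one_fin_two]

theorem lineMat_mul (o : Option (ResidueRing φ p)) : lineMat φ p o * lineMatInv φ p o = 1 :=
  mul_eq_one_comm.mp (lineMatInv_mul φ p o)

theorem det_lineMat (o : Option (ResidueRing φ p)) : (lineMat φ p o).det = 1 := by
  cases o <;> simp [lineMat]

theorem isInt_lineMat (o : Option (ResidueRing φ p)) : IsInt φ (lineMat φ p o) := by
  cases o with
  | none => exact isInt_of_fin_two (zero_mem _) (one_mem _) (neg_mem (one_mem _)) (zero_mem _)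
  | some x => exact isInt_of_fin_two (one_mem _) (lift φ p x).2 (zero_mem _) (one_mem _)

theorem isInt_lineMatInv (o : Option (ResidueRing φ p)) : IsInt φ (lineMatInv φ p o) := by
  cases o with
  | none => exact isInt_of_fin_two (zero_mem _) (neg_mem (one_mem _)) (one_mem _) (zero_mem _)
  | some x =>
    exact isInt_of_fin_two (one_mem _) (neg_mem (lift φ p x).2) (zero_mem _) (one_mem _)

/-- Hermitian matrices representing the classes modulo `p`. -/
def hermMat (b : ZMod p × ZMod p × ResidueRing φ p) : Matrix (Fin 2) (Fin 2) ℂ :=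
  !![(b.1.val : ℂ), (lift φ p b.2.2 : ℂ); star (lift φ p b.2.2 : ℂ), (b.2.1.val : ℂ)]

theorem hermMat_conjTranspose (b : ZMod p × ZMod p × ResidueRing φ p) :
    (hermMat φ p b)ᴴ = hermMat φ p b := by
  ext i j
  fin_cases i <;> fin_cases j <;> simp [hermMat]

theorem isInt_hermMat (b : ZMod p × ZMod p × ResidueRing φ p) : IsInt φ (hermMat φ p b) :=
  isInt_of_fin_two (natCast_mem _ _) (lift φ p b.2.2).2 (conj_mem_intRing φ (lift φ p b.2.2).2)
    (natCast_mem _ _)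

/-- The index set for the right cosets in the double coset of `diag(I_2, p I_2)`. -/
abbrev CosetIndex : Type :=
  (ZMod p × ZMod p × ResidueRing φ p) ⊕ Unit ⊕ (Option (ResidueRing φ p) × ZMod p)

/-- The upper left blocks of the representatives. -/
def repA : CosetIndex φ p → Matrix (Fin 2) (Fin 2) ℂ
  | .inl _ => 1
  | .inr (.inl _) => (p : ℂ) • 1
  | .inr (.inr (o, _)) => diagonal ![1, (p : ℂ)] * lineMatInv φ p o

/-- The upper right blocks of the representatives. -/
def repB : CosetIndex φ p → Matrix (Fin 2) (Fin 2) ℂ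
  | .inl b => hermMat φ p b
  | .inr (.inl _) => 0
  | .inr (.inr (o, b)) => diagonal ![(b.val : ℂ), 0] * (lineMat φ p o)ᴴ

/-- The lower right blocks of the representatives. -/
def repE : CosetIndex φ p → Matrix (Fin 2) (Fin 2) ℂ
  | .inl _ => (p : ℂ) • 1
  | .inr (.inl _) => 1
  | .inr (.inr (o, _)) => diagonal ![(p : ℂ), 1] * (lineMat φ p o)ᴴ

theorem isInt_repA (i : CosetIndex φ p) : IsInt φ (repA φ p i) := by
  rcases i with b | _ | ⟨o, b⟩
  · exact isInt_one
  · exact isInt_one.natCast_smul p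
  · refine (isInt_diagonal fun i => ?_).mul (isInt_lineMatInv φ p o)
    fin_cases i
    exacts [one_mem _, natCast_mem _ _]

theorem isInt_repB (i : CosetIndex φ p) : IsInt φ (repB φ p i) := by
  rcases i with b | _ | ⟨o, b⟩
  · exact isInt_hermMat φ p b
  · exact isInt_zero
  · refine (isInt_diagonal fun i => ?_).mul (isInt_lineMat φ p o).conjTranspose
    fin_cases i
    exacts [natCast_mem _ _, zero_mem _]

theorem isInt_repE (i : CosetIndex φ p) : IsInt φ (repE φ p i) := by
  rcases i with b | _ | ⟨o, b⟩
  · exact isInt_one.natCast_smul p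
  · exact isInt_one
  · refine (isInt_diagonal fun i => ?_).mul (isInt_lineMat φ p o).conjTranspose
    fin_cases i
    exacts [natCast_mem _ _, one_mem _]

theorem lineMatInv_conjTranspose_mul (o : Option (ResidueRing φ p)) :
    (lineMatInv φ p o)ᴴ * (lineMat φ p o)ᴴ = 1 := by
  rw [← conjTranspose_mul, lineMat_mul, conjTranspose_one]

theorem lineMat_conjTranspose_mul (o : Option (ResidueRing φ p)) :
    (lineMat φ p o)ᴴ * (lineMatInv φ p o)ᴴ = 1 := by
  rw [← conjTranspose_mul, lineMatInv_mul, conjTranspose_one]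

theorem repA_conjTranspose_mul_repE (i : CosetIndex φ p) :
    (repA φ p i)ᴴ * repE φ p i = (p : ℂ) • 1 := by
  rcases i with b | _ | ⟨o, b⟩
  · simp [repA, repE]
  · simp [repA, repE]
  · simp only [repA, repE]
    rw [conjTranspose_mul, diagonal_conjTranspose, Matrix.mul_assoc,
      ← Matrix.mul_assoc (diagonal _), diagonal_mul_diagonal]
    have : (diagonal fun i => star ![1, (p : ℂ)] i * ![(p : ℂ), 1] i)
        = (p : ℂ) • (1 : Matrix (Fin 2) (Fin 2) ℂ) := by
      rw [smul_one_eq_diagonal]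
      congr 1; funext i; fin_cases i <;> simp
    rw [this, Matrix.smul_mul, Matrix.mul_smul, Matrix.one_mul, lineMatInv_conjTranspose_mul]

theorem repE_conjTranspose_mul_repB (i : CosetIndex φ p) :
    (repE φ p i)ᴴ * repB φ p i = (repB φ p i)ᴴ * repE φ p i := by
  rcases i with b | _ | ⟨o, b⟩
  · simp [repB, repE, hermMat_conjTranspose]
  · simp [repB, repE]
  · simp only [repB, repE]
    simp only [conjTranspose_mul, diagonal_conjTranspose, Matrix.mul_assoc]
    congr 1
    rw [← Matrix.mul_assoc (diagonal _), ← Matrix.mul_assoc (diagonal _), diagonal_mul_diagonal,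
      diagonal_mul_diagonal]
    congr 2; funext i; fin_cases i <;> simp [mul_comm]

variable {p}

/-- The representatives of the right cosets in the double coset of `diag(I_2, p I_2)`. -/
def rep (hp : 0 < p) (i : CosetIndex φ p) : GUPos 2 :=
  mkGU (fromBlocks (repA φ p i) (repB φ p i) 0 (repE φ p i)) p (by exact_mod_cast hp)
    (similitude_fromBlocks (by simp [repA_conjTranspose_mul_repE φ p i]) (by simp)
      (repE_conjTranspose_mul_repB φ p i) (by simp))

theorem rep_val (hp : 0 < p) (i : CosetIndex φ p) :
    (rep φ hp i).val.val = fromBlocks (repA φ p i) (repB φ p i) 0 (repE φ p i) := rfl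

theorem hasMultiplier_rep (hp : 0 < p) (i : CosetIndex φ p) : HasMultiplier (rep φ hp i) p := by
  have := similitude_fromBlocks (A := repA φ p i) (B := repB φ p i) (C := 0) (E := repE φ p i)
    (μ := p) (by simp [repA_conjTranspose_mul_repE φ p i]) (by simp)
    (repE_conjTranspose_mul_repB φ p i) (by simp)
  exact this

theorem hasMultiplier_diagElt (hp : 0 < p) : HasMultiplier (diagElt 2 hp) p := by
  have := similitude_fromBlocks (A := 1) (B := 0) (C := 0)
    (E := (p : ℂ) • (1 : Matrix (Fin 2) (Fin 2) ℂ)) (μ := p) (by simp) (by simp) (by simp)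
    (by simp)
  exact this

variable {N : ℕ}

theorem mem_Gamma0_of_fromBlocks {g : GUPos 2} {A B C E : Matrix (Fin 2) (Fin 2) ℂ}
    (hg : g.val.val = fromBlocks A B C E) (h1 : HasMultiplier g 1) (hA : IsInt φ A)
    (hB : IsInt φ B) (hE : IsInt φ E) (hC : DvdInt φ N C) : g ∈ Gamma0 φ 2 N := by
  refine ⟨?_, by simpa [HasMultiplier] using h1, ?_⟩
  · rw [hg]
    refine hA.fromBlocks hB (fun i j => ?_) hE
    obtain ⟨c, hc, e⟩ := hC i j
    rw [e]
    exact mul_mem (natCast_mem _ _) hc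
  · rw [hg]
    exact hC

/-- Up to sign, the four matrices are p times the blocks of g h⁻¹, so the conditions express
integrality of g h⁻¹. Its multiplier is 1, and the level condition comes for free because p is prime
to N. -/
theorem mk_eq_mk_iff (hp : 0 < p) (hpN : Nat.Coprime p N) {g h : GUPos 2}
    (hg : HasMultiplier g p) (hh : HasMultiplier h p)
    {A B E A' B' C' E' : Matrix (Fin 2) (Fin 2) ℂ}
    (eg : g.val.val = fromBlocks A B 0 E) (eh : h.val.val = fromBlocks A' B' C' E')
    (hE : IsInt φ E) (hC' : DvdInt φ N C') :
    Quotient.mk (QuotientGroup.rightRel (Gamma0 φ 2 N)) h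
        = Quotient.mk (QuotientGroup.rightRel (Gamma0 φ 2 N)) g ↔
      DvdInt φ p (A * E'ᴴ - B * C'ᴴ) ∧ DvdInt φ p (B * A'ᴴ - A * B'ᴴ) ∧
        DvdInt φ p (E * C'ᴴ) ∧ DvdInt φ p (E * A'ᴴ) := by
  have hp' : p ≠ 0 := hp.ne'
  have hpC : (p : ℂ) ≠ 0 := by exact_mod_cast hp'
  have hv := hh.mul_inv_val hpC eg eh
  rw [Quotient.eq, QuotientGroup.rightRel_apply]
  constructor
  · rintro ⟨hi, -, -⟩
    rw [hv] at hi
    refine ⟨IsInt.dvdInt_of_inv_smul hp' fun i j => ?_, IsInt.dvdInt_of_inv_smul hp' fun i j => ?_,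
      IsInt.dvdInt_of_inv_smul hp' fun i j => ?_, IsInt.dvdInt_of_inv_smul hp' fun i j => ?_⟩
    · simpa using hi (Sum.inl i) (Sum.inl j)
    · simpa using hi (Sum.inl i) (Sum.inr j)
    · simpa using neg_mem (hi (Sum.inr i) (Sum.inl j))
    · simpa using hi (Sum.inr i) (Sum.inr j)
  · rintro ⟨h1, h2, h3, h4⟩
    rw [fromBlocks_smul] at hv
    refine mem_Gamma0_of_fromBlocks φ hv ?_ (h1.isInt_inv_smul hp') (h2.isInt_inv_smul hp')
      (h4.isInt_inv_smul hp') ?_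
    · have := hg.mul (hh.inv hpC)
      rwa [mul_inv_cancel₀ hpC] at this
    · exact h3.neg.inv_smul_of_coprime hp' hpN (DvdInt.mul_left hE hC'.conjTranspose).neg

/-! #### The representatives lie in the double coset -/

/-- The translation `Z ↦ Z + B`. -/
def transElt (B : Matrix (Fin 2) (Fin 2) ℂ) (hB : Bᴴ = B) : GUPos 2 :=
  mkGU (fromBlocks 1 B 0 1) 1 one_pos
    (similitude_fromBlocks (by simp) (by simp) (by simp [hB]) (by simp))

theorem transElt_mem {B : Matrix (Fin 2) (Fin 2) ℂ} (hB : Bᴴ = B) (hB' : IsInt φ B) :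
    transElt B hB ∈ Gamma0 φ 2 N := by
  refine mem_Gamma0_of_fromBlocks φ rfl ?_ isInt_one hB' isInt_one
    fun i j => ⟨0, zero_mem _, by simp⟩
  exact similitude_fromBlocks (A := 1) (B := B) (C := 0) (E := 1) (μ := 1) (by simp) (by simp)
    (by simp [hB]) (by simp)

/-- The element `diag(V⁻¹, V^*)`. -/
def leviElt (o : Option (ResidueRing φ p)) : GUPos 2 :=
  mkGU (fromBlocks (lineMatInv φ p o) 0 0 (lineMat φ p o)ᴴ) 1 one_pos
    (similitude_fromBlocks (by simp [lineMatInv_conjTranspose_mul]) (by simp) (by simp) (by simp))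

theorem leviElt_mem (o : Option (ResidueRing φ p)) : leviElt φ o ∈ Gamma0 φ 2 N := by
  refine mem_Gamma0_of_fromBlocks φ rfl ?_ (isInt_lineMatInv φ p o) isInt_zero
    (isInt_lineMat φ p o).conjTranspose fun i j => ⟨0, zero_mem _, by simp⟩
  exact similitude_fromBlocks (A := lineMatInv φ p o) (B := 0) (C := 0) (E := (lineMat φ p o)ᴴ)
    (μ := 1) (by simp [lineMatInv_conjTranspose_mul]) (by simp) (by simp) (by simp)

/-- An integral matrix in `SL_2`, embedded in the coordinates where `e` is `1`. -/
theorem exists_diagonal_Gamma0 {e : Fin 2 → ℂ} (he : ∀ i, e i = 0 ∨ e i = 1) (a b c d : ℤ)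
    (h : a * d - b * c = 1) (hc : (N : ℤ) ∣ c) : ∃ g ∈ Gamma0 φ 2 N,
      g.val.val = fromBlocks (diagonal fun i => 1 - e i + a * e i) (diagonal fun i => b * e i)
        (diagonal fun i => c * e i) (diagonal fun i => 1 - e i + d * e i) := by
  have hC : (a : ℂ) * d - b * c = 1 := by exact_mod_cast h
  have key := similitude_fromBlocks (A := diagonal fun i => 1 - e i + a * e i)
    (B := diagonal fun i => b * e i) (C := diagonal fun i => c * e i)
    (E := diagonal fun i => 1 - e i + d * e i) (μ := 1)
    (by
      rw [diagonal_conjTranspose, diagonal_conjTranspose, diagonal_mul_diagonal,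
        diagonal_mul_diagonal, diagonal_sub, one_smul, ← diagonal_one]
      congr 1; funext i
      rcases he i with h | h <;> simp [h]
      linear_combination hC)
    (by
      rw [diagonal_conjTranspose, diagonal_conjTranspose, diagonal_mul_diagonal,
        diagonal_mul_diagonal]
      congr 1; funext i
      rcases he i with h | h <;> simp [h, mul_comm])
    (by
      rw [diagonal_conjTranspose, diagonal_conjTranspose, diagonal_mul_diagonal,
        diagonal_mul_diagonal]
      congr 1; funext i
      rcases he i with h | h <;> simp [h, mul_comm])
    (by simp)
  have hmem : ∀ i, e i ∈ intRing φ := fun i => by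
    rcases he i with h | h <;> simp [h, zero_mem, one_mem]
  refine ⟨mkGU _ 1 one_pos (by rw [Complex.ofReal_one]; exact key), ?_, rfl⟩
  refine mem_Gamma0_of_fromBlocks φ rfl key ?_ ?_ ?_ ?_
  · exact isInt_diagonal fun i => add_mem (sub_mem (one_mem _) (hmem i))
      (mul_mem (intCast_mem _ _) (hmem i))
  · exact isInt_diagonal fun i => mul_mem (intCast_mem _ _) (hmem i)
  · exact isInt_diagonal fun i => add_mem (sub_mem (one_mem _) (hmem i))
      (mul_mem (intCast_mem _ _) (hmem i))
  · obtain ⟨c', rfl⟩ := hc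
    have : (diagonal fun i => ((N * c' : ℤ) : ℂ) * e i)
        = (N : ℂ) • diagonal fun i => (c' : ℂ) * e i := by
      rw [← diagonal_smul]
      congr 1; funext i
      simp [mul_assoc]
    rw [this]
    exact (isInt_diagonal fun i => mul_mem (intCast_mem _ _) (hmem i)).dvdInt_natCast_smul N

/-- If pw - uN = 1, then [pw, -u; -N, 1] · diag(1, p) · [p, u; N, w] = diag(p, 1), and both outer
factors are in SL_2(ℤ) with lower left entry divisible by N. This is applied in the coordinates
where e is 1. -/
theorem exists_swap (hp : 0 < p) (hpN : Nat.Coprime p N) {e : Fin 2 → ℂ}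
    (he : ∀ i, e i = 0 ∨ e i = 1) :
    ∃ a ∈ Gamma0 φ 2 N, ∃ b ∈ Gamma0 φ 2 N, (a * diagElt 2 hp * b).val.val
      = fromBlocks (diagonal fun i => 1 - e i + p * e i) 0 0
        (diagonal fun i => p * (1 - e i) + e i) := by
  obtain ⟨w, u, hwu⟩ : ∃ w u : ℤ, (p : ℤ) * w - u * N = 1 := by
    have := Nat.gcd_eq_gcd_ab p N
    rw [hpN.gcd_eq_one] at this
    exact ⟨p.gcdA N, -p.gcdB N, by push_cast at this; linear_combination -this⟩
  obtain ⟨a, ha, ea⟩ := exists_diagonal_Gamma0 φ (N := N) he (p * w) (-u) (-N) 1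
    (by linear_combination hwu) (by simp)
  obtain ⟨b, hb, eb⟩ := exists_diagonal_Gamma0 φ (N := N) he p u N w
    (by linear_combination hwu) (by simp)
  refine ⟨a, ha, b, hb, ?_⟩
  have hC : (p : ℂ) * w - u * N = 1 := by exact_mod_cast hwu
  have hd : (diagElt 2 hp).val.val
      = fromBlocks (diagonal fun _ => 1) (diagonal fun _ => 0) (diagonal fun _ => 0)
        (diagonal fun _ => (p : ℂ)) := by
    change fromBlocks 1 0 0 ((p : ℂ) • 1) = _
    rw [smul_one_eq_diagonal, diagonal_one, diagonal_zero]
  have hmul : (a * diagElt 2 hp * b).val.val = a.val.val * (diagElt 2 hp).val.val * b.val.val := rfl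
  rw [hmul, ea, eb, hd, fromBlocks_multiply, fromBlocks_multiply]
  simp only [diagonal_mul_diagonal, diagonal_add]
  rw [← diagonal_zero]
  congr 2 <;> funext i <;> rcases he i with h | h <;> simp [h]
  · linear_combination (p : ℂ) * hC
  · ring
  · ring
  · linear_combination hC

theorem GUPos.ext_val {g h : GUPos 2} (e : g.val.val = h.val.val) : g = h :=
  Subtype.ext (Units.ext e)

theorem rep_mem_doubleCoset (hp : 0 < p) (hpN : Nat.Coprime p N) (i : CosetIndex φ p) :
    ∃ a ∈ Gamma0 φ 2 N, ∃ b ∈ Gamma0 φ 2 N, rep φ hp i = a * diagElt 2 hp * b := by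
  rcases i with b | u | ⟨o, b⟩
  · refine ⟨1, one_mem _, _, transElt_mem φ (hermMat_conjTranspose φ p b) (isInt_hermMat φ p b),
      GUPos.ext_val ?_⟩
    rw [one_mul]
    change fromBlocks 1 (hermMat φ p b) 0 ((p : ℂ) • 1)
      = fromBlocks 1 0 0 ((p : ℂ) • 1) * fromBlocks 1 (hermMat φ p b) 0 1
    simp [fromBlocks_multiply]
  · obtain ⟨a, ha, b, hb, e⟩ := exists_swap φ hp hpN (e := fun _ => 1) (fun _ => Or.inr rfl)
    refine ⟨a, ha, b, hb, GUPos.ext_val ?_⟩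
    rw [e, rep_val]
    simp [repA, repB, repE, smul_one_eq_diagonal]
  -- Only the second coordinate is swapped, which yields the blocks diag(1, p) and diag(p, 1).
  · obtain ⟨a, ha, c, hc, e⟩ := exists_swap φ hp hpN (e := ![0, 1])
      (fun i => by fin_cases i <;> simp)
    have hB : (diagonal ![(b.val : ℂ), 0])ᴴ = diagonal ![(b.val : ℂ), 0] := by
      rw [diagonal_conjTranspose]; congr 1; funext i; fin_cases i <;> simp
    have hB' : IsInt φ (diagonal ![(b.val : ℂ), 0]) := isInt_diagonal fun i => by
      fin_cases i
      exacts [natCast_mem _ _, zero_mem _]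
    refine ⟨a, ha, c * (transElt _ hB * leviElt φ o),
      mul_mem hc (mul_mem (transElt_mem φ hB hB') (leviElt_mem φ o)), GUPos.ext_val ?_⟩
    rw [← mul_assoc]
    change _ = (a * diagElt 2 hp * c).val.val * (fromBlocks 1 (diagonal ![(b.val : ℂ), 0]) 0 1
      * fromBlocks (lineMatInv φ p o) 0 0 (lineMat φ p o)ᴴ)
    rw [e, rep_val]
    simp only [fromBlocks_multiply, repA, repB, repE, Matrix.mul_zero, Matrix.zero_mul, add_zero,
      zero_add, Matrix.one_mul, ← Matrix.mul_assoc, diagonal_mul_diagonal]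
    congr 3 <;> funext i <;> fin_cases i <;> simp

end Representatives

/-! ### The right cosets in the double coset -/

section Cosets

open NumberField

variable {K : Type*} [Field K] [NumberField K] [Algebra.IsQuadraticExtension ℚ K]
  [IsTotallyComplex K] {φ : K →+* ℂ} {p : ℕ} [hpf : Fact p.Prime]

theorem exists_zmod_of_star_eq (h : Prime (p : intRing φ)) {y : ResidueRing φ p}
    (hy : star y = y) : ∃ b : ZMod p, y = (b.val : ResidueRing φ p) := by
  have := charP_residueRing φ p h
  obtain ⟨x, rfl⟩ := Ideal.Quotient.mk_surjective y
  obtain ⟨n, hn⟩ := exists_natCast_of_conj_eq h (x := x) hy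
  refine ⟨(n : ZMod p), ?_⟩
  change red φ p x = _
  rw [hn, map_natCast, ZMod.val_natCast, ← CharP.cast_eq_mod]

/-- A nonzero kernel vector is scaled to (x, 1), or spans the line of (1, 0) if its second entry
vanishes; these are the second columns of `lineMat`. -/
theorem exists_line (h : Prime (p : intRing φ)) {a : Matrix (Fin 2) (Fin 2) (ResidueRing φ p)}
    (ha : a.det = 0) : ∃ o : Option (ResidueRing φ p),
      (a * redM φ p (lineMat φ p o)) 0 1 = 0 ∧ (a * redM φ p (lineMat φ p o)) 1 1 = 0 := by
  have := isDomain_residueRing φ p h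
  obtain ⟨v, hv, hav⟩ := exists_mulVec_eq_zero_iff.mpr ha
  have h0 := congrFun hav 0
  have h1 := congrFun hav 1
  simp only [mulVec, dotProduct, Fin.sum_univ_two, Pi.zero_apply] at h0 h1
  by_cases hv1 : v 1 = 0
  · have hv0 : v 0 ≠ 0 := fun h => hv (by funext i; fin_cases i <;> assumption)
    refine ⟨none, ?_, ?_⟩
    · simpa [mul_apply, lineMat, redM, hv1, hv0] using h0
    · simpa [mul_apply, lineMat, redM, hv1, hv0] using h1
  · obtain ⟨z, hz⟩ := exists_mul_eq_one hv1
    refine ⟨some (v 0 * z), ?_, ?_⟩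
    · simp only [mul_apply, lineMat, redM, Fin.sum_univ_two, map_apply, of_apply, cons_val',
        cons_val_zero, cons_val_one, cons_val_fin_one, redC_lift, redC_one]
      linear_combination z * h0 - a 0 1 * hz
    · simp only [mul_apply, lineMat, redM, Fin.sum_univ_two, map_apply, of_apply, cons_val',
        cons_val_zero, cons_val_one, cons_val_fin_one, redC_lift, redC_one]
      linear_combination z * h1 - a 1 1 * hz

theorem exists_hermMat (h : Prime (p : intRing φ)) {M : Matrix (Fin 2) (Fin 2) (ResidueRing φ p)}
    (hM : Mᴴ = M) : ∃ b, redM φ p (hermMat φ p b) = M := by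
  obtain ⟨b1, h1⟩ := exists_zmod_of_star_eq h (y := M 0 0) (congrFun (congrFun hM 0) 0)
  obtain ⟨b2, h2⟩ := exists_zmod_of_star_eq h (y := M 1 1) (congrFun (congrFun hM 1) 1)
  refine ⟨(b1, b2, M 0 1), ?_⟩
  ext i j
  fin_cases i <;> fin_cases j
  · simp [redM, hermMat, h1, -ZMod.natCast_val]
  · simp [redM, hermMat]
  · have := congrFun (congrFun hM 1) 0
    change redC φ p (star (lift φ p (M 0 1) : ℂ)) = M 1 0
    rw [redC_star (lift φ p (M 0 1)).2, redC_lift]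
    exact this
  · simp [redM, hermMat, h2, -ZMod.natCast_val]

/-- The relation forces w = λu with λ = w_j/u_j for any nonzero u_j, and the case i = j shows that λ
is fixed by conjugation, hence lies in the prime field. -/
theorem exists_ratio (h : Prime (p : intRing φ)) {u w : Fin 2 → ResidueRing φ p}
    (huw : ∀ i j, u i * star (w j) = w i * star (u j)) (hu : u ≠ 0) :
    ∃ b : ZMod p, ∀ i, star (w i) = (b.val : ResidueRing φ p) * star (u i) := by
  have := isDomain_residueRing φ p h
  obtain ⟨j, hj⟩ : ∃ j, u j ≠ 0 := by
    by_contra hcon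
    push Not at hcon
    exact hu (funext hcon)
  obtain ⟨z, hz⟩ := exists_mul_eq_one hj
  have hz' : star (u j) * star z = 1 := by
    rw [mul_comm, ← star_mul, hz, star_one]
  have hl : star (w j * z) = w j * z := by
    rw [star_mul]
    linear_combination (-star z * star (w j)) * hz + z * star z * huw j j + w j * z * hz'
  obtain ⟨b, hb⟩ := exists_zmod_of_star_eq h hl
  refine ⟨b, fun i => ?_⟩
  have hi : w i = u i * (w j * z) := by
    rw [← hl, star_mul]
    linear_combination (-w i) * hz' - star z * huw i j
  rw [← hb, ← hl, ← mul_comm (star (u i)), ← star_mul, hi]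
  congr 1
  ring

/-- The rank of a modulo p selects the family. If a is invertible, a⁻¹b is hermitian and supplies B;
if a vanishes, A = p works; in rank one, V moves the kernel of a into the second column and
`exists_ratio` supplies the remaining parameter. -/
theorem exists_coset (h : Prime (p : intRing φ)) {a b : Matrix (Fin 2) (Fin 2) ℂ} (ha : IsInt φ a)
    (hb : IsInt φ b) (hab : a * bᴴ = b * aᴴ) : ∃ i : CosetIndex φ p,
      DvdInt φ p (repB φ p i * aᴴ - repA φ p i * bᴴ) ∧ DvdInt φ p (repE φ p i * aᴴ) := by
  have := isDomain_residueRing φ p h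
  set α := redM φ p a with hα
  set β := redM φ p b with hβ
  have hαβ : α * βᴴ = β * αᴴ := by
    have := congrArg (redM φ p) hab
    rwa [redM_mul ha hb.conjTranspose, redM_mul hb ha.conjTranspose, redM_conjTranspose ha,
      redM_conjTranspose hb] at this
  have key : ∀ i : CosetIndex φ p, redM φ p (repB φ p i) * αᴴ = redM φ p (repA φ p i) * βᴴ →
      redM φ p (repE φ p i) * αᴴ = 0 →
      DvdInt φ p (repB φ p i * aᴴ - repA φ p i * bᴴ) ∧ DvdInt φ p (repE φ p i * aᴴ) := by
    intro i h1 h2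
    have iA := (isInt_repA φ p i).mul hb.conjTranspose
    have iB := (isInt_repB φ p i).mul ha.conjTranspose
    have iE := (isInt_repE φ p i).mul ha.conjTranspose
    rw [dvdInt_iff (iB.sub iA), dvdInt_iff iE, redM_sub iB iA,
      redM_mul (isInt_repA φ p i) hb.conjTranspose, redM_mul (isInt_repB φ p i) ha.conjTranspose,
      redM_mul (isInt_repE φ p i) ha.conjTranspose, redM_conjTranspose ha, redM_conjTranspose hb,
      ← hα, ← hβ, h1, h2, sub_self]
    exact ⟨rfl, rfl⟩
  have hps : redM φ p ((p : ℂ) • (1 : Matrix (Fin 2) (Fin 2) ℂ)) = 0 := by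
    rw [smul_one_eq_diagonal, redM_diagonal]; simp
  by_cases hdet : α.det = 0
  · by_cases hα0 : α = 0
    · refine ⟨.inr (.inl ()), key _ ?_ ?_⟩
      · rw [hα0]
        change _ = redM φ p ((p : ℂ) • (1 : Matrix (Fin 2) (Fin 2) ℂ)) * _
        rw [hps]; simp
      · rw [hα0]; simp
    · obtain ⟨o, ho0, ho1⟩ := exists_line h hdet
      have iV := isInt_lineMat φ p o
      have iW := isInt_lineMatInv φ p o
      set V := redM φ p (lineMat φ p o) with hV
      set W := redM φ p (lineMatInv φ p o) with hW
      have hVW : V * W = 1 := by rw [hV, hW, ← redM_mul iV iW, lineMat_mul, redM_one]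
      have hVW' : Wᴴ * Vᴴ = 1 := by rw [← conjTranspose_mul, hVW, conjTranspose_one]
      set α' := α * V with hα'
      set β' := β * Wᴴ with hβ'
      -- The substitution a ↦ aV, b ↦ b(V⁻¹)^* preserves the relation ab^* = ba^*. As the second
      -- column of aV vanishes, the relation then involves first columns only.
      have hrel : α' * β'ᴴ = β' * α'ᴴ := by
        rw [hα', hβ', conjTranspose_mul, conjTranspose_mul, conjTranspose_conjTranspose,
          Matrix.mul_assoc, ← Matrix.mul_assoc V, hVW, Matrix.one_mul, hαβ, Matrix.mul_assoc,
          ← Matrix.mul_assoc Wᴴ, hVW', Matrix.one_mul]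
      have hcol : ∀ i, α' i 1 = 0 := by intro i; fin_cases i <;> assumption
      obtain ⟨c, hc⟩ := exists_ratio h (u := fun i => α' i 0) (w := fun i => β' i 0) (by
        intro i j
        have := congrFun (congrFun hrel i) j
        simpa [mul_apply, hcol] using this) (by
        intro h0
        apply hα0
        have h1 : α' = 0 := by
          ext i j
          fin_cases j
          · exact congrFun h0 i
          · exact hcol i
        have h2 : α = α' * W := by rw [hα', Matrix.mul_assoc, hVW, Matrix.mul_one]
        rw [h2, h1, Matrix.zero_mul])
      have iD : ∀ x y : ℕ, IsInt φ (diagonal ![(x : ℂ), (y : ℂ)]) := fun x y =>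
        isInt_diagonal fun i => by fin_cases i <;> exact natCast_mem _ _
      have e4 : Vᴴ * αᴴ = α'ᴴ := by rw [hα', conjTranspose_mul]
      refine ⟨.inr (.inr (o, c)), key _ ?_ ?_⟩
      · simp only [repA, repB]
        have e1 := iD c.val 0
        have e2 := iD 1 p
        rw [Nat.cast_zero] at e1
        rw [Nat.cast_one] at e2
        rw [redM_mul e1 iV.conjTranspose, redM_conjTranspose iV, redM_mul e2 iW, Matrix.mul_assoc,
          Matrix.mul_assoc]
        have e3 : W * βᴴ = β'ᴴ := by rw [hβ', conjTranspose_mul, conjTranspose_conjTranspose]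
        rw [← hW, e3, ← hV, e4, redM_diagonal, redM_diagonal]
        ext i j
        fin_cases i
        · simpa [diagonal_mul, -ZMod.natCast_val] using (hc j).symm
        · simp [diagonal_mul]
      · simp only [repE]
        have e2 := iD p 1
        rw [Nat.cast_one] at e2
        rw [redM_mul e2 iV.conjTranspose, redM_conjTranspose iV, Matrix.mul_assoc,
          ← hV, e4, redM_diagonal]
        ext i j
        fin_cases i
        · simp [diagonal_mul]
        · have := hcol j
          simp [diagonal_mul, this]
  · obtain ⟨z, hz⟩ := exists_mul_eq_one hdet
    have hu : IsUnit α.det := IsUnit.of_mul_eq_one z hz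
    have h1 : α * α⁻¹ = 1 := mul_nonsing_inv _ hu
    have h2 : α⁻¹ * α = 1 := nonsing_inv_mul _ hu
    have h3 : αᴴ * α⁻¹ᴴ = 1 := by rw [← conjTranspose_mul, h2, conjTranspose_one]
    have h4 : α⁻¹ * β = βᴴ * α⁻¹ᴴ := by
      calc α⁻¹ * β = α⁻¹ * (β * αᴴ) * α⁻¹ᴴ := by
            rw [Matrix.mul_assoc, Matrix.mul_assoc β, h3, Matrix.mul_one]
        _ = βᴴ * α⁻¹ᴴ := by rw [← hαβ, ← Matrix.mul_assoc, h2, Matrix.one_mul]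
    obtain ⟨c, hc⟩ := exists_hermMat h (M := α⁻¹ * β) (by rw [conjTranspose_mul, h4])
    refine ⟨.inl c, key _ ?_ ?_⟩
    · simp only [repA, repB]
      rw [hc, redM_one, Matrix.one_mul, Matrix.mul_assoc, ← hαβ, ← Matrix.mul_assoc, h2,
        Matrix.one_mul]
    · simp only [repE]
      rw [hps, Matrix.zero_mul]

variable {N : ℕ}

/-- The lower blocks of diag(1, p)γ are multiples of p, so two of the four divisibility conditions
are automatic and only the upper blocks of γ matter. -/
theorem exists_mk_eq_mk_rep (h : Prime (p : intRing φ)) (hpN : Nat.Coprime p N) {γ : GUPos 2}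
    (hγ : γ ∈ Gamma0 φ 2 N) : ∃ i : CosetIndex φ p,
      Quotient.mk (QuotientGroup.rightRel (Gamma0 φ 2 N)) (diagElt 2 hpf.out.pos * γ)
        = Quotient.mk (QuotientGroup.rightRel (Gamma0 φ 2 N)) (rep φ hpf.out.pos i) := by
  obtain ⟨hint, hJ, hN⟩ := hγ
  have hm : HasMultiplier γ 1 := by simpa [HasMultiplier] using hJ
  set a := γ.val.val.toBlocks₁₁ with ha
  set b := γ.val.val.toBlocks₁₂ with hb
  set c := γ.val.val.toBlocks₂₁ with hc
  set d := γ.val.val.toBlocks₂₂ with hd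
  have eγ : γ.val.val = fromBlocks a b c d := (fromBlocks_toBlocks _).symm
  have ia : IsInt φ a := fun i j => hint _ _
  have ib : IsInt φ b := fun i j => hint _ _
  have ic : IsInt φ c := fun i j => hint _ _
  have id' : IsInt φ d := fun i j => hint _ _
  have hab : a * bᴴ = b * aᴴ := by
    have h1 := mul_inv_val γ
    rw [hm.inv_val one_ne_zero, ← ha, ← hb, ← hc, ← hd, eγ, inv_one, one_smul, fromBlocks_multiply,
      ← fromBlocks_one, fromBlocks_inj] at h1
    have h2 := h1.2.1
    rw [Matrix.mul_neg, neg_add_eq_zero] at h2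
    exact h2
  obtain ⟨i, h1, h2⟩ := exists_coset h ia ib hab
  refine ⟨i, ?_⟩
  have eh : (diagElt 2 hpf.out.pos * γ).val.val
      = fromBlocks a b ((p : ℂ) • c) ((p : ℂ) • d) := by
    change fromBlocks 1 0 0 ((p : ℂ) • 1) * γ.val.val = _
    rw [eγ, fromBlocks_multiply]
    simp
  have hmh : HasMultiplier (diagElt 2 hpf.out.pos * γ) p := by
    simpa using (hasMultiplier_diagElt hpf.out.pos).mul hm
  rw [mk_eq_mk_iff φ hpf.out.pos hpN (hasMultiplier_rep φ hpf.out.pos i) hmh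
    (rep_val φ hpf.out.pos i) eh (isInt_repE φ p i)]
  · refine ⟨?_, h1, ?_, h2⟩
    · rw [conjTranspose_smul, conjTranspose_smul, star_natCast, Matrix.mul_smul, Matrix.mul_smul,
        ← smul_sub]
      exact (((isInt_repA φ p i).mul id'.conjTranspose).sub
        ((isInt_repB φ p i).mul ic.conjTranspose)).dvdInt_natCast_smul p
    · rw [conjTranspose_smul, star_natCast, Matrix.mul_smul]
      exact ((isInt_repE φ p i).mul ic.conjTranspose).dvdInt_natCast_smul p
  · intro i j
    obtain ⟨x, hx, e⟩ := hN i j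
    refine ⟨p * x, mul_mem (natCast_mem _ _) hx, ?_⟩
    have : c i j = N * x := e
    rw [Matrix.smul_apply, this, smul_eq_mul]
    ring

theorem dvd_of_mk_rep_eq (hpN : Nat.Coprime p N) {i j : CosetIndex φ p}
    (hij : Quotient.mk (QuotientGroup.rightRel (Gamma0 φ 2 N)) (rep φ hpf.out.pos j)
        = Quotient.mk (QuotientGroup.rightRel (Gamma0 φ 2 N)) (rep φ hpf.out.pos i)) :
    redM φ p (repB φ p i * (repA φ p j)ᴴ - repA φ p i * (repB φ p j)ᴴ) = 0 ∧
      redM φ p (repE φ p i * (repA φ p j)ᴴ) = 0 := by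
  rw [mk_eq_mk_iff φ hpf.out.pos hpN (hasMultiplier_rep φ hpf.out.pos i)
    (hasMultiplier_rep φ hpf.out.pos j) (rep_val φ hpf.out.pos i) (rep_val φ hpf.out.pos j)
    (isInt_repE φ p i) (fun i j => ⟨0, zero_mem _, by simp⟩)] at hij
  have iA := (isInt_repB φ p i).mul (isInt_repA φ p j).conjTranspose
  have iB := (isInt_repA φ p i).mul (isInt_repB φ p j).conjTranspose
  have iE := (isInt_repE φ p i).mul (isInt_repA φ p j).conjTranspose
  exact ⟨(dvdInt_iff (iA.sub iB)).mp hij.2.1, (dvdInt_iff iE).mp hij.2.2.2⟩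

theorem zmod_eq_of_val_eq (h : Prime (p : intRing φ)) {a b : ZMod p}
    (hab : (a.val : ResidueRing φ p) = b.val) : a = b := by
  have := charP_residueRing φ p h
  exact ZMod.val_injective p (CharP.natCast_injOn_Iio (ResidueRing φ p) p (ZMod.val_lt a) (ZMod.val_lt b) hab)

/-- Equality of cosets gives E_iA_j^* ≡ 0 and E_jA_i^* ≡ 0 modulo p. One of these fails for indices
from different families; for two lines they force the lines to agree. Within one pair of diagonal
blocks the congruence for B decides. -/
theorem injective_mk_rep (h : Prime (p : intRing φ)) (hpN : Nat.Coprime p N) :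
    Function.Injective fun i : CosetIndex φ p =>
      Quotient.mk (QuotientGroup.rightRel (Gamma0 φ 2 N)) (rep φ hpf.out.pos i) := by
  have := isDomain_residueRing φ p h
  have hneg : redC φ p (-1) = -1 := by rw [redC_neg (one_mem _), redC_one]
  intro j i hij
  obtain ⟨h1, h2⟩ := dvd_of_mk_rep_eq hpN hij
  obtain ⟨-, h4⟩ := dvd_of_mk_rep_eq hpN hij.symm
  rcases i with b | u | ⟨o, b⟩ <;> rcases j with b' | u' | ⟨o', b'⟩
  · simp only [repB, repA, conjTranspose_one, Matrix.mul_one, Matrix.one_mul,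
      hermMat_conjTranspose] at h1
    rw [redM_sub (isInt_hermMat φ p b) (isInt_hermMat φ p b'), sub_eq_zero] at h1
    have e1 := congrFun (congrFun h1 0) 0
    have e2 := congrFun (congrFun h1 1) 1
    have e3 := congrFun (congrFun h1 0) 1
    simp [redM, hermMat, -ZMod.natCast_val] at e1 e2 e3
    rw [Sum.inl.injEq, Prod.ext_iff, Prod.ext_iff]
    exact ⟨(zmod_eq_of_val_eq h e1).symm, (zmod_eq_of_val_eq h e2).symm, e3.symm⟩
  · exfalso
    have e := congrFun (congrFun h4 0) 0
    simp [redM, repE, repA] at e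
  · exfalso
    cases o' with
    | none =>
      have e := congrFun (congrFun h4 1) 0
      simp [redM, repE, repA, lineMat] at e
    | some x =>
      have e := congrFun (congrFun h4 1) 1
      simp [redM, repE, repA, lineMat] at e
  · exfalso
    have e := congrFun (congrFun h2 0) 0
    simp [redM, repE, repA] at e
  · rfl
  · exfalso
    cases o' with
    | none =>
      have e := congrFun (congrFun h2 1) 0
      simp [redM, repE, repA, lineMatInv, hneg] at e
    | some x =>
      have e := congrFun (congrFun h2 0) 0
      simp [redM, repE, repA, lineMatInv] at e
  · exfalso
    cases o with
    | none =>
      have e := congrFun (congrFun h2 1) 0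
      simp [redM, repE, repA, lineMat] at e
    | some x =>
      have e := congrFun (congrFun h2 1) 1
      simp [redM, repE, repA, lineMat] at e
  · exfalso
    cases o with
    | none =>
      have e := congrFun (congrFun h4 1) 0
      simp [redM, repE, repA, lineMatInv, hneg] at e
    | some x =>
      have e := congrFun (congrFun h4 0) 0
      simp [redM, repE, repA, lineMatInv] at e
  · have ho : o' = o := by
      -- This entry is the conjugate of the upper right entry of V_{o'}⁻¹V_o, which vanishes modulo
      -- p exactly when the second columns span the same line.
      have e := congrFun (congrFun h2 1) 0
      cases o with
      | none =>
        cases o' with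
        | none => rfl
        | some y =>
          exfalso
          simp [redM, repE, repA, lineMat, lineMatInv, mul_apply] at e
      | some x =>
        cases o' with
        | none =>
          exfalso
          simp [redM, repE, repA, lineMat, lineMatInv, mul_apply, hneg] at e
        | some y =>
          simp [redM, repE, repA, lineMat, lineMatInv, mul_apply] at e
          have ix := conj_mem_intRing φ (lift φ p x).2
          have iy := conj_mem_intRing φ (lift φ p y).2
          rw [← sub_eq_add_neg] at e
          change redC φ p (star (lift φ p x : ℂ) - star (lift φ p y : ℂ)) = 0 at e
          rw [redC_sub ix iy, redC_star (lift φ p x).2, redC_star (lift φ p y).2, redC_lift,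
            redC_lift, sub_eq_zero] at e
          rw [star_injective e]
    subst ho
    have hb : (b.val : ResidueRing φ p) = b'.val := by
      have e1 : repB φ p (.inr (.inr (o', b))) * (repA φ p (.inr (.inr (o', b'))))ᴴ
          = diagonal ![(b.val : ℂ), 0] := by
        simp only [repA, repB]
        rw [conjTranspose_mul, Matrix.mul_assoc, ← Matrix.mul_assoc (lineMat φ p o')ᴴ,
          lineMat_conjTranspose_mul, Matrix.one_mul, diagonal_conjTranspose, diagonal_mul_diagonal]
        congr 1; funext i; fin_cases i <;> simp
      have e2 : repA φ p (.inr (.inr (o', b))) * (repB φ p (.inr (.inr (o', b'))))ᴴ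
          = diagonal ![(b'.val : ℂ), 0] := by
        simp only [repA, repB]
        rw [conjTranspose_mul, conjTranspose_conjTranspose, Matrix.mul_assoc,
          ← Matrix.mul_assoc (lineMatInv φ p o'), lineMatInv_mul, Matrix.one_mul,
          diagonal_conjTranspose, diagonal_mul_diagonal]
        congr 1; funext i; fin_cases i <;> simp [-ZMod.natCast_val]
      rw [e1, e2, diagonal_sub, redM_diagonal] at h1
      have e := congrFun (congrFun h1 0) 0
      rw [diagonal_apply_eq, Matrix.zero_apply] at e
      change redC φ p ((b.val : ℂ) - (b'.val : ℂ)) = 0 at e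
      rwa [redC_sub (natCast_mem _ _) (natCast_mem _ _), redC_natCast, redC_natCast,
        sub_eq_zero] at e
    rw [zmod_eq_of_val_eq h hb]

theorem bijOn_mk_rep (h : Prime (p : intRing φ)) (hpN : Nat.Coprime p N) :
    Set.BijOn (fun i : CosetIndex φ p =>
      Quotient.mk (QuotientGroup.rightRel (Gamma0 φ 2 N)) (rep φ hpf.out.pos i)) Set.univ
      (heckeCosets (Gamma0 φ 2 N) (diagElt 2 hpf.out.pos)) := by
  refine ⟨fun i _ => ?_, (injective_mk_rep h hpN).injOn, ?_⟩
  · exact mk_mem_heckeCosets_iff.mpr (rep_mem_doubleCoset φ hpf.out.pos hpN i)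
  · intro c hc
    induction c using Quotient.inductionOn with | _ g =>
    obtain ⟨a, ha, b, hb, rfl⟩ := mk_mem_heckeCosets_iff.mp hc
    obtain ⟨i, hi⟩ := exists_mk_eq_mk_rep h hpN hb
    refine ⟨i, Set.mem_univ _, ?_⟩
    dsimp only
    rw [← hi]
    refine Quotient.sound (QuotientGroup.rightRel_apply.mpr ?_)
    simpa [mul_assoc] using ha

theorem finite_heckeCosets (h : Prime (p : intRing φ)) (hpN : Nat.Coprime p N) :
    (heckeCosets (Gamma0 φ 2 N) (diagElt 2 hpf.out.pos)).Finite := by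
  rw [← (bijOn_mk_rep h hpN).image_eq]
  exact Set.finite_univ.image _

end Cosets

/-! ### Holomorphy -/

section Holomorphy

variable {n : ℕ}

theorem IsHolomorphic.finset_sum {ι : Type*} {s : Finset ι} {f : ι → HH n → ℂ}
    (h : ∀ i ∈ s, IsHolomorphic (f i)) : IsHolomorphic (∑ i ∈ s, f i) := by
  classical
  have h1 := DifferentiableOn.fun_sum (u := s) h
  refine h1.congr fun z hz => ?_
  have hz' : Matrix.of z ∈ upperHalf n := hz
  simp [hz', Finset.sum_apply]

theorem denom_of_fromBlocks {g : GUPos n} {A B E : Matrix (Fin n) (Fin n) ℂ}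
    (hg : g.val.val = fromBlocks A B 0 E) (Z : Matrix (Fin n) (Fin n) ℂ) : denom g Z = E := by
  simp [denom, hg]

theorem num_of_fromBlocks {g : GUPos n} {A B E : Matrix (Fin n) (Fin n) ℂ}
    (hg : g.val.val = fromBlocks A B 0 E) (Z : Matrix (Fin n) (Fin n) ℂ) :
    num g Z = A * Z + B := by
  simp [num, hg]

/-- With C = 0 the automorphy factor is the constant det E and the action on Z is affine. -/
theorem IsHolomorphic.slash_of_fromBlocks {k : ℕ} {g : GUPos n} {A B E : Matrix (Fin n) (Fin n) ℂ}
    (hg : g.val.val = fromBlocks A B 0 E) {F : HH n → ℂ} (hF : IsHolomorphic F) :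
    IsHolomorphic (slash k g F) := by
  classical
  set w : (Fin n → Fin n → ℂ) → (Fin n → Fin n → ℂ) :=
    fun z => Matrix.of.symm ((A * Matrix.of z + B) * E⁻¹) with hw
  have hwd : Differentiable ℂ w := by
    rw [differentiable_pi]
    intro i
    rw [differentiable_pi]
    intro j
    have : (fun z => w z i j)
        = fun z => ∑ l, (∑ m, A i m * z m l + B i l) * E⁻¹ l j := by
      funext z
      simp [hw, mul_apply]
    rw [this]
    fun_prop
  have hmaps : ∀ z : Fin n → Fin n → ℂ, ∀ h : Matrix.of z ∈ upperHalf n,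
      (mobius g ⟨Matrix.of z, h⟩).val = Matrix.of (w z) := by
    intro z h
    change num g (Matrix.of z) * (denom g (Matrix.of z))⁻¹ = _
    rw [denom_of_fromBlocks hg, num_of_fromBlocks hg]
    rfl
  have h1 := DifferentiableOn.comp (g := fun z : Fin n → Fin n → ℂ =>
      if h : Matrix.of z ∈ upperHalf n then F ⟨Matrix.of z, h⟩ else 0) hF
      (hwd.differentiableOn (s := {z | Matrix.of z ∈ upperHalf n}))
      (fun z hz => by
        change Matrix.of (w z) ∈ upperHalf n
        rw [← hmaps z hz]
        exact (mobius g ⟨Matrix.of z, hz⟩).2)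
  refine (h1.const_mul (E.det ^ (-(k : ℤ)))).congr fun z hz => ?_
  have hz' : Matrix.of z ∈ upperHalf n := hz
  have hz2 : Matrix.of (w z) ∈ upperHalf n := by
    rw [← hmaps z hz]
    exact (mobius g ⟨Matrix.of z, hz⟩).2
  simp only [hz', dif_pos, Function.comp, hz2, slash, autFactor, denom_of_fromBlocks hg]
  congr 2
  exact Subtype.ext (hmaps z hz')

end Holomorphy

/-! ### Character sums -/

/-- The function `x ↦ e^{2πix}`. -/
def expTwoPi (x : ℂ) : ℂ := Complex.exp (2 * Real.pi * Complex.I * x)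

theorem expTwoPi_add (x y : ℂ) : expTwoPi (x + y) = expTwoPi x * expTwoPi y := by
  rw [expTwoPi, mul_add, Complex.exp_add]; rfl

theorem expTwoPi_zero : expTwoPi 0 = 1 := by simp [expTwoPi]

theorem expTwoPi_eq_one_iff (x : ℂ) : expTwoPi x = 1 ↔ ∃ n : ℤ, x = n := by
  rw [expTwoPi, Complex.exp_eq_one_iff]
  refine exists_congr fun n => ?_
  rw [mul_comm (n : ℂ)]
  exact mul_right_inj' Complex.two_pi_I_ne_zero

theorem sum_expTwoPi_zmod (p : ℕ) [NeZero p] (l : ℤ) :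
    ∑ b : ZMod p, expTwoPi ((p : ℂ)⁻¹ * (l * (b.val : ℂ))) = if (p : ℤ) ∣ l then (p : ℂ) else 0 := by
  have h1 := AddChar.sum_mulShift (l : ZMod p) (ZMod.isPrimitive_stdAddChar p)
  simp only [ZMod.card, ZMod.intCast_zmod_eq_zero_iff_dvd, Nat.cast_ite, Nat.cast_zero] at h1
  rw [← h1]
  refine Finset.sum_congr rfl fun b _ => ?_
  have h2 : b * (l : ZMod p) = ((l * b.val : ℤ) : ZMod p) := by
    push_cast
    rw [ZMod.natCast_zmod_val, mul_comm]
  rw [h2, ZMod.stdAddChar_coe, expTwoPi]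
  congr 1
  push_cast
  ring

section Fourier

open NumberField

variable {K : Type*} [Field K] [NumberField K] [Algebra.IsQuadraticExtension ℚ K]
  [IsTotallyComplex K] {φ : K →+* ℂ} {p : ℕ} [hpf : Fact p.Prime]

/-- The integral alternating form `(x ȳ - x̄ y) / √-D` on the ring of integers. -/
def altForm (K : Type*) [Field K] [NumberField K] (x y : ℂ) : ℂ :=
  (x * star y - star x * y) / sqrtDisc K

theorem exists_altForm_eq {x y : ℂ} (hx : x ∈ intRing φ) (hy : y ∈ intRing φ) :
    ∃ s : ℤ, altForm K x y = s := by
  obtain ⟨s, hs⟩ := exists_alternating φ hx hy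
  exact ⟨s, by rw [altForm, hs, mul_div_cancel_right₀ _ sqrtDisc_ne_zero]⟩

theorem altForm_add (x y z : ℂ) : altForm K x (y + z) = altForm K x y + altForm K x z := by
  simp only [altForm, star_add]; ring

theorem altForm_natCast_mul (n : ℕ) (x y : ℂ) : altForm K x (n * y) = n * altForm K x y := by
  simp only [altForm, star_mul', star_natCast]; ring

theorem altForm_natCast_mul_left (n : ℕ) (x y : ℂ) : altForm K (n * x) y = n * altForm K x y := by
  simp only [altForm, star_mul', star_natCast]; ring

theorem expTwoPi_altForm_congr {x y z : ℂ} (hx : x ∈ intRing φ) (hz : z ∈ intRing φ) :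
    expTwoPi ((p : ℂ)⁻¹ * altForm K x (y + p * z)) = expTwoPi ((p : ℂ)⁻¹ * altForm K x y) := by
  have hp : (p : ℂ) ≠ 0 := by exact_mod_cast hpf.out.ne_zero
  obtain ⟨s, hs⟩ := exists_altForm_eq hx hz
  rw [altForm_add, altForm_natCast_mul, mul_add, inv_mul_cancel_left₀ hp, expTwoPi_add, hs,
    (expTwoPi_eq_one_iff s).mpr ⟨s, rfl⟩, mul_one]

/-- The character of `𝔬_K / p` defined by `altForm`. -/
def altChar {x : ℂ} (hx : x ∈ intRing φ) : AddChar (ResidueRing φ p) ℂ where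
  toFun y := expTwoPi ((p : ℂ)⁻¹ * altForm K x (lift φ p y))
  map_zero_eq_one' := by
    obtain ⟨z, hz, e⟩ := (red_eq_iff φ p (lift φ p 0) 0).mp (by rw [red_lift, map_zero])
    rw [e, expTwoPi_altForm_congr hx hz]
    simp [altForm, expTwoPi_zero]
  map_add_eq_mul' y y' := by
    obtain ⟨z, hz, e⟩ := (red_eq_iff φ p (lift φ p (y + y')) (lift φ p y + lift φ p y')).mp
      (by rw [map_add, red_lift, red_lift, red_lift])
    rw [e, expTwoPi_altForm_congr hx hz, Subring.coe_add, altForm_add, mul_add, expTwoPi_add]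

-- This is orthogonality of characters: the character is trivial exactly when p divides all values
-- of the alternating form at x, and then p divides x by unimodularity.
open Classical in
theorem sum_expTwoPi_altForm {x : ℂ} (hx : x ∈ intRing φ) :
    ∑ y : ResidueRing φ p, expTwoPi ((p : ℂ)⁻¹ * altForm K x (lift φ p y))
      = if ∃ z ∈ intRing φ, x = p * z then (p : ℂ) ^ 2 else 0 := by
  have hp : (p : ℂ) ≠ 0 := by exact_mod_cast hpf.out.ne_zero
  have h := AddChar.sum_eq_ite (altChar (p := p) hx)
  rw [fintype_card_residueRing] at h
  have h2 : altChar (p := p) hx = 0 ↔ ∃ z ∈ intRing φ, x = p * z := by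
    constructor
    · intro h0
      refine natCast_dvd_of_alternating φ hx p fun y hy => ?_
      obtain ⟨z, hz, e⟩ := (red_eq_iff φ p ⟨y, hy⟩ (lift φ p (red φ p ⟨y, hy⟩))).mp
        (by rw [red_lift])
      have h3 : expTwoPi ((p : ℂ)⁻¹ * altForm K x y) = 1 := by
        change y = _ at e
        rw [e, expTwoPi_altForm_congr hx hz]
        exact DFunLike.congr_fun h0 _
      obtain ⟨n, hn⟩ := (expTwoPi_eq_one_iff _).mp h3
      refine ⟨n, ?_⟩
      rw [inv_mul_eq_iff_eq_mul₀ hp, altForm, div_eq_iff sqrtDisc_ne_zero] at hn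
      exact hn
    · rintro ⟨z, hz, rfl⟩
      ext y
      change expTwoPi _ = 1
      obtain ⟨s, hs⟩ := exists_altForm_eq hz (lift φ p y).2
      rw [altForm_natCast_mul_left, inv_mul_cancel_left₀ hp, hs]
      exact (expTwoPi_eq_one_iff _).mpr ⟨s, rfl⟩
  simp only [h2, Nat.cast_pow] at h
  exact h

/-! ### The lattice `S_2` -/

variable (K) in
/-- The matrix `[l, a/√-D; *, m]`. -/
def s2Mat (l m : ℤ) (a : ℂ) : Matrix (Fin 2) (Fin 2) ℂ :=
  !![(l : ℂ), a / sqrtDisc K; star (a / sqrtDisc K), (m : ℂ)]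

@[simp] theorem s2Mat_zero_zero (l m : ℤ) (a : ℂ) : s2Mat K l m a 0 0 = l := rfl

@[simp] theorem s2Mat_zero_one (l m : ℤ) (a : ℂ) : s2Mat K l m a 0 1 = a / sqrtDisc K := rfl

@[simp] theorem s2Mat_one_zero (l m : ℤ) (a : ℂ) :
    s2Mat K l m a 1 0 = star (a / sqrtDisc K) := rfl

@[simp] theorem s2Mat_one_one (l m : ℤ) (a : ℂ) : s2Mat K l m a 1 1 = m := rfl

theorem mem_S2_iff {T : Matrix (Fin 2) (Fin 2) ℂ} :
    T ∈ S2 φ ↔ ∃ (l m : ℤ), ∃ a ∈ intRing φ, T = s2Mat K l m a := by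
  constructor
  · rintro ⟨l, m, t, ⟨a, ha, rfl⟩, rfl⟩
    exact ⟨l, m, a, ha, rfl⟩
  · rintro ⟨l, m, a, ha, rfl⟩
    exact ⟨l, m, _, ⟨a, ha, rfl⟩, rfl⟩

theorem inv_smul_s2Mat_mem_iff {n : ℕ} (hn : n ≠ 0) (l m : ℤ) {a : ℂ} :
    (n : ℂ)⁻¹ • s2Mat K l m a ∈ S2 φ ↔
      (n : ℤ) ∣ l ∧ (n : ℤ) ∣ m ∧ ∃ z ∈ intRing φ, a = n * z := by
  have hn' : (n : ℂ) ≠ 0 := by exact_mod_cast hn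
  rw [mem_S2_iff]
  constructor
  · rintro ⟨l', m', a', ha', e⟩
    rw [inv_smul_eq_iff₀ hn'] at e
    have e1 := congrFun (congrFun e 0) 0
    have e2 := congrFun (congrFun e 1) 1
    have e3 := congrFun (congrFun e 0) 1
    simp only [Matrix.smul_apply, smul_eq_mul, s2Mat_zero_zero, s2Mat_zero_one,
      s2Mat_one_one] at e1 e2 e3
    refine ⟨⟨l', by exact_mod_cast e1⟩, ⟨m', by exact_mod_cast e2⟩, a', ha', ?_⟩
    rw [mul_div_assoc', div_left_inj' sqrtDisc_ne_zero] at e3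
    exact e3
  · rintro ⟨⟨l', rfl⟩, ⟨m', rfl⟩, a', ha', rfl⟩
    refine ⟨l', m', a', ha', ?_⟩
    rw [inv_smul_eq_iff₀ hn']
    ext i j
    fin_cases i <;> fin_cases j <;> simp [mul_div_assoc]

/-- Conjugation negates √-D, so the two off-diagonal products combine into the integral alternating
form. The character sum over hermitian matrices therefore splits into three independent sums. -/
theorem trace_s2Mat_mul (l m : ℤ) (a b₁ b₂ β : ℂ) :
    (s2Mat K l m a * !![b₁, β; star β, b₂]).trace = l * b₁ + m * b₂ + altForm K a β := by
  have h : star (a / sqrtDisc K) = - (star a / sqrtDisc K) := by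
    rw [star_div₀, star_sqrtDisc, div_neg]
  rw [s2Mat, h, altForm, trace_fin_two]
  simp only [mul_apply, Fin.sum_univ_two, of_apply, cons_val', cons_val_zero, cons_val_one,
    cons_val_fin_one]
  ring

open Classical in
theorem sum_expTwoPi_hermMat {T : Matrix (Fin 2) (Fin 2) ℂ} (hT : T ∈ S2 φ) :
    ∑ b, expTwoPi ((p : ℂ)⁻¹ * (T * hermMat φ p b).trace)
      = if (p : ℂ)⁻¹ • T ∈ S2 φ then (p : ℂ) ^ 4 else 0 := by
  obtain ⟨l, m, a, ha, rfl⟩ := mem_S2_iff.mp hT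
  have h1 := sum_expTwoPi_zmod p l
  have h2 := sum_expTwoPi_zmod p m
  have h3 := sum_expTwoPi_altForm (p := p) ha
  simp only [Fintype.sum_prod_type, hermMat, trace_s2Mat_mul, mul_add, expTwoPi_add,
    ← Finset.mul_sum, ← Finset.sum_mul, h1, h2, h3]
  simp only [inv_smul_s2Mat_mem_iff hpf.out.ne_zero]
  by_cases c1 : (p : ℤ) ∣ l
  · by_cases c2 : (p : ℤ) ∣ m
    · by_cases c3 : ∃ z ∈ intRing φ, a = p * z
      · rw [if_pos c1, if_pos c2, if_pos c3, if_pos ⟨c1, c2, c3⟩]; ring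
      · simp [c3]
    · simp [c2]
  · simp [c1]

end Fourier

/-! ### The Fourier expansion of `F | T_p` -/

section Expansion

open NumberField

variable {K : Type*} [Field K] [NumberField K] [Algebra.IsQuadraticExtension ℚ K]
  [IsTotallyComplex K] {φ : K →+* ℂ} {p : ℕ} [hpf : Fact p.Prime]

open Classical in
/-- Fourier coefficients, extended by zero to all matrices. -/
def extCoeff (c : S2 φ → ℂ) (T : Matrix (Fin 2) (Fin 2) ℂ) : ℂ :=
  if h : T ∈ S2 φ then c ⟨T, h⟩ else 0

theorem extCoeff_of_mem (c : S2 φ → ℂ) {T : Matrix (Fin 2) (Fin 2) ℂ} (h : T ∈ S2 φ) :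
    extCoeff c T = c ⟨T, h⟩ := dif_pos h

theorem extCoeff_of_notMem (c : S2 φ → ℂ) {T : Matrix (Fin 2) (Fin 2) ℂ} (h : T ∉ S2 φ) :
    extCoeff c T = 0 := dif_neg h

/-- The substitution `indexEquiv` need not preserve S_2. After extension by zero to all complex
matrices it is a bijection of the index set. -/
theorem HasFourierExpansion.hasSum_matrix {F : HH 2 → ℂ} {c : S2 φ → ℂ}
    (h : HasFourierExpansion φ F c) (Z : HH 2) :
    HasSum (fun T : Matrix (Fin 2) (Fin 2) ℂ => extCoeff c T * expTwoPi (T * Z.val).trace)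
      (F Z) := by
  classical
  have h1 := h Z
  have h2 : (fun T : S2 φ => c T * Complex.exp (2 * Real.pi * Complex.I * (T.val * Z.val).trace))
      = (fun T : Matrix (Fin 2) (Fin 2) ℂ => extCoeff c T * expTwoPi (T * Z.val).trace)
        ∘ Subtype.val := by
    funext T
    simp only [Function.comp, extCoeff_of_mem c T.2, expTwoPi]
  rw [h2, hasSum_subtype_iff_indicator] at h1
  convert h1 using 1
  funext T
  by_cases hT : T ∈ S2 φ
  · rw [Set.indicator_of_mem hT]
  · rw [Set.indicator_of_notMem hT, extCoeff_of_notMem c hT, zero_mul]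

theorem repE_mul_repA_conjTranspose (i : CosetIndex φ p) :
    repE φ p i * (repA φ p i)ᴴ = (p : ℂ) • 1 := by
  have hp : (p : ℂ) ≠ 0 := by exact_mod_cast hpf.out.ne_zero
  have h1 : ((p : ℂ)⁻¹ • (repA φ p i)ᴴ) * repE φ p i = 1 := by
    rw [Matrix.smul_mul, repA_conjTranspose_mul_repE, smul_smul, inv_mul_cancel₀ hp, one_smul]
  have h2 := mul_eq_one_comm.mp h1
  rw [Matrix.mul_smul, inv_smul_eq_iff₀ hp] at h2
  exact h2

theorem repA_mul_repE_conjTranspose (i : CosetIndex φ p) :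
    repA φ p i * (repE φ p i)ᴴ = (p : ℂ) • 1 := by
  have := congrArg conjTranspose (repE_mul_repA_conjTranspose (φ := φ) (p := p) i)
  simpa [conjTranspose_mul] using this

theorem repE_conjTranspose_mul_repA (i : CosetIndex φ p) :
    (repE φ p i)ᴴ * repA φ p i = (p : ℂ) • 1 := by
  have := congrArg conjTranspose (repA_conjTranspose_mul_repE φ p i)
  simpa [conjTranspose_mul] using this

theorem repE_inv (i : CosetIndex φ p) : (repE φ p i)⁻¹ = (p : ℂ)⁻¹ • (repA φ p i)ᴴ := by
  have hp : (p : ℂ) ≠ 0 := by exact_mod_cast hpf.out.ne_zero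
  apply inv_eq_right_inv
  rw [Matrix.mul_smul, repE_mul_repA_conjTranspose, smul_smul, inv_mul_cancel₀ hp, one_smul]

/-- The substitution on Fourier indices induced by a representative. -/
def indexEquiv (i : CosetIndex φ p) :
    Matrix (Fin 2) (Fin 2) ℂ ≃ Matrix (Fin 2) (Fin 2) ℂ where
  toFun T := (p : ℂ)⁻¹ • (repE φ p i * T * (repE φ p i)ᴴ)
  invFun T := (p : ℂ)⁻¹ • ((repA φ p i)ᴴ * T * repA φ p i)
  left_inv T := by
    have hp : (p : ℂ) ≠ 0 := by exact_mod_cast hpf.out.ne_zero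
    dsimp only
    rw [Matrix.mul_smul, Matrix.smul_mul, smul_smul]
    have : (repA φ p i)ᴴ * (repE φ p i * T * (repE φ p i)ᴴ) * repA φ p i
        = ((repA φ p i)ᴴ * repE φ p i) * T * ((repE φ p i)ᴴ * repA φ p i) := by
      simp only [Matrix.mul_assoc]
    rw [this, repA_conjTranspose_mul_repE, repE_conjTranspose_mul_repA, Matrix.smul_mul,
      Matrix.one_mul, Matrix.mul_smul, Matrix.mul_one, smul_smul, smul_smul]
    field_simp
    simp
  right_inv T := by
    have hp : (p : ℂ) ≠ 0 := by exact_mod_cast hpf.out.ne_zero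
    dsimp only
    rw [Matrix.mul_smul, Matrix.smul_mul, smul_smul]
    have : repE φ p i * ((repA φ p i)ᴴ * T * repA φ p i) * (repE φ p i)ᴴ
        = (repE φ p i * (repA φ p i)ᴴ) * T * (repA φ p i * (repE φ p i)ᴴ) := by
      simp only [Matrix.mul_assoc]
    rw [this, repE_mul_repA_conjTranspose, repA_mul_repE_conjTranspose, Matrix.smul_mul,
      Matrix.one_mul, Matrix.mul_smul, Matrix.mul_one, smul_smul, smul_smul]
    field_simp
    simp

/-- Since E⁻¹ = p⁻¹A^*, one has gZ = p⁻¹(AZA^* + BA^*). The index T' of F therefore contributes at T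
= p⁻¹A^*T'A, that is T' = p⁻¹ETE^*, with a factor in which B enters only through a character. -/
theorem hasSum_slash_rep {F : HH 2 → ℂ} {c : S2 φ → ℂ} (h : HasFourierExpansion φ F c) (k : ℕ)
    (i : CosetIndex φ p) (Z : HH 2) :
    HasSum (fun T : Matrix (Fin 2) (Fin 2) ℂ => (repE φ p i).det ^ (-(k : ℤ)) *
      extCoeff c (indexEquiv i T) *
        expTwoPi ((p : ℂ)⁻¹ * (indexEquiv i T * (repB φ p i * (repA φ p i)ᴴ)).trace) *
          expTwoPi (T * Z.val).trace)
      (slash k (rep φ hpf.out.pos i) F Z) := by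
  have hp : (p : ℂ) ≠ 0 := by exact_mod_cast hpf.out.ne_zero
  have h1 := (h.hasSum_matrix (mobius (rep φ hpf.out.pos i) Z)).mul_left
    ((repE φ p i).det ^ (-(k : ℤ)))
  rw [← (indexEquiv (φ := φ) (p := p) i).hasSum_iff] at h1
  have h2 : slash k (rep φ hpf.out.pos i) F Z = (repE φ p i).det ^ (-(k : ℤ)) *
      F (mobius (rep φ hpf.out.pos i) Z) := by
    rw [slash, autFactor, denom_of_fromBlocks (rep_val φ hpf.out.pos i)]
  rw [h2]
  refine (congrArg (fun f => HasSum f _) (funext fun T => ?_)).mp h1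
  simp only [Function.comp]
  symm
  rw [mul_assoc, mul_assoc, ← expTwoPi_add]
  congr 3
  have h3 : (mobius (rep φ hpf.out.pos i) Z).val
      = (p : ℂ)⁻¹ • (repA φ p i * Z.val * (repA φ p i)ᴴ)
        + (p : ℂ)⁻¹ • (repB φ p i * (repA φ p i)ᴴ) := by
    change num _ Z.val * (denom _ Z.val)⁻¹ = _
    rw [denom_of_fromBlocks (rep_val φ hpf.out.pos i), num_of_fromBlocks (rep_val φ hpf.out.pos i),
      repE_inv, Matrix.mul_smul, Matrix.add_mul, smul_add]
  have h4 : T = (p : ℂ)⁻¹ • ((repA φ p i)ᴴ * indexEquiv i T * repA φ p i) :=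
    ((indexEquiv i).symm_apply_apply T).symm
  rw [h3, Matrix.mul_add, trace_add, Matrix.mul_smul, trace_smul, Matrix.mul_smul, trace_smul,
    smul_eq_mul, smul_eq_mul, add_comm]
  congr 1
  conv_lhs => rw [h4]
  rw [Matrix.smul_mul, trace_smul, smul_eq_mul, Matrix.mul_assoc, Matrix.mul_assoc,
    trace_mul_comm]
  simp only [Matrix.mul_assoc]

/-- The part of the Fourier expansion that comes from representatives with the same diagonal
blocks. -/
theorem hasSum_family {F : HH 2 → ℂ} {c : S2 φ → ℂ} (h : HasFourierExpansion φ F c) (k : ℕ)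
    {ι : Type*} [Fintype ι] (f : ι → CosetIndex φ p) (i : CosetIndex φ p)
    (hA : ∀ b, repA φ p (f b) = repA φ p i) (hE : ∀ b, repE φ p (f b) = repE φ p i) (n : ℂ)
    (h1 : ∀ T ∈ S2 φ, indexEquiv i T ∈ S2 φ →
      ∑ b, expTwoPi ((p : ℂ)⁻¹ * (indexEquiv i T * (repB φ p (f b) * (repA φ p i)ᴴ)).trace) = n)
    (h0 : ∀ T ∉ S2 φ, indexEquiv i T ∈ S2 φ →
      ∑ b, expTwoPi ((p : ℂ)⁻¹ * (indexEquiv i T * (repB φ p (f b) * (repA φ p i)ᴴ)).trace) = 0)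
    (Z : HH 2) :
    HasSum (fun T : S2 φ => (n * (repE φ p i).det ^ (-(k : ℤ)) * extCoeff c (indexEquiv i T.val)) *
        Complex.exp (2 * Real.pi * Complex.I * (T.val * Z.val).trace))
      (∑ b, slash k (rep φ hpf.out.pos (f b)) F Z) := by
  have key := hasSum_sum fun b (_ : b ∈ Finset.univ) => hasSum_slash_rep h k (f b) Z
  have hind : ∀ b, indexEquiv (f b) = indexEquiv i := by
    intro b
    ext1 T
    change (p : ℂ)⁻¹ • (repE φ p (f b) * T * (repE φ p (f b))ᴴ) = _
    rw [hE]
    rfl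
  have h2 : (fun T : S2 φ => (n * (repE φ p i).det ^ (-(k : ℤ)) *
        extCoeff c (indexEquiv i T.val)) *
        Complex.exp (2 * Real.pi * Complex.I * (T.val * Z.val).trace))
      = (fun T : Matrix (Fin 2) (Fin 2) ℂ => (n * (repE φ p i).det ^ (-(k : ℤ)) *
        extCoeff c (indexEquiv i T)) * expTwoPi (T * Z.val).trace) ∘ Subtype.val := rfl
  rw [h2, hasSum_subtype_iff_indicator]
  convert key using 1
  funext T
  simp only [hE, hA, hind]
  rw [← Finset.sum_mul, ← Finset.mul_sum]
  by_cases hm : indexEquiv i T ∈ S2 φ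
  · by_cases hT : T ∈ S2 φ
    · rw [Set.indicator_of_mem hT, h1 T hT hm]; ring
    · rw [Set.indicator_of_notMem hT, h0 T hT hm]; ring
  · by_cases hT : T ∈ S2 φ
    · rw [Set.indicator_of_mem hT, extCoeff_of_notMem c hm]; ring
    · rw [Set.indicator_of_notMem hT, extCoeff_of_notMem c hm]; ring

theorem indexEquiv_inl (b : ZMod p × ZMod p × ResidueRing φ p) (T : Matrix (Fin 2) (Fin 2) ℂ) :
    indexEquiv (.inl b) T = (p : ℂ) • T := by
  have hp : (p : ℂ) ≠ 0 := by exact_mod_cast hpf.out.ne_zero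
  simp [indexEquiv, repE, smul_smul, hp]

theorem indexEquiv_unit (T : Matrix (Fin 2) (Fin 2) ℂ) :
    indexEquiv (.inr (.inl ()) : CosetIndex φ p) T = (p : ℂ)⁻¹ • T := by
  simp [indexEquiv, repE]

/-- The matrix `[p ℓ, t; *, m/p]` for `V^* T V = [ℓ, t; *, m]`. -/
theorem indexEquiv_line (o : Option (ResidueRing φ p)) (b : ZMod p)
    (T : Matrix (Fin 2) (Fin 2) ℂ) :
    indexEquiv (.inr (.inr (o, b))) T = !![(p : ℂ) * ((lineMat φ p o)ᴴ * T * lineMat φ p o) 0 0,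
      ((lineMat φ p o)ᴴ * T * lineMat φ p o) 0 1; ((lineMat φ p o)ᴴ * T * lineMat φ p o) 1 0,
      (p : ℂ)⁻¹ * ((lineMat φ p o)ᴴ * T * lineMat φ p o) 1 1] := by
  have hp : (p : ℂ) ≠ 0 := by exact_mod_cast hpf.out.ne_zero
  have : repE φ p (.inr (.inr (o, b))) * T * (repE φ p (.inr (.inr (o, b))))ᴴ
      = diagonal ![(p : ℂ), 1] * ((lineMat φ p o)ᴴ * T * lineMat φ p o)
        * diagonal ![(p : ℂ), 1] := by
    simp only [repE, conjTranspose_mul, conjTranspose_conjTranspose, Matrix.mul_assoc,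
      diagonal_conjTranspose]
    congr 5
    funext i; fin_cases i <;> simp
  change (p : ℂ)⁻¹ • (repE φ p (.inr (.inr (o, b))) * T * (repE φ p (.inr (.inr (o, b))))ᴴ) = _
  rw [this]
  ext i j
  rw [Matrix.smul_apply, mul_diagonal, diagonal_mul]
  fin_cases i <;> fin_cases j
  · change (p : ℂ)⁻¹ * (p * _ * p) = p * _
    field_simp
    rfl
  · change (p : ℂ)⁻¹ * (p * _ * 1) = _
    field_simp
    rfl
  · change (p : ℂ)⁻¹ * (1 * _ * p) = _
    field_simp
    rfl
  · change (p : ℂ)⁻¹ * (1 * _ * 1) = _ * _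
    rw [one_mul, mul_one]
    rfl

/-- If v is a column of V, the corresponding diagonal entry is ℓ|v₀|² + m|v₁|² plus the alternating
form at (a, v₀v̄₁), hence a rational integer. -/
theorem conj_mem_S2 {T V : Matrix (Fin 2) (Fin 2) ℂ} (hT : T ∈ S2 φ) (hV : IsInt φ V) :
    Vᴴ * T * V ∈ S2 φ := by
  obtain ⟨l, m, a, ha, rfl⟩ := mem_S2_iff.mp hT
  have hδ := sqrtDisc_ne_zero (K := K)
  have hδm := sqrtDisc_mem φ
  have hs : star (sqrtDisc K) = -sqrtDisc K := star_sqrtDisc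
  have hdiag : ∀ j, ∃ n : ℤ, (Vᴴ * s2Mat K l m a * V) j j = n := by
    intro j
    obtain ⟨r, hr⟩ := exists_mul_star_eq_intCast φ (hV 0 j)
    obtain ⟨s, hs'⟩ := exists_mul_star_eq_intCast φ (hV 1 j)
    obtain ⟨u, hu⟩ := exists_altForm_eq ha (mul_mem (hV 0 j) (conj_mem_intRing φ (hV 1 j)))
    refine ⟨l * r + m * s + u, ?_⟩
    push_cast
    rw [← hr, ← hs', ← hu]
    simp only [mul_apply, Fin.sum_univ_two, conjTranspose_apply, s2Mat_zero_zero, s2Mat_zero_one,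
      s2Mat_one_zero, s2Mat_one_one, star_div₀, hs, altForm, star_mul', star_star]
    field_simp
    ring
  obtain ⟨l', hl⟩ := hdiag 0
  obtain ⟨m', hm⟩ := hdiag 1
  obtain ⟨a', ha', h01⟩ : ∃ a' ∈ intRing φ, (Vᴴ * s2Mat K l m a * V) 0 1 = a' / sqrtDisc K := by
    have c00 := conj_mem_intRing φ (hV 0 0)
    have c10 := conj_mem_intRing φ (hV 1 0)
    refine ⟨l * sqrtDisc K * star (V 0 0) * V 0 1
      + a * star (V 0 0) * V 1 1 - star a * star (V 1 0) * V 0 1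
      + m * sqrtDisc K * star (V 1 0) * V 1 1, add_mem (sub_mem (add_mem
      (mul_mem (mul_mem (mul_mem (intCast_mem _ _) hδm) c00) (hV 0 1))
      (mul_mem (mul_mem ha c00) (hV 1 1)))
      (mul_mem (mul_mem (conj_mem_intRing φ ha) c10) (hV 0 1)))
      (mul_mem (mul_mem (mul_mem (intCast_mem _ _) hδm) c10) (hV 1 1)), ?_⟩
    simp only [mul_apply, Fin.sum_univ_two, conjTranspose_apply, s2Mat_zero_zero, s2Mat_zero_one,
      s2Mat_one_zero, s2Mat_one_one, star_div₀, hs]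
    field_simp
    ring
  have hherm : (s2Mat K l m a)ᴴ = s2Mat K l m a := by
    ext i j
    fin_cases i <;> fin_cases j <;> simp [s2Mat]
  have h10 : (Vᴴ * s2Mat K l m a * V) 1 0 = star ((Vᴴ * s2Mat K l m a * V) 0 1) := by
    rw [← conjTranspose_apply]
    simp only [conjTranspose_mul, conjTranspose_conjTranspose, hherm, Matrix.mul_assoc]
  refine mem_S2_iff.mpr ⟨l', m', a', ha', ?_⟩
  ext i j
  fin_cases i <;> fin_cases j
  · exact hl
  · exact h01
  · exact h10.trans (congrArg star h01)
  · exact hm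

theorem smul_mem_S2 {T : Matrix (Fin 2) (Fin 2) ℂ} (hT : T ∈ S2 φ) (n : ℕ) :
    (n : ℂ) • T ∈ S2 φ := by
  obtain ⟨l, m, a, ha, rfl⟩ := mem_S2_iff.mp hT
  refine mem_S2_iff.mpr ⟨n * l, n * m, n * a, mul_mem (natCast_mem _ _) ha, ?_⟩
  ext i j
  fin_cases i <;> fin_cases j <;> simp [mul_div_assoc]

theorem lineMat_conj_mem_iff (o : Option (ResidueRing φ p)) (T : Matrix (Fin 2) (Fin 2) ℂ) :
    (lineMat φ p o)ᴴ * T * lineMat φ p o ∈ S2 φ ↔ T ∈ S2 φ := by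
  refine ⟨fun h => ?_, fun h => conj_mem_S2 h (isInt_lineMat φ p o)⟩
  have h1 := conj_mem_S2 h (isInt_lineMatInv φ p o)
  have h2 : (lineMatInv φ p o)ᴴ * ((lineMat φ p o)ᴴ * T * lineMat φ p o) * lineMatInv φ p o
      = ((lineMatInv φ p o)ᴴ * (lineMat φ p o)ᴴ) * T * (lineMat φ p o * lineMatInv φ p o) := by
    simp only [Matrix.mul_assoc]
  rwa [h2, lineMatInv_conjTranspose_mul, lineMat_mul, Matrix.one_mul, Matrix.mul_one] at h1

theorem repB_line_mul (o : Option (ResidueRing φ p)) (b b' : ZMod p) :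
    repB φ p (.inr (.inr (o, b))) * (repA φ p (.inr (.inr (o, b'))))ᴴ
      = diagonal ![(b.val : ℂ), 0] := by
  simp only [repA, repB]
  rw [conjTranspose_mul, Matrix.mul_assoc, ← Matrix.mul_assoc (lineMat φ p o)ᴴ,
    lineMat_conjTranspose_mul, Matrix.one_mul, diagonal_conjTranspose, diagonal_mul_diagonal]
  congr 1; funext i; fin_cases i <;> simp

/-- Going back from T_o to V^*TV divides the upper left entry by p and multiplies the lower right
one by p. So only the upper left entry can fail to be integral, and this is what the sum over b
tests. -/
theorem mem_S2_of_line {o : Option (ResidueRing φ p)} {T : Matrix (Fin 2) (Fin 2) ℂ}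
    {b : ZMod p} {l m : ℤ} {a : ℂ} (ha : a ∈ intRing φ)
    (h : indexEquiv (.inr (.inr (o, b))) T = s2Mat K l m a) : T ∈ S2 φ ↔ (p : ℤ) ∣ l := by
  have hp : (p : ℂ) ≠ 0 := by exact_mod_cast hpf.out.ne_zero
  rw [indexEquiv_line] at h
  have e00 : (p : ℂ) * ((lineMat φ p o)ᴴ * T * lineMat φ p o) 0 0 = l := congrFun (congrFun h 0) 0
  have e01 : ((lineMat φ p o)ᴴ * T * lineMat φ p o) 0 1 = a / sqrtDisc K :=
    congrFun (congrFun h 0) 1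
  have e10 : ((lineMat φ p o)ᴴ * T * lineMat φ p o) 1 0 = star (a / sqrtDisc K) :=
    congrFun (congrFun h 1) 0
  have e11 : (p : ℂ)⁻¹ * ((lineMat φ p o)ᴴ * T * lineMat φ p o) 1 1 = m :=
    congrFun (congrFun h 1) 1
  rw [← lineMat_conj_mem_iff o]
  constructor
  · intro h1
    obtain ⟨l', m', a', -, e⟩ := mem_S2_iff.mp h1
    rw [e, s2Mat_zero_zero] at e00
    exact ⟨l', by exact_mod_cast e00.symm⟩
  · rintro ⟨l', rfl⟩
    refine mem_S2_iff.mpr ⟨l', p * m, a, ha, ?_⟩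
    ext i j
    fin_cases i <;> fin_cases j
    · rw [Int.cast_mul, Int.cast_natCast] at e00
      exact mul_left_cancel₀ hp e00
    · exact e01
    · exact e10
    · rw [inv_mul_eq_iff_eq_mul₀ hp] at e11
      change _ = ((p * m : ℤ) : ℂ)
      rw [Int.cast_mul, Int.cast_natCast]
      exact e11

/-- The Fourier coefficients of `F | T_p`. -/
def heckeCoeff (p : ℕ) [hpf : Fact p.Prime] (k : ℕ) (c : S2 φ → ℂ) (T : Matrix (Fin 2) (Fin 2) ℂ) :
    ℂ :=
  (p : ℂ) ^ 4 * ((p : ℂ) ^ 2) ^ (-(k : ℤ)) * extCoeff c ((p : ℂ) • T)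
    + extCoeff c ((p : ℂ)⁻¹ • T)
    + ∑ o, (p : ℂ) * (p : ℂ) ^ (-(k : ℤ)) *
        extCoeff c (indexEquiv (.inr (.inr (o, 0)) : CosetIndex φ p) T)

/-- Each pair of diagonal blocks is one application of `hasSum_family`. The sums over B are p⁴, 1
and p for T in S_2; for T outside S_2 they vanish, or the index T' lies outside S_2 too. -/
theorem hasFourierExpansion_sum_slash {F : HH 2 → ℂ} {c : S2 φ → ℂ}
    (h : HasFourierExpansion φ F c) (k : ℕ) :
    HasFourierExpansion φ (∑ i, slash k (rep φ hpf.out.pos i) F)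
      (fun T => heckeCoeff p k c T.val) := by
  classical
  intro Z
  have hp : (p : ℂ) ≠ 0 := by exact_mod_cast hpf.out.ne_zero
  have h1 := hasSum_family h k (Sum.inl : _ → CosetIndex φ p) (.inl 0) (fun _ => rfl)
    (fun _ => rfl) ((p : ℂ) ^ 4) (fun T hT hi => by
      simp only [indexEquiv_inl, repA, repB, conjTranspose_one, Matrix.mul_one] at hi ⊢
      rw [sum_expTwoPi_hermMat hi, if_pos]
      rwa [smul_smul, inv_mul_cancel₀ hp, one_smul])
    (fun T hT hi => by
      simp only [indexEquiv_inl, repA, repB, conjTranspose_one, Matrix.mul_one] at hi ⊢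
      rw [sum_expTwoPi_hermMat hi, if_neg]
      rwa [smul_smul, inv_mul_cancel₀ hp, one_smul]) Z
  have h2 := hasSum_family h k (fun u : Unit => (.inr (.inl u) : CosetIndex φ p)) (.inr (.inl ()))
    (fun _ => rfl) (fun _ => rfl) 1 (fun T hT hi => by simp [repB, expTwoPi_zero])
    (fun T hT hi => by
      exfalso
      rw [indexEquiv_unit] at hi
      apply hT
      have := smul_mem_S2 hi p
      rwa [smul_smul, mul_inv_cancel₀ hp, one_smul] at this) Z
  have h3 : ∀ o : Option (ResidueRing φ p), _ := fun o =>
    hasSum_family h k (fun b : ZMod p => (.inr (.inr (o, b)) : CosetIndex φ p)) (.inr (.inr (o, 0)))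
    (fun _ => rfl) (fun _ => rfl) (p : ℂ) (fun T hT hi => by
      obtain ⟨l, m, a, ha, e⟩ := mem_S2_iff.mp hi
      have := sum_expTwoPi_zmod p l
      rw [if_pos ((mem_S2_of_line ha e).mp hT)] at this
      refine Eq.trans (Finset.sum_congr rfl fun b _ => ?_) this
      rw [repB_line_mul, e, trace_fin_two, mul_diagonal, mul_diagonal]
      simp)
    (fun T hT hi => by
      obtain ⟨l, m, a, ha, e⟩ := mem_S2_iff.mp hi
      have := sum_expTwoPi_zmod p l
      rw [if_neg (mt (mem_S2_of_line ha e).mpr hT)] at this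
      refine Eq.trans (Finset.sum_congr rfl fun b _ => ?_) this
      rw [repB_line_mul, e, trace_fin_two, mul_diagonal, mul_diagonal]
      simp) Z
  have h4 := (h1.add h2).add (hasSum_sum fun o (_ : o ∈ Finset.univ) => h3 o)
  have e1 : (repE φ p (.inl 0)).det = (p : ℂ) ^ 2 := by simp [repE]
  have e2 : (repE φ p (.inr (.inl ()))).det = 1 := by simp [repE]
  have e3 : ∀ o, (repE φ p (.inr (.inr (o, 0)))).det = (p : ℂ) := by
    intro o
    simp [repE, det_conjTranspose, det_lineMat]
  have e4 : (∑ i, slash k (rep φ hpf.out.pos i) F) Z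
      = ∑ b, slash k (rep φ hpf.out.pos (.inl b)) F Z
        + ∑ u, slash k (rep φ hpf.out.pos (.inr (.inl u))) F Z
        + ∑ o, ∑ b, slash k (rep φ hpf.out.pos (.inr (.inr (o, b)))) F Z := by
    rw [Finset.sum_apply, Fintype.sum_sum_type, Fintype.sum_sum_type, add_assoc]
    congr 2
    exact Fintype.sum_prod_type _
  rw [e4]
  refine (congrArg (fun f => HasSum f _) (funext fun T => ?_)).mp h4
  simp only [e1, e2, e3, indexEquiv_inl, indexEquiv_unit, heckeCoeff, add_mul, Finset.sum_mul,
    _root_.one_zpow, one_mul]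

end Expansion

/-! ### Counting isotropic lines modulo `p` -/

section Counting

open NumberField

variable {K : Type*} [Field K] [NumberField K] [Algebra.IsQuadraticExtension ℚ K]
  [IsTotallyComplex K] {φ : K →+* ℂ} {p : ℕ} [hpf : Fact p.Prime]

theorem lineMat_none_conj (l m : ℤ) (a : ℂ) :
    (lineMat φ p none)ᴴ * s2Mat K l m a * lineMat φ p none = s2Mat K m l (star a) := by
  have hs : star (sqrtDisc K) = -sqrtDisc K := star_sqrtDisc
  ext i j
  fin_cases i <;> fin_cases j <;>
    simp only [lineMat, mul_apply, Fin.sum_univ_two, conjTranspose_apply, Fin.zero_eta, Fin.mk_one,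
      s2Mat_zero_zero, s2Mat_zero_one, s2Mat_one_zero, s2Mat_one_one, of_apply, cons_val',
      cons_val_zero, cons_val_one, cons_val_fin_one, star_zero, star_one, star_neg, star_div₀, hs,
      star_star] <;> ring

theorem lineMat_some_conj (l m : ℤ) (a : ℂ) (y : ResidueRing φ p) {m' : ℤ}
    (hm : (m' : ℂ) = l * ((lift φ p y : ℂ) * star (lift φ p y : ℂ)) + m
      + altForm K a (lift φ p y)) :
    (lineMat φ p (some y))ᴴ * s2Mat K l m a * lineMat φ p (some y)
      = s2Mat K l m' (a + l * sqrtDisc K * lift φ p y) := by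
  have hs : star (sqrtDisc K) = -sqrtDisc K := star_sqrtDisc
  have hδ := sqrtDisc_ne_zero (K := K)
  ext i j
  fin_cases i <;> fin_cases j <;>
    simp only [lineMat, mul_apply, Fin.sum_univ_two, conjTranspose_apply, Fin.zero_eta, Fin.mk_one,
      s2Mat_zero_zero, s2Mat_zero_one, s2Mat_one_zero, s2Mat_one_one, of_apply, cons_val',
      cons_val_zero, cons_val_one, cons_val_fin_one, star_zero, star_one, star_div₀, hs, hm,
      star_add, star_mul', star_intCast, altForm] <;> field_simp <;> ring

/-- The entry m is the value of the hermitian form at the vector spanning the line, so membership of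
T_o in S_2 means that the line is isotropic modulo p. -/
theorem indexEquiv_mem_iff {o : Option (ResidueRing φ p)} {b : ZMod p}
    {T : Matrix (Fin 2) (Fin 2) ℂ} {l m : ℤ} {a : ℂ} (ha : a ∈ intRing φ)
    (h : (lineMat φ p o)ᴴ * T * lineMat φ p o = s2Mat K l m a) :
    indexEquiv (.inr (.inr (o, b))) T ∈ S2 φ ↔ (p : ℤ) ∣ m := by
  have hp : (p : ℂ) ≠ 0 := by exact_mod_cast hpf.out.ne_zero
  rw [indexEquiv_line, h]
  simp only [s2Mat_zero_zero, s2Mat_zero_one, s2Mat_one_zero, s2Mat_one_one]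
  constructor
  · intro h1
    obtain ⟨l', m', a', -, e⟩ := mem_S2_iff.mp h1
    have e1 : (p : ℂ)⁻¹ * m = m' := congrFun (congrFun e 1) 1
    rw [inv_mul_eq_iff_eq_mul₀ hp] at e1
    exact ⟨m', by exact_mod_cast e1⟩
  · rintro ⟨m', rfl⟩
    refine mem_S2_iff.mpr ⟨p * l, m', a, ha, ?_⟩
    rw [Int.cast_mul, Int.cast_natCast, inv_mul_cancel_left₀ hp, s2Mat, Int.cast_mul,
      Int.cast_natCast]

theorem inv_smul_indexEquiv_mem_iff {o : Option (ResidueRing φ p)} {b : ZMod p}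
    {T : Matrix (Fin 2) (Fin 2) ℂ} {l m : ℤ} {a : ℂ}
    (h : (lineMat φ p o)ᴴ * T * lineMat φ p o = s2Mat K l m a) :
    (p : ℂ)⁻¹ • indexEquiv (.inr (.inr (o, b))) T ∈ S2 φ ↔
      (∃ z ∈ intRing φ, a = p * z) ∧ (p : ℤ) ^ 2 ∣ m := by
  have hp : (p : ℂ) ≠ 0 := by exact_mod_cast hpf.out.ne_zero
  rw [indexEquiv_line, h]
  simp only [s2Mat_zero_zero, s2Mat_zero_one, s2Mat_one_zero, s2Mat_one_one]
  constructor
  · intro h1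
    obtain ⟨l', m', a', ha', e⟩ := mem_S2_iff.mp h1
    have e1 : (p : ℂ)⁻¹ * ((p : ℂ)⁻¹ * m) = m' := congrFun (congrFun e 1) 1
    have e2 : (p : ℂ)⁻¹ * (a / sqrtDisc K) = a' / sqrtDisc K := congrFun (congrFun e 0) 1
    rw [inv_mul_eq_iff_eq_mul₀ hp] at e2
    rw [inv_mul_eq_iff_eq_mul₀ hp, inv_mul_eq_iff_eq_mul₀ hp, ← mul_assoc, ← pow_two] at e1
    rw [mul_div_assoc', div_left_inj' sqrtDisc_ne_zero] at e2
    exact ⟨⟨a', ha', e2⟩, m', by exact_mod_cast e1⟩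
  · rintro ⟨⟨z, hz, rfl⟩, m', rfl⟩
    refine mem_S2_iff.mpr ⟨l, m', z, hz, ?_⟩
    ext i j
    fin_cases i <;> fin_cases j
    · change (p : ℂ)⁻¹ * (p * l) = l
      field_simp
    · change (p : ℂ)⁻¹ * (p * z / sqrtDisc K) = z / sqrtDisc K
      field_simp
    · change (p : ℂ)⁻¹ * (star (p * z / sqrtDisc K)) = star (z / sqrtDisc K)
      simp only [star_div₀, star_mul', star_natCast]
      field_simp
    · change (p : ℂ)⁻¹ * ((p : ℂ)⁻¹ * ((p ^ 2 * m' : ℤ) : ℂ)) = m'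
      push_cast
      field_simp

theorem det_s2Mat (l m : ℤ) (a : ℂ) :
    (absDisc K : ℂ) * (s2Mat K l m a).det = absDisc K * l * m - a * star a := by
  have hs : star (sqrtDisc K) = -sqrtDisc K := star_sqrtDisc
  have hδ := sqrtDisc_ne_zero (K := K)
  have hsq := sqrtDisc_sq (K := K)
  rw [det_fin_two, s2Mat_zero_zero, s2Mat_zero_one, s2Mat_one_zero, s2Mat_one_one, star_div₀, hs]
  have : (absDisc K : ℂ) = -sqrtDisc K ^ 2 := by rw [hsq]; ring
  rw [this]
  field_simp
  ring

/-- The form `altForm` modulo `p`. -/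
theorem exists_altHom {a : ℂ} (ha : a ∈ intRing φ) : ∃ g : ResidueRing φ p →+ ZMod p,
    ∀ x ∈ intRing φ, ∀ s : ℤ, altForm K a x = s → g (redC φ p x) = s := by
  have hspec : ∀ y : ResidueRing φ p, ∃ s : ℤ, altForm K a (lift φ p y) = s :=
    fun y => exists_altForm_eq ha (lift φ p y).2
  choose f hf using hspec
  have key : ∀ (y : ResidueRing φ p) (x : intRing φ), red φ p x = y → ∀ s : ℤ,
      altForm K a x = s → ((f y : ℤ) : ZMod p) = s := by
    intro y x hx s hs
    obtain ⟨z, hz, e⟩ := (red_eq_iff φ p (lift φ p y) x).mp (by rw [red_lift, hx])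
    obtain ⟨u, hu⟩ := exists_altForm_eq ha hz
    have h1 := hf y
    rw [e, altForm_add, altForm_natCast_mul, hs, hu] at h1
    have h2 : f y = s + p * u := by exact_mod_cast h1.symm
    rw [h2]; simp
  refine ⟨AddMonoidHom.mk' (fun y => ((f y : ℤ) : ZMod p)) fun y y' => ?_, ?_⟩
  · have h1 : altForm K a ((lift φ p y + lift φ p y' : intRing φ) : ℂ) = ((f y + f y' : ℤ) : ℂ) := by
      rw [Subring.coe_add, altForm_add, hf, hf]; push_cast; rfl
    have := key (y + y') (lift φ p y + lift φ p y') (by rw [map_add, red_lift, red_lift]) _ h1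
    rw [this]; push_cast; rfl
  · intro x hx s hs
    exact key _ ⟨x, hx⟩ (redC_of_mem hx).symm s hs

/-- Unimodularity makes the map nonzero, hence onto ℤ/p, and its p fibres share the p² residue
classes equally. -/
theorem card_fiber_altHom {a : ℂ} (ha : a ∈ intRing φ) (hpa : ¬∃ z ∈ intRing φ, a = p * z)
    {g : ResidueRing φ p →+ ZMod p}
    (hg : ∀ x ∈ intRing φ, ∀ s : ℤ, altForm K a x = s → g (redC φ p x) = s) (b : ZMod p) :
    (Finset.univ.filter fun y => g y = b).card = p := by
  have hne : ∃ y, g y ≠ 0 := by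
    by_contra hcon
    push Not at hcon
    refine hpa (natCast_dvd_of_alternating φ ha p fun x hx => ?_)
    obtain ⟨s, hs⟩ := exists_altForm_eq ha hx
    have h1 := hg x hx s hs
    rw [hcon] at h1
    obtain ⟨u, rfl⟩ := (ZMod.intCast_zmod_eq_zero_iff_dvd s p).mp h1.symm
    refine ⟨u, ?_⟩
    rw [altForm, div_eq_iff sqrtDisc_ne_zero] at hs
    rw [hs]; push_cast; rfl
  obtain ⟨y₀, hy₀⟩ := hne
  have hsurj : ∀ b, ∃ y, g y = b := by
    intro b
    refine ⟨(b / g y₀).val • y₀, ?_⟩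
    rw [map_nsmul, nsmul_eq_mul, ZMod.natCast_zmod_val, div_mul_cancel₀ _ hy₀]
  have hall : ∀ b', (Finset.univ.filter fun y => g y = b').card
      = (Finset.univ.filter fun y => g y = b).card := by
    intro b'
    exact AddMonoidHom.card_fiber_eq_of_mem_range g (hsurj b') (hsurj b)
  have hsum := Finset.card_eq_sum_card_fiberwise (s := (Finset.univ : Finset (ResidueRing φ p)))
    (t := (Finset.univ : Finset (ZMod p))) (f := g) (fun _ _ => Finset.mem_coe.mpr (Finset.mem_univ _))
  rw [Finset.card_univ, fintype_card_residueRing, Finset.sum_congr rfl fun b' _ => hall b',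
    Finset.sum_const, Finset.card_univ, ZMod.card, smul_eq_mul, pow_two] at hsum
  exact (Nat.eq_of_mul_eq_mul_left hpf.out.pos hsum).symm

theorem redC_intCast (a : ℤ) : redC φ p (a : ℂ) = a := by
  have := redC_coe (φ := φ) (p := p) (a : intRing φ)
  simpa using this

theorem intCast_residueRing_eq_zero_iff (h : Prime (p : intRing φ)) (a : ℤ) :
    (a : ResidueRing φ p) = 0 ↔ (p : ℤ) ∣ a := by
  have := charP_residueRing φ p h
  exact CharP.intCast_eq_zero_iff (ResidueRing φ p) p a

theorem star_eq_pow (h : Prime (p : intRing φ)) (y : ResidueRing φ p) : star y = y ^ p := by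
  obtain ⟨x, rfl⟩ := Ideal.Quotient.mk_surjective y
  exact red_conjInt h x

theorem redC_sqrtDisc_ne_zero (h : Prime (p : intRing φ)) : redC φ p (sqrtDisc K) ≠ 0 := by
  rw [redC_of_mem (sqrtDisc_mem φ)]
  exact red_sqrtDisc_ne_zero h

theorem dvd_norm_iff (h : Prime (p : intRing φ)) {a : ℂ} (ha : a ∈ intRing φ) {r : ℤ}
    (hr : a * star a = r) : (p : ℤ) ∣ r ↔ ∃ z ∈ intRing φ, a = p * z := by
  have := isDomain_residueRing φ p h
  rw [← redC_eq_zero_iff ha, ← intCast_residueRing_eq_zero_iff h, ← redC_intCast, ← hr,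
    redC_mul ha (conj_mem_intRing φ ha), redC_star ha, mul_eq_zero, star_eq_zero, or_self]

theorem sq_dvd_norm {a : ℂ} (ha : ∃ z ∈ intRing φ, a = p * z) {r : ℤ}
    (hr : a * star a = r) : (p : ℤ) ^ 2 ∣ r := by
  obtain ⟨z, hz, rfl⟩ := ha
  obtain ⟨s, hs⟩ := exists_mul_star_eq_intCast φ hz
  refine ⟨s, ?_⟩
  have : ((p : ℂ) ^ 2 * s) = r := by
    rw [← hs, ← hr, star_mul', star_natCast]; ring
  exact_mod_cast this.symm

/-- The value of the quadratic form at the line spanned by `(y, 1)`. -/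
theorem exists_lineValue (l m n : ℤ) {a : ℂ} (ha : a ∈ intRing φ)
    (hn : (n : ℂ) = absDisc K * (s2Mat K l m a).det) (y : ResidueRing φ p) :
    ∃ m' s r : ℤ, ((lineMat φ p (some y))ᴴ * s2Mat K l m a * lineMat φ p (some y)
      = s2Mat K l m' (a + l * sqrtDisc K * lift φ p y)) ∧
      altForm K a (lift φ p y) = s ∧
      (∃ u : ℤ, m' = l * u + m + s) ∧
      (a + l * sqrtDisc K * lift φ p y) * star (a + l * sqrtDisc K * lift φ p y) = r ∧
      absDisc K * l * m' = r + n := by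
  obtain ⟨s, hs⟩ := exists_altForm_eq ha (lift φ p y).2
  obtain ⟨u, hu⟩ := exists_mul_star_eq_intCast φ (lift φ p y).2
  obtain ⟨r, hr⟩ := exists_mul_star_eq_intCast φ (add_mem ha
    (mul_mem (mul_mem (intCast_mem _ l) (sqrtDisc_mem φ)) (lift φ p y).2))
  refine ⟨l * u + m + s, s, r, lineMat_some_conj l m a y ?_, hs, ⟨u, rfl⟩, hr, ?_⟩
  · rw [hu, hs]; push_cast; rfl
  -- Completing the square: Dℓ times the value at (y, 1) is the norm of a + ℓ√-D y plus n.
  · have : (absDisc K : ℂ) * l * (l * u + m + s) = r + n := by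
      rw [hn, det_s2Mat, ← hr, ← hu, ← hs, altForm]
      have hs : star (sqrtDisc K) = -sqrtDisc K := star_sqrtDisc
      have hδ := sqrtDisc_ne_zero (K := K)
      have hD : (absDisc K : ℂ) = -sqrtDisc K ^ 2 := by rw [sqrtDisc_sq]; ring
      rw [hD]
      simp only [star_add, star_mul', star_intCast, hs]
      field_simp
      ring
    exact_mod_cast this

end Counting

/-! ### Numbers of isotropic and of divisible lines -/

section Counting

open NumberField

variable {K : Type*} [Field K] [NumberField K] [Algebra.IsQuadraticExtension ℚ K]
  [IsTotallyComplex K] {φ : K →+* ℂ} {p : ℕ} [hpf : Fact p.Prime]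

open Classical in
theorem card_filter_option {α : Type*} [Fintype α] (P : Option α → Prop) :
    (Finset.univ.filter P).card
      = (if P none then 1 else 0) + (Finset.univ.filter fun y => P (some y)).card := by
  rw [Finset.card_filter, Fintype.sum_option, Finset.card_filter]

theorem redC_line (l : ℤ) {a : ℂ} (ha : a ∈ intRing φ) (y : ResidueRing φ p) :
    redC φ p (a + l * sqrtDisc K * lift φ p y)
      = redC φ p a + l * redC φ p (sqrtDisc K) * y := by
  have h1 := mul_mem (intCast_mem (intRing φ) l) (sqrtDisc_mem φ)
  rw [redC_add ha (mul_mem h1 (lift φ p y).2), redC_mul h1 (lift φ p y).2,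
    redC_mul (intCast_mem _ l) (sqrtDisc_mem φ), redC_intCast, redC_lift]

/-- The bijection `y ↦ a + ℓ √-D y` of `𝔬_K / p`. -/
theorem bijective_redC_line (h : Prime (p : intRing φ)) {l : ℤ} (hl : ¬ (p : ℤ) ∣ l) {a : ℂ}
    (ha : a ∈ intRing φ) :
    Function.Bijective fun y : ResidueRing φ p =>
      redC φ p (a + l * sqrtDisc K * lift φ p y) := by
  have := isDomain_residueRing φ p h
  apply Finite.injective_iff_bijective.mp
  intro y y' e
  simp only [redC_line l ha] at e
  have hl' : (l : ResidueRing φ p) * redC φ p (sqrtDisc K) ≠ 0 :=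
    mul_ne_zero (mt (intCast_residueRing_eq_zero_iff h l).mp hl) (redC_sqrtDisc_ne_zero h)
  exact mul_left_cancel₀ hl' (add_left_cancel e)

theorem isCoprime_absDisc_mul (h : Prime (p : intRing φ)) {l : ℤ} (hl : ¬ (p : ℤ) ∣ l) :
    IsCoprime (p : ℤ) (absDisc K * l) := by
  have hp : Prime (p : ℤ) := Nat.prime_iff_prime_int.mp hpf.out
  rw [(Int.prime_iff_natAbs_prime.mpr (by simpa using hpf.out)).irreducible.coprime_iff_not_dvd]
  intro h1
  rcases hp.dvd_or_dvd h1 with h2 | h2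
  · exact not_dvd_absDisc h h2
  · exact hl h2

theorem dvd_mul_iff_of_isCoprime {a b : ℤ} (h : IsCoprime a b) (c : ℤ) : a ∣ b * c ↔ a ∣ c :=
  ⟨h.dvd_of_dvd_mul_left, fun h1 => h1.mul_left _⟩

-- As yȳ = y^{p+1}, this is a fibre of the norm to the prime field, with p + 1 elements over a
-- nonzero value and only y = 0 over zero.
open Classical in
theorem card_filter_mul_star (h : Prime (p : intRing φ)) (n : ℤ) :
    (Finset.univ.filter fun y : ResidueRing φ p => y * star y + n = 0).card
      = 1 + if (p : ℤ) ∣ n then 0 else p := by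
  have := isDomain_residueRing φ p h
  have := charP_residueRing φ p h
  have h1 : ∀ y : ResidueRing φ p, y * star y + n = 0 ↔ y ^ (p + 1) = ((-n : ℤ) : ResidueRing φ p) := by
    intro y
    rw [star_eq_pow h, ← pow_succ', Int.cast_neg, ← eq_neg_iff_add_eq_zero]
  simp only [h1]
  split_ifs with hn
  · have h2 : ((-n : ℤ) : ResidueRing φ p) = 0 :=
      (intCast_residueRing_eq_zero_iff h _).mpr (by simpa using hn)
    rw [h2]
    have h3 : (Finset.univ.filter fun y : ResidueRing φ p => y ^ (p + 1) = 0) = {0} := by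
      ext y; simp
    rw [h3, Finset.card_singleton]
  · rw [card_filter_pow_succ_eq (fintype_card_residueRing φ p), add_comm]
    · rw [Ne, intCast_residueRing_eq_zero_iff h]
      simpa using hn
    · exact map_intCast (frobenius (ResidueRing φ p) p) (-n)

open Classical in
/-- The number of isotropic lines of a hermitian form modulo `p`. -/
theorem card_isotropic (h : Prime (p : intRing φ)) {T : Matrix (Fin 2) (Fin 2) ℂ} (hT : T ∈ S2 φ)
    {n : ℤ} (hn : (n : ℂ) = absDisc K * T.det) :
    (Finset.univ.filter fun o : Option (ResidueRing φ p) =>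
      indexEquiv (.inr (.inr (o, 0)) : CosetIndex φ p) T ∈ S2 φ).card
      + (if (p : ℂ)⁻¹ • T ∈ S2 φ then 0 else p ^ 2)
      = p ^ 2 + 1 + if (p : ℤ) ∣ n then 0 else p := by
  have hpp : Prime (p : ℤ) := Nat.prime_iff_prime_int.mp hpf.out
  obtain ⟨l, m, a, ha, rfl⟩ := mem_S2_iff.mp hT
  obtain ⟨r₀, hr₀⟩ := exists_mul_star_eq_intCast φ ha
  have hn0 : n = absDisc K * l * m - r₀ := by
    rw [det_s2Mat, hr₀] at hn
    exact_mod_cast hn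
  choose m' s r hconj hs hu hr hmr using exists_lineValue (p := p) l m n ha hn
  have hmem : ∀ y, a + l * sqrtDisc K * (lift φ p y : ℂ) ∈ intRing φ := fun y => add_mem ha
    (mul_mem (mul_mem (intCast_mem _ l) (sqrtDisc_mem φ)) (lift φ p y).2)
  rw [card_filter_option, indexEquiv_mem_iff (conj_mem_intRing φ ha) (lineMat_none_conj l m a)]
  simp only [fun y => indexEquiv_mem_iff (b := 0) (hmem y) (hconj y)]
  simp only [inv_smul_s2Mat_mem_iff hpf.out.ne_zero]
  -- If p divides ℓ, the line `none` is isotropic and the value at (y, 1) is m + s(y) modulo p, with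
  -- s additive in y.
  by_cases hl : (p : ℤ) ∣ l
  · have hm' : ∀ y, (p : ℤ) ∣ m' y ↔ (p : ℤ) ∣ m + s y := by
      intro y
      obtain ⟨u, e⟩ := hu y
      rw [e, add_assoc, (Int.dvd_add_right (hl.mul_right u))]
    have hnr : (p : ℤ) ∣ n ↔ (p : ℤ) ∣ r₀ := by
      rw [hn0, dvd_sub_right ((hl.mul_left _).mul_right m)]
    rw [dvd_norm_iff h ha hr₀] at hnr
    simp only [hm', hnr]
    by_cases hpa : ∃ z ∈ intRing φ, a = p * z
    · have hs0 : ∀ y, (p : ℤ) ∣ s y := by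
        intro y
        obtain ⟨z, hz, e⟩ := hpa
        obtain ⟨u, hu⟩ := exists_altForm_eq hz (lift φ p y).2
        refine ⟨u, ?_⟩
        have h1 := hs y
        rw [e, altForm_natCast_mul_left, hu] at h1
        exact_mod_cast h1.symm
      simp only [Int.dvd_add_left (hs0 _)]
      by_cases hm : (p : ℤ) ∣ m
      · simp only [hl, hm, hpa, if_true, and_self, Finset.filter_true, Finset.card_univ,
          fintype_card_residueRing]
        ring
      · simp only [hl, hm, hpa, if_true, if_false, false_and, and_false, Finset.filter_false,
          Finset.card_empty]
        ring
    -- Now s takes each value p times, so there are p + 1 isotropic lines; accordingly n ≡ -aā is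
    -- prime to p.
    · obtain ⟨g, hg⟩ := exists_altHom (p := p) ha
      have hcard := card_fiber_altHom ha hpa hg (-m)
      have hfil : ∀ y, (p : ℤ) ∣ m + s y ↔ g y = -m := by
        intro y
        have h1 := hg _ (lift φ p y).2 _ (hs y)
        rw [redC_lift] at h1
        rw [h1, eq_neg_iff_add_eq_zero, add_comm, ← Int.cast_add,
          ZMod.intCast_zmod_eq_zero_iff_dvd]
      simp only [hfil, hcard, hl, hpa, and_false, if_true, if_false]
      ring
  -- If p does not divide ℓ, the line `none` is not isotropic. After completing the square the
  -- condition reads zz̄ + n = 0, where z = a + ℓ√-D y runs once through the residue field.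
  · have hfil : ∀ y, (p : ℤ) ∣ m' y ↔ redC φ p (a + l * sqrtDisc K * lift φ p y)
        * star (redC φ p (a + l * sqrtDisc K * lift φ p y)) + n = 0 := by
      intro y
      rw [← dvd_mul_iff_of_isCoprime (isCoprime_absDisc_mul h hl), hmr, ← intCast_residueRing_eq_zero_iff h,
        Int.cast_add, ← redC_intCast (r y), ← hr y, redC_mul (hmem y)
        (conj_mem_intRing φ (hmem y)), redC_star (hmem y)]
    simp only [hfil]
    have hbij := bijective_redC_line h hl ha
    have hcard : (Finset.univ.filter fun y : ResidueRing φ p =>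
        redC φ p (a + l * sqrtDisc K * lift φ p y)
          * star (redC φ p (a + l * sqrtDisc K * lift φ p y)) + n = 0).card
        = (Finset.univ.filter fun y : ResidueRing φ p => y * star y + n = 0).card := by
      rw [Finset.card_filter, Finset.card_filter]
      exact hbij.sum_comp fun y => if y * star y + n = 0 then 1 else 0
    rw [hcard, card_filter_mul_star h, if_neg hl]
    simp only [hl, false_and, if_false]
    ring

open Classical in
/-- The number of lines along which the form becomes divisible by `p`. -/
theorem card_divisible (h : Prime (p : intRing φ)) {T : Matrix (Fin 2) (Fin 2) ℂ} (hT : T ∈ S2 φ)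
    (hpT : (p : ℂ)⁻¹ • T ∉ S2 φ) {n : ℤ} (hn : (n : ℂ) = absDisc K * T.det) :
    (Finset.univ.filter fun o : Option (ResidueRing φ p) =>
      (p : ℂ)⁻¹ • indexEquiv (.inr (.inr (o, 0)) : CosetIndex φ p) T ∈ S2 φ).card
      = if (p : ℤ) ^ 2 ∣ n then 1 else 0 := by
  have := isDomain_residueRing φ p h
  have hpp : Prime (p : ℤ) := Nat.prime_iff_prime_int.mp hpf.out
  obtain ⟨l, m, a, ha, rfl⟩ := mem_S2_iff.mp hT
  obtain ⟨r₀, hr₀⟩ := exists_mul_star_eq_intCast φ ha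
  have hn0 : n = absDisc K * l * m - r₀ := by
    rw [det_s2Mat, hr₀] at hn
    exact_mod_cast hn
  choose m' s r hconj hs hu hr hmr using exists_lineValue (p := p) l m n ha hn
  have hmem : ∀ y, a + l * sqrtDisc K * (lift φ p y : ℂ) ∈ intRing φ := fun y => add_mem ha
    (mul_mem (mul_mem (intCast_mem _ l) (sqrtDisc_mem φ)) (lift φ p y).2)
  have hstar : (∃ z ∈ intRing φ, star a = p * z) ↔ ∃ z ∈ intRing φ, a = p * z := by
    rw [← redC_eq_zero_iff ha, ← redC_eq_zero_iff (conj_mem_intRing φ ha), redC_star ha,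
      star_eq_zero]
  rw [card_filter_option, inv_smul_indexEquiv_mem_iff (lineMat_none_conj l m a), hstar]
  simp only [fun y => inv_smul_indexEquiv_mem_iff (b := 0) (hconj y)]
  rw [inv_smul_s2Mat_mem_iff hpf.out.ne_zero] at hpT
  -- If p divides ℓ, the off-diagonal entry is a modulo p, up to conjugation, on every line. If p
  -- divides a too, it cannot divide m, so only the line `none`, with value ℓ, can count; and p²
  -- divides n exactly if it divides ℓ.
  by_cases hl : (p : ℤ) ∣ l
  · have hred : ∀ y, (∃ z ∈ intRing φ, a + l * sqrtDisc K * lift φ p y = p * z)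
        ↔ ∃ z ∈ intRing φ, a = p * z := by
      intro y
      rw [← redC_eq_zero_iff ha, ← redC_eq_zero_iff (hmem y), redC_line l ha,
        (intCast_residueRing_eq_zero_iff h l).mpr hl, zero_mul, zero_mul, add_zero]
    simp only [hred]
    by_cases hpa : ∃ z ∈ intRing φ, a = p * z
    · have hm : ¬ (p : ℤ) ∣ m := fun hm => hpT ⟨hl, hm, hpa⟩
      have hs0 : ∀ y, (p : ℤ) ∣ s y := by
        intro y
        obtain ⟨z, hz, e⟩ := hpa
        obtain ⟨u, hu⟩ := exists_altForm_eq hz (lift φ p y).2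
        refine ⟨u, ?_⟩
        have h1 := hs y
        rw [e, altForm_natCast_mul_left, hu] at h1
        exact_mod_cast h1.symm
      have hm' : ∀ y, ¬ (p : ℤ) ^ 2 ∣ m' y := by
        intro y h2
        obtain ⟨u, e⟩ := hu y
        have h3 : (p : ℤ) ∣ m' y := (dvd_pow_self _ two_ne_zero).trans h2
        rw [e, Int.dvd_add_left (hs0 y), Int.dvd_add_right (hl.mul_right u)] at h3
        exact hm h3
      have hn2 : (p : ℤ) ^ 2 ∣ n ↔ (p : ℤ) ^ 2 ∣ l := by
        rw [hn0, dvd_sub_left (sq_dvd_norm hpa hr₀)]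
        rw [← dvd_mul_iff_of_isCoprime ((isCoprime_absDisc_mul h hm).pow_left (m := 2)) l,
          mul_right_comm]
      simp [hpa, hm', hn2]
    · have hn2 : ¬ (p : ℤ) ^ 2 ∣ n := by
        intro h2
        apply hpa
        rw [← dvd_norm_iff h ha hr₀]
        have h3 : (p : ℤ) ∣ n := (dvd_pow_self _ two_ne_zero).trans h2
        rwa [hn0, dvd_sub_right ((hl.mul_left _).mul_right m)] at h3
      simp [hpa, hn2]
  · have hl2 : ¬ (p : ℤ) ^ 2 ∣ l := fun h2 => hl ((dvd_pow_self _ two_ne_zero).trans h2)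
    -- The off-diagonal entry vanishes modulo p for this single y₀. There p² divides the norm r, so
    -- by Dℓm' = r + n it divides m' exactly if it divides n.
    obtain ⟨y₀, hy₀⟩ := (bijective_redC_line h hl ha).surjective 0
    have hfil : ∀ y, ((∃ z ∈ intRing φ, a + l * sqrtDisc K * lift φ p y = p * z) ∧
        (p : ℤ) ^ 2 ∣ m' y) ↔ y = y₀ ∧ (p : ℤ) ^ 2 ∣ n := by
      intro y
      rw [← redC_eq_zero_iff (hmem y)]
      have h1 : redC φ p (a + l * sqrtDisc K * lift φ p y) = 0 ↔ y = y₀ := by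
        constructor
        · intro h2
          exact (bijective_redC_line h hl ha).injective (h2.trans hy₀.symm)
        · rintro rfl
          exact hy₀
      rw [← h1]
      refine and_congr_right fun h2 => ?_
      rw [redC_eq_zero_iff (hmem y)] at h2
      rw [← dvd_mul_iff_of_isCoprime ((isCoprime_absDisc_mul h hl).pow_left (m := 2)), hmr,
        dvd_add_right (sq_dvd_norm h2 (hr y))]
    simp only [hfil, hl2, and_false, if_false, zero_add]
    by_cases hn2 : (p : ℤ) ^ 2 ∣ n
    · simp only [hn2, and_true, if_true]
      convert Finset.card_singleton y₀
      ext
      simp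
    · simp [hn2]

end Counting

/-! ### The Maass relation for `F | T_p` -/

section Relation

open NumberField

variable {K : Type*} [Field K] [NumberField K] [Algebra.IsQuadraticExtension ℚ K]
  [IsTotallyComplex K] {φ : K →+* ℂ} {p : ℕ} [hpf : Fact p.Prime]

/-! ### Divisors of a matrix in `S2` -/

theorem combination_mem_S2 {A B : Matrix (Fin 2) (Fin 2) ℂ} (hA : A ∈ S2 φ) (hB : B ∈ S2 φ)
    (u v : ℤ) : (u : ℂ) • A + (v : ℂ) • B ∈ S2 φ := by
  obtain ⟨l, m, a, ha, rfl⟩ := mem_S2_iff.mp hA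
  obtain ⟨l', m', a', ha', rfl⟩ := mem_S2_iff.mp hB
  refine mem_S2_iff.mpr ⟨u * l + v * l', u * m + v * m', u * a + v * a',
    add_mem (mul_mem (intCast_mem _ _) ha) (mul_mem (intCast_mem _ _) ha'), ?_⟩
  ext i j
  fin_cases i <;> fin_cases j <;> simp [s2Mat] <;> ring

theorem mem_S2_of_coprime {A : Matrix (Fin 2) (Fin 2) ℂ} {m n : ℕ} (h : Nat.Coprime m n)
    (hm : (m : ℂ) • A ∈ S2 φ) (hn : (n : ℂ) • A ∈ S2 φ) : A ∈ S2 φ := by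
  obtain ⟨u, v, e⟩ := Nat.isCoprime_iff_coprime.mpr h
  have h1 := combination_mem_S2 hm hn u v
  have h2 : (u : ℂ) * m + v * n = 1 := by exact_mod_cast e
  rwa [smul_smul, smul_smul, ← add_smul, h2, one_smul] at h1

theorem inv_lcm_smul_mem_S2 {T : Matrix (Fin 2) (Fin 2) ℂ} {m n : ℕ} (hm : 0 < m) (hn : 0 < n)
    (h1 : (m : ℂ)⁻¹ • T ∈ S2 φ) (h2 : (n : ℂ)⁻¹ • T ∈ S2 φ) :
    ((m.lcm n : ℕ) : ℂ)⁻¹ • T ∈ S2 φ := by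
  have h3 := combination_mem_S2 h1 h2 (m.gcdB n) (m.gcdA n)
  have hm' : (m : ℂ) ≠ 0 := by exact_mod_cast hm.ne'
  have hn' : (n : ℂ) ≠ 0 := by exact_mod_cast hn.ne'
  have hl : ((m.lcm n : ℕ) : ℂ) ≠ 0 := by exact_mod_cast Nat.lcm_ne_zero hm.ne' hn.ne'
  have e1 : ((m.gcd n : ℕ) : ℂ) = m * m.gcdA n + n * m.gcdB n := by
    exact_mod_cast congrArg (Int.cast (R := ℂ)) (Nat.gcd_eq_gcd_ab m n)
  have e2 : ((m.gcd n : ℕ) : ℂ) * (m.lcm n : ℕ) = m * n := by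
    exact_mod_cast congrArg (Nat.cast (R := ℂ)) (Nat.gcd_mul_lcm m n)
  rw [smul_smul, smul_smul, ← add_smul] at h3
  convert h3 using 2
  rw [e1] at e2
  field_simp
  linear_combination -e2

theorem inv_smul_mem_S2_of_dvd {T : Matrix (Fin 2) (Fin 2) ℂ} {d e : ℕ} (h : d ∣ e) (he : 0 < e)
    (hT : (e : ℂ)⁻¹ • T ∈ S2 φ) : (d : ℂ)⁻¹ • T ∈ S2 φ := by
  obtain ⟨f, rfl⟩ := h
  have h1 := smul_mem_S2 hT f
  have hf : (f : ℂ) ≠ 0 := by exact_mod_cast (Nat.pos_of_mul_pos_left he).ne'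
  rwa [smul_smul, Nat.cast_mul, _root_.mul_inv_rev, mul_inv_cancel_left₀ hf] at h1

theorem bddAbove_inv_smul_mem_S2 {T : Matrix (Fin 2) (Fin 2) ℂ} (hT : T ∈ S2 φ) (h0 : T ≠ 0) :
    BddAbove {q : ℕ | 0 < q ∧ ((q : ℂ)⁻¹) • T ∈ S2 φ} := by
  obtain ⟨l, m, a, ha, rfl⟩ := mem_S2_iff.mp hT
  obtain ⟨r, hr⟩ := exists_mul_star_eq_intCast φ ha
  have hbound : ∀ {q : ℕ} {n : ℤ}, (q : ℤ) ∣ n → n ≠ 0 → q ≤ n.natAbs := fun h hn =>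
    Nat.le_of_dvd (Int.natAbs_pos.mpr hn) (Int.natCast_dvd.mp h)
  have hne : l ≠ 0 ∨ m ≠ 0 ∨ r ≠ 0 := by
    by_contra! hcon
    obtain ⟨rfl, rfl, rfl⟩ := hcon
    apply h0
    have : a = 0 := by simpa using hr
    rw [this]
    ext i j
    fin_cases i <;> fin_cases j <;> simp
  refine ⟨l.natAbs + m.natAbs + r.natAbs, ?_⟩
  rintro q ⟨hq, hqT⟩
  obtain ⟨hl, hm, z, hz, rfl⟩ := (inv_smul_s2Mat_mem_iff hq.ne' l m).mp hqT
  obtain ⟨s, hs⟩ := exists_mul_star_eq_intCast φ hz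
  have hqr : (q : ℤ) ∣ r := by
    refine ⟨q * s, ?_⟩
    have : (r : ℂ) = q * (q * s) := by
      rw [← hr, ← hs, star_mul', star_natCast]
      ring
    exact_mod_cast this
  rcases hne with h | h | h
  · have := hbound hl h; omega
  · have := hbound hm h; omega
  · have := hbound hqr h; omega

/-- The q with T/q in S_2 are closed under divisors and least common multiples, so their maximum is
a multiple of all of them. The hypothesis T ≠ 0 bounds the set, without which `sSup` would take the
default value 0. -/
theorem mem_divisors_epsilon_iff {T : Matrix (Fin 2) (Fin 2) ℂ} (hT : T ∈ S2 φ) (h0 : T ≠ 0)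
    {d : ℕ} : d ∈ (epsilon φ T).divisors ↔ 0 < d ∧ (d : ℂ)⁻¹ • T ∈ S2 φ := by
  have hb := bddAbove_inv_smul_mem_S2 hT h0
  obtain ⟨he, heT⟩ : 0 < epsilon φ T ∧ ((epsilon φ T : ℕ) : ℂ)⁻¹ • T ∈ S2 φ :=
    Nat.sSup_mem (s := {q : ℕ | 0 < q ∧ ((q : ℂ)⁻¹) • T ∈ S2 φ})
      ⟨1, one_pos, by simpa using hT⟩ hb
  rw [Nat.mem_divisors]
  constructor
  · rintro ⟨hd, -⟩
    exact ⟨Nat.pos_of_dvd_of_pos hd he, inv_smul_mem_S2_of_dvd hd he heT⟩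
  · rintro ⟨hd, hdT⟩
    refine ⟨?_, he.ne'⟩
    have h1 : (d.lcm (epsilon φ T)) ≤ epsilon φ T :=
      le_csSup hb ⟨Nat.lcm_pos hd he, inv_lcm_smul_mem_S2 hd he hdT heT⟩
    have h2 := Nat.le_antisymm h1 (Nat.le_of_dvd (Nat.lcm_pos hd he) (Nat.dvd_lcm_right _ _))
    rw [← h2]
    exact Nat.dvd_lcm_left _ _

/-- The terms of the sum in the Maass relation, for a form of discriminant `Δ`. -/
def maassTerm (k N : ℕ) (α : ℕ → ℂ) (Δ : ℂ) (d : ℕ) : ℂ :=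
  if d.Coprime N then (d : ℂ) ^ ((k : ℤ) - 1) * α ⌊(Δ / (d : ℂ) ^ 2).re⌋₊ else 0

/-- This homogeneity brings the Maass sums of pT, T_o and T/p, whose discriminants differ by powers
of p², to one common function. -/
theorem maassTerm_mul {k N n : ℕ} (hn : n ≠ 0) (hnN : n.Coprime N) (α : ℕ → ℂ) (Δ : ℂ) (d : ℕ) :
    maassTerm k N α ((n : ℂ) ^ 2 * Δ) (n * d)
      = (n : ℂ) ^ ((k : ℤ) - 1) * maassTerm k N α Δ d := by
  have hn' : (n : ℂ) ^ 2 ≠ 0 := pow_ne_zero _ (by exact_mod_cast hn)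
  have hc : (n * d).Coprime N ↔ d.Coprime N := by
    rw [Nat.coprime_mul_iff_left, and_iff_right hnN]
  by_cases h : d.Coprime N
  · rw [maassTerm, maassTerm, if_pos h, if_pos (hc.mpr h), Nat.cast_mul, mul_pow,
      mul_div_mul_left _ _ hn', mul_zpow, mul_assoc]
  · rw [maassTerm, maassTerm, if_neg h, if_neg (mt hc.mp h), mul_zero]

theorem sum_divisors_epsilon_eq_sum_maassTerm (k N : ℕ) (α : ℕ → ℂ)
    (T : Matrix (Fin 2) (Fin 2) ℂ) :
    ∑ d ∈ (epsilon φ T).divisors with d.Coprime N, (d : ℂ) ^ ((k : ℤ) - 1) * α (discIndex K T d)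
      = ∑ d ∈ (epsilon φ T).divisors, maassTerm k N α (absDisc K * T.det) d := by
  rw [Finset.sum_filter]
  rfl

open Classical in
variable (φ) in
/-- The indicator function of the divisors `d` of `T` in `S_2`. -/
def divInd (d : ℕ) (T : Matrix (Fin 2) (Fin 2) ℂ) : ℕ :=
  if 0 < d ∧ (d : ℂ)⁻¹ • T ∈ S2 φ then 1 else 0

/-- As sums over all of ℕ with indicator weights, divisor sums with different ranges acquire the
same index set and can be compared term by term. -/
theorem hasSum_divisors_epsilon {T : Matrix (Fin 2) (Fin 2) ℂ} (hT : T ∈ S2 φ) (h0 : T ≠ 0)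
    (f : ℕ → ℂ) : HasSum (fun d : ℕ => (divInd φ d T : ℂ) * f d)
      (∑ d ∈ (epsilon φ T).divisors, f d) := by
  have h1 := hasSum_sum_of_ne_finset_zero (L := SummationFilter.unconditional ℕ)
    (f := fun d : ℕ => (divInd φ d T : ℂ) * f d) (s := (epsilon φ T).divisors)
    (fun d hd => by
      rw [divInd, if_neg (mt (mem_divisors_epsilon_iff hT h0).mpr hd), Nat.cast_zero, zero_mul])
  convert h1 using 1
  refine Finset.sum_congr rfl fun d hd => ?_
  rw [divInd, if_pos ((mem_divisors_epsilon_iff hT h0).mp hd), Nat.cast_one, one_mul]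

theorem divInd_eq_zero {T : Matrix (Fin 2) (Fin 2) ℂ} (hT : T ∉ S2 φ) (d : ℕ) :
    divInd φ d T = 0 := by
  refine if_neg ?_
  rintro ⟨hd, hdT⟩
  apply hT
  have := smul_mem_S2 hdT d
  rwa [smul_smul, mul_inv_cancel₀ (by exact_mod_cast hd.ne'), one_smul] at this

theorem MaassRelation.hasSum {k N : ℕ} {c : S2 φ → ℂ} {α : ℕ → ℂ} (h : MaassRelation φ k N c α)
    {T : Matrix (Fin 2) (Fin 2) ℂ} (hT : T.PosSemidef) (h0 : T ≠ 0) :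
    HasSum (fun d : ℕ => (divInd φ d T : ℂ) * maassTerm k N α (absDisc K * T.det) d)
      (extCoeff c T) := by
  by_cases hm : T ∈ S2 φ
  · rw [extCoeff_of_mem c hm, h ⟨T, hm⟩ hT h0, sum_divisors_epsilon_eq_sum_maassTerm]
    exact hasSum_divisors_epsilon hm h0 _
  · rw [extCoeff_of_notMem c hm]
    simp only [divInd_eq_zero hm, Nat.cast_zero, zero_mul]
    exact hasSum_zero

open Classical in
theorem divInd_congr {d d' : ℕ} {T T' : Matrix (Fin 2) (Fin 2) ℂ} (h0 : 0 < d ↔ 0 < d')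
    (h : (d : ℂ)⁻¹ • T ∈ S2 φ ↔ (d' : ℂ)⁻¹ • T' ∈ S2 φ) : divInd φ d T = divInd φ d' T' := by
  simp only [divInd, h0, h]

theorem divInd_zero (T : Matrix (Fin 2) (Fin 2) ℂ) : divInd φ 0 T = 0 := by
  simp [divInd]

theorem divInd_mul_smul {n : ℕ} (hn : 0 < n) (d : ℕ) (T : Matrix (Fin 2) (Fin 2) ℂ) :
    divInd φ (n * d) ((n : ℂ) • T) = divInd φ d T := by
  have hn' : (n : ℂ) ≠ 0 := by exact_mod_cast hn.ne'
  have e : ((n * d : ℕ) : ℂ)⁻¹ • ((n : ℂ) • T) = (d : ℂ)⁻¹ • T := by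
    rw [smul_smul, Nat.cast_mul, _root_.mul_inv_rev, inv_mul_cancel_right₀ hn']
  exact divInd_congr (Nat.mul_pos_iff_of_pos_left hn) (by rw [e])

theorem divInd_inv_smul {n : ℕ} (hn : 0 < n) (d : ℕ) (T : Matrix (Fin 2) (Fin 2) ℂ) :
    divInd φ d ((n : ℂ)⁻¹ • T) = divInd φ (n * d) T := by
  have hn' : (n : ℂ) ≠ 0 := by exact_mod_cast hn.ne'
  rw [← divInd_mul_smul hn d, smul_smul, mul_inv_cancel₀ hn', one_smul]

theorem divInd_smul_of_coprime {n d : ℕ} (h : n.Coprime d)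
    {T : Matrix (Fin 2) (Fin 2) ℂ} (hT : T ∈ S2 φ) :
    divInd φ d ((n : ℂ) • T) = divInd φ d T := by
  rcases Nat.eq_zero_or_pos d with rfl | hd
  · rw [divInd_zero, divInd_zero]
  have hd' : (d : ℂ) ≠ 0 := by exact_mod_cast hd.ne'
  have e : (d : ℂ)⁻¹ • (n : ℂ) • T ∈ S2 φ ↔ (d : ℂ)⁻¹ • T ∈ S2 φ := by
    rw [smul_comm]
    refine ⟨fun h1 => mem_S2_of_coprime h h1 ?_, fun h1 => smul_mem_S2 h1 n⟩
    rwa [smul_smul, mul_inv_cancel₀ hd', one_smul]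
  exact divInd_congr Iff.rfl e

/-- The d-th term is moved to the index nd; this aligns the terms containing f(x), f(pd) and f(p²d)
by the argument of f. -/
theorem HasSum.comp_div {f : ℕ → ℂ} {s : ℂ} (h : HasSum f s) {n : ℕ} (hn : 0 < n) :
    HasSum (fun x : ℕ => if n ∣ x then f (x / n) else 0) s := by
  have hinj : Function.Injective fun d : ℕ => n * d := fun a b e => Nat.eq_of_mul_eq_mul_left hn e
  rw [← hinj.hasSum_iff]
  · convert h using 1
    funext d
    simp [Nat.mul_div_cancel_left d hn]
  · intro x hx
    refine if_neg ?_
    rintro ⟨d, rfl⟩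
    exact hx ⟨d, rfl⟩

/-! ### Divisor counts of the matrices T_o -/

theorem indexEquiv_smul (i : CosetIndex φ p) (z : ℂ) (T : Matrix (Fin 2) (Fin 2) ℂ) :
    indexEquiv i (z • T) = z • indexEquiv i T := by
  change (p : ℂ)⁻¹ • (repE φ p i * (z • T) * (repE φ p i)ᴴ)
    = z • (p : ℂ)⁻¹ • (repE φ p i * T * (repE φ p i)ᴴ)
  rw [Matrix.mul_smul, Matrix.smul_mul, smul_comm]

theorem indexEquiv_ne_zero (i : CosetIndex φ p) {T : Matrix (Fin 2) (Fin 2) ℂ} (h0 : T ≠ 0) :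
    indexEquiv i T ≠ 0 := by
  intro e
  apply h0
  apply (indexEquiv i).injective
  have := indexEquiv_smul i 0 (0 : Matrix (Fin 2) (Fin 2) ℂ)
  rw [zero_smul, zero_smul] at this
  rw [e, this]

theorem posSemidef_indexEquiv (i : CosetIndex φ p) {T : Matrix (Fin 2) (Fin 2) ℂ}
    (hT : T.PosSemidef) : (indexEquiv i T).PosSemidef := by
  have h1 : (0 : ℂ) ≤ (p : ℂ)⁻¹ := by
    rw [← Complex.ofReal_natCast, ← Complex.ofReal_inv]
    exact Complex.zero_le_real.mpr (by positivity)
  exact (hT.mul_mul_conjTranspose_same (repE φ p i)).smul h1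

theorem det_indexEquiv_line (o : Option (ResidueRing φ p)) (b : ZMod p)
    (T : Matrix (Fin 2) (Fin 2) ℂ) : (indexEquiv (.inr (.inr (o, b))) T).det = T.det := by
  have hp : (p : ℂ) ≠ 0 := by exact_mod_cast hpf.out.ne_zero
  have e3 : (repE φ p (.inr (.inr (o, b)))).det = (p : ℂ) := by
    simp [repE, det_conjTranspose, det_lineMat]
  change ((p : ℂ)⁻¹ • (repE φ p _ * T * (repE φ p _)ᴴ)).det = _
  rw [det_smul, det_mul, det_mul, det_conjTranspose, e3, star_natCast, Fintype.card_fin]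
  field_simp

theorem smul_mem_S2_of_indexEquiv {i : CosetIndex φ p}
    {T : Matrix (Fin 2) (Fin 2) ℂ} (h : indexEquiv i T ∈ S2 φ) : (p : ℂ) • T ∈ S2 φ := by
  have hp : (p : ℂ) ≠ 0 := by exact_mod_cast hpf.out.ne_zero
  have h4 : T = (p : ℂ)⁻¹ • ((repA φ p i)ᴴ * indexEquiv i T * repA φ p i) :=
    ((indexEquiv i).symm_apply_apply T).symm
  rw [h4, smul_smul, mul_inv_cancel₀ hp, one_smul]
  exact conj_mem_S2 h (isInt_repA φ p i)

open Classical in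
theorem sum_divInd_line {d : ℕ} (hd : 0 < d) (T : Matrix (Fin 2) (Fin 2) ℂ) :
    ∑ o, divInd φ d (indexEquiv (.inr (.inr (o, 0)) : CosetIndex φ p) T)
      = (Finset.univ.filter fun o : Option (ResidueRing φ p) =>
          indexEquiv (.inr (.inr (o, 0)) : CosetIndex φ p) ((d : ℂ)⁻¹ • T) ∈ S2 φ).card := by
  rw [Finset.card_filter]
  refine Finset.sum_congr rfl fun o _ => ?_
  rw [divInd, indexEquiv_smul]
  simp only [hd, true_and]

/-- This is `card_isotropic` for T/d, with the correction for divisibility by p distributed over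
both sides to avoid subtraction in ℕ. -/
theorem sum_divInd_line_of_mem (h : Prime (p : intRing φ)) {T : Matrix (Fin 2) (Fin 2) ℂ} {d : ℕ}
    (hd : 0 < d) (hdT : (d : ℂ)⁻¹ • T ∈ S2 φ) {n : ℕ}
    (hn : (n : ℂ) = absDisc K * T.det / (d : ℂ) ^ 2) :
    p ^ 2 * divInd φ d T + ∑ o, divInd φ d (indexEquiv (.inr (.inr (o, 0)) : CosetIndex φ p) T)
      = p ^ 2 * divInd φ (p * d) T + (p ^ 2 + 1 + if p ∣ n then 0 else p) := by
  have hn' : ((n : ℤ) : ℂ) = absDisc K * ((d : ℂ)⁻¹ • T).det := by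
    rw [Int.cast_natCast, hn, det_smul, Fintype.card_fin]
    field_simp
  have h1 := card_isotropic h hdT hn'
  simp only [Int.natCast_dvd_natCast] at h1
  rw [sum_divInd_line hd, ← divInd_inv_smul hpf.out.pos, divInd, divInd, if_pos ⟨hd, hdT⟩, ← h1,
    smul_comm]
  by_cases h2 : (p : ℂ)⁻¹ • (d : ℂ)⁻¹ • T ∈ S2 φ
  · rw [if_pos h2, if_pos ⟨hd, h2⟩]
    ring
  · rw [if_neg h2, if_neg fun h3 => h2 h3.2]
    ring

/-- If T_o/d were in S_2, then both p(T/d) and d(T/d) = T would be, and so would T/d, as p and d are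
coprime. -/
theorem sum_divInd_line_of_coprime {T : Matrix (Fin 2) (Fin 2) ℂ} (hT : T ∈ S2 φ) {d : ℕ}
    (hd : 0 < d) (hpd : p.Coprime d) (hdT : (d : ℂ)⁻¹ • T ∉ S2 φ) :
    ∑ o, divInd φ d (indexEquiv (.inr (.inr (o, 0)) : CosetIndex φ p) T) = 0 := by
  have hd' : (d : ℂ) ≠ 0 := by exact_mod_cast hd.ne'
  refine Finset.sum_eq_zero fun o _ => if_neg ?_
  rintro ⟨-, h1⟩
  rw [← indexEquiv_smul] at h1
  refine hdT (mem_S2_of_coprime hpd (smul_mem_S2_of_indexEquiv h1) ?_)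
  rwa [smul_smul, mul_inv_cancel₀ hd', one_smul]

theorem sum_divInd_line_of_notMem {T : Matrix (Fin 2) (Fin 2) ℂ} {d : ℕ}
    (hdT : (d : ℂ)⁻¹ • T ∉ S2 φ) :
    ∑ o, divInd φ (p * d) (indexEquiv (.inr (.inr (o, 0)) : CosetIndex φ p) T) = 0 := by
  have hp : (p : ℂ) ≠ 0 := by exact_mod_cast hpf.out.ne_zero
  refine Finset.sum_eq_zero fun o _ => if_neg ?_
  rintro ⟨-, h1⟩
  rw [← indexEquiv_smul] at h1
  have h2 := smul_mem_S2_of_indexEquiv h1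
  rw [smul_smul, Nat.cast_mul, _root_.mul_inv_rev, mul_left_comm, mul_inv_cancel₀ hp, mul_one] at h2
  exact hdT h2

open Classical in
theorem sum_divInd_line_mul (h : Prime (p : intRing φ)) {T : Matrix (Fin 2) (Fin 2) ℂ} {d : ℕ}
    (hd : 0 < d) (hdT : (d : ℂ)⁻¹ • T ∈ S2 φ) (hpT : ((p * d : ℕ) : ℂ)⁻¹ • T ∉ S2 φ) {n : ℕ}
    (hn : (n : ℂ) = absDisc K * T.det / (d : ℂ) ^ 2) :
    ∑ o, divInd φ (p * d) (indexEquiv (.inr (.inr (o, 0)) : CosetIndex φ p) T)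
      = if p ^ 2 ∣ n then 1 else 0 := by
  have hn' : ((n : ℤ) : ℂ) = absDisc K * ((d : ℂ)⁻¹ • T).det := by
    rw [Int.cast_natCast, hn, det_smul, Fintype.card_fin]
    field_simp
  have e : ((p * d : ℕ) : ℂ)⁻¹ = (p : ℂ)⁻¹ * (d : ℂ)⁻¹ := by
    rw [Nat.cast_mul, mul_inv]
  rw [e, ← smul_smul] at hpT
  have h1 := card_divisible h hdT hpT hn'
  have h2 : (p : ℤ) ^ 2 ∣ (n : ℤ) ↔ p ^ 2 ∣ n := by
    rw [← Nat.cast_pow, Int.natCast_dvd_natCast]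
  simp only [h2] at h1
  rw [sum_divInd_line (Nat.mul_pos hpf.out.pos hd), ← h1]
  simp only [e, ← smul_smul, indexEquiv_smul]

/-- The identity between divisor counts behind the Maass relation, for `d` prime to `p`. -/
theorem divInd_identity_of_coprime (h : Prime (p : intRing φ)) {T : Matrix (Fin 2) (Fin 2) ℂ}
    (hT : T ∈ S2 φ) {ν : ℕ → ℕ}
    (hν : ∀ d : ℕ, (d : ℂ)⁻¹ • T ∈ S2 φ → (ν d : ℂ) = absDisc K * T.det / (d : ℂ) ^ 2)
    {d : ℕ} (hd : 0 < d) (hpd : p.Coprime d) :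
    p ^ 2 * divInd φ d T + ∑ o, divInd φ d (indexEquiv (.inr (.inr (o, 0)) : CosetIndex φ p) T)
      = p ^ 2 * divInd φ (p * d) T
        + divInd φ d T * (p ^ 2 + 1 + if p ∣ ν d then 0 else p) := by
  by_cases hdT : (d : ℂ)⁻¹ • T ∈ S2 φ
  · have e : divInd φ d T = 1 := if_pos ⟨hd, hdT⟩
    rw [sum_divInd_line_of_mem h hd hdT (hν d hdT), e, one_mul]
  · have e : divInd φ d T = 0 := if_neg fun h1 => hdT h1.2
    have e' : divInd φ (p * d) T = 0 := if_neg fun h1 =>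
      hdT (inv_smul_mem_S2_of_dvd (Nat.dvd_mul_left _ _) h1.1 h1.2)
    rw [sum_divInd_line_of_coprime hT hd hpd hdT, e, e']
    simp

/-- The identity between divisor counts behind the Maass relation, at multiples of `p`. -/
theorem divInd_identity_mul (h : Prime (p : intRing φ)) {T : Matrix (Fin 2) (Fin 2) ℂ}
    {ν : ℕ → ℕ}
    (hν : ∀ d : ℕ, (d : ℂ)⁻¹ • T ∈ S2 φ → (ν d : ℂ) = absDisc K * T.det / (d : ℂ) ^ 2)
    {d : ℕ} (hd : 0 < d) :
    p ^ 2 * divInd φ (p * d) T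
        + ∑ o, divInd φ (p * d) (indexEquiv (.inr (.inr (o, 0)) : CosetIndex φ p) T)
        + divInd φ (p * d) T
      = p ^ 2 * divInd φ (p * (p * d)) T
        + divInd φ (p * d) T * (p ^ 2 + 1 + if p ∣ ν (p * d) then 0 else p)
        + divInd φ d T * (if p ^ 2 ∣ ν d then 1 else 0) := by
  have hp : (p : ℂ) ≠ 0 := by exact_mod_cast hpf.out.ne_zero
  have hpd := Nat.mul_pos hpf.out.pos hd
  by_cases hdT : (d : ℂ)⁻¹ • T ∈ S2 φ
  · have e : divInd φ d T = 1 := if_pos ⟨hd, hdT⟩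
    by_cases hpT : ((p * d : ℕ) : ℂ)⁻¹ • T ∈ S2 φ
    · have e' : divInd φ (p * d) T = 1 := if_pos ⟨hpd, hpT⟩
      -- Because p² divides ν(d), the last term on the right equals 1 and balances the extra term on
      -- the left, which stems from c(T/p).
      have h2 : ν d = p ^ 2 * ν (p * d) := by
        have h3 : (ν d : ℂ) = p ^ 2 * ν (p * d) := by
          rw [hν d hdT, hν _ hpT, Nat.cast_mul, mul_pow]
          field_simp
        exact_mod_cast h3
      rw [sum_divInd_line_of_mem h hpd hpT (hν _ hpT), e, e',
        if_pos (show p ^ 2 ∣ ν d from ⟨_, h2⟩)]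
      ring
    · have e' : divInd φ (p * d) T = 0 := if_neg fun h1 => hpT h1.2
      have e'' : divInd φ (p * (p * d)) T = 0 := if_neg fun h1 =>
        hpT (inv_smul_mem_S2_of_dvd (Nat.dvd_mul_left _ _) h1.1 h1.2)
      -- Here T/d is in S_2 but not divisible by p, so the line sum is the count of
      -- `card_divisible`, which is the last term on the right.
      rw [sum_divInd_line_mul h hd hdT hpT (hν d hdT), e, e', e'']
      simp
  · have e : divInd φ d T = 0 := if_neg fun h1 => hdT h1.2
    have e' : divInd φ (p * d) T = 0 := if_neg fun h1 =>
      hdT (inv_smul_mem_S2_of_dvd (Nat.dvd_mul_left _ _) h1.1 h1.2)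
    have e'' : divInd φ (p * (p * d)) T = 0 := if_neg fun h1 =>
      hdT (inv_smul_mem_S2_of_dvd ((Nat.dvd_mul_left _ _).mul_left _) h1.1 h1.2)
    rw [sum_divInd_line_of_notMem hdT, e, e', e'']
    simp

end Relation

/-! ### Stability of the Maass space -/

section Stability

open NumberField

variable {K : Type*} [Field K] [NumberField K] [Algebra.IsQuadraticExtension ℚ K]
  [IsTotallyComplex K] {φ : K →+* ℂ} {p : ℕ} [hpf : Fact p.Prime]

theorem maassTerm_eq (k N : ℕ) (α : ℕ → ℂ) {Δ : ℂ} {d n : ℕ} (hn : (n : ℂ) = Δ / (d : ℂ) ^ 2) :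
    maassTerm k N α Δ d = if d.Coprime N then (d : ℂ) ^ ((k : ℤ) - 1) * α n else 0 := by
  rw [maassTerm, ← hn, Complex.natCast_re, Nat.floor_natCast]

/-- The arithmetic function attached to `F | T_p`. -/
def heckeAlpha (p k : ℕ) (α : ℕ → ℂ) (n : ℕ) : ℂ :=
  (p : ℂ) ^ 2 * (((p : ℂ) ^ ((k : ℤ) - 1)) ^ 2)⁻¹ * α (p ^ 2 * n)
    + ((p : ℂ) ^ ((k : ℤ) - 1))⁻¹ * ((p ^ 2 + 1 + if p ∣ n then 0 else p : ℕ) : ℂ) * α n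
    + ((if p ^ 2 ∣ n then 1 else 0 : ℕ) : ℂ) * α (n / p ^ 2)

/-- By homogeneity the three summands of `heckeAlpha`, multiplied by p^{2k-2}, become values of the
common function at d, pd and p²d. If p² does not divide n, the truncated quotient in the third
summand carries the factor 0. -/
theorem maassTerm_heckeAlpha {k N : ℕ} (hpN : p.Coprime N) (α : ℕ → ℂ) {Δ : ℂ} {d n : ℕ}
    (hn : (n : ℂ) = Δ / (d : ℂ) ^ 2) :
    ((p : ℂ) ^ ((k : ℤ) - 1)) ^ 2 * maassTerm k N (heckeAlpha p k α) Δ d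
      = (p : ℂ) ^ 2 * maassTerm k N α ((p : ℂ) ^ 2 * Δ) d
        + ((p ^ 2 + 1 + if p ∣ n then 0 else p : ℕ) : ℂ)
          * maassTerm k N α ((p : ℂ) ^ 2 * Δ) (p * d)
        + ((if p ^ 2 ∣ n then 1 else 0 : ℕ) : ℂ)
          * maassTerm k N α ((p : ℂ) ^ 2 * Δ) (p * (p * d)) := by
  have hp : (p : ℂ) ≠ 0 := by exact_mod_cast hpf.out.ne_zero
  have hq : (p : ℂ) ^ ((k : ℤ) - 1) ≠ 0 := zpow_ne_zero _ hp
  have h1 : maassTerm k N α ((p : ℂ) ^ 2 * Δ) d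
      = if d.Coprime N then (d : ℂ) ^ ((k : ℤ) - 1) * α (p ^ 2 * n) else 0 :=
    maassTerm_eq k N α (by rw [mul_div_assoc, ← hn]; push_cast; rfl)
  have h2 : p ^ 2 ∣ n → maassTerm k N α Δ (p * d) = if d.Coprime N then
      (p : ℂ) ^ ((k : ℤ) - 1) * ((d : ℂ) ^ ((k : ℤ) - 1) * α (n / p ^ 2)) else 0 := by
    rintro ⟨m, rfl⟩
    have e : (m : ℂ) = Δ / ((p * d : ℕ) : ℂ) ^ 2 := by
      rw [Nat.cast_mul, mul_pow, mul_comm, ← div_div, ← hn]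
      push_cast
      field_simp
    have hc : (p * d).Coprime N ↔ d.Coprime N := by
      rw [Nat.coprime_mul_iff_left, and_iff_right hpN]
    rw [maassTerm_eq k N α e, Nat.mul_div_cancel_left m (pow_pos hpf.out.pos 2), Nat.cast_mul,
      mul_zpow, mul_assoc]
    by_cases h : d.Coprime N
    · rw [if_pos h, if_pos (hc.mpr h)]
    · rw [if_neg h, if_neg (mt hc.mp h)]
  rw [maassTerm_mul hpf.out.ne_zero hpN, maassTerm_mul hpf.out.ne_zero hpN, h1,
    maassTerm_eq k N α hn, maassTerm_eq k N _ hn]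
  by_cases hd : d.Coprime N
  · simp only [if_pos hd] at h2 ⊢
    rw [heckeAlpha]
    by_cases hpn : p ^ 2 ∣ n
    · rw [h2 hpn]
      field_simp
    · simp only [if_neg hpn, Nat.cast_zero, zero_mul, add_zero]
      field_simp
  · simp only [if_neg hd] at h2 ⊢
    by_cases hpn : p ^ 2 ∣ n
    · rw [h2 hpn]
      ring
    · simp only [if_neg hpn]
      simp

/-- Both sides, multiplied by q², are sums of values of f over the positive integers. The divisor
identities show that each f(x) has the same coefficient on both sides. -/
theorem heckeCoeff_eq (h : Prime (p : intRing φ)) {k N : ℕ} (hpN : p.Coprime N) {c : S2 φ → ℂ}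
    {α : ℕ → ℂ} (hc : MaassRelation φ k N c α) {T : Matrix (Fin 2) (Fin 2) ℂ} (hT : T ∈ S2 φ)
    (hT' : T.PosSemidef) (h0 : T ≠ 0) :
    heckeCoeff p k c T = ∑ d ∈ (epsilon φ T).divisors,
      maassTerm k N (heckeAlpha p k α) (absDisc K * T.det) d := by
  have hpp := hpf.out.pos
  have hp : (p : ℂ) ≠ 0 := by exact_mod_cast hpf.out.ne_zero
  have hp0 : (0 : ℂ) ≤ (p : ℂ) := by exact_mod_cast Nat.zero_le p
  have hp1 : (0 : ℂ) ≤ (p : ℂ)⁻¹ := by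
    rw [← Complex.ofReal_natCast, ← Complex.ofReal_inv]
    exact Complex.zero_le_real.mpr (by positivity)
  set q : ℂ := (p : ℂ) ^ ((k : ℤ) - 1) with hq
  have hq0 : q ≠ 0 := zpow_ne_zero _ hp
  set Δ : ℂ := absDisc K * T.det with hΔ
  set f : ℕ → ℂ := maassTerm k N α ((p : ℂ) ^ 2 * Δ) with hf
  set ν := discIndex K T with hν
  set L : Option (ResidueRing φ p) → Matrix (Fin 2) (Fin 2) ℂ :=
    fun o => indexEquiv (.inr (.inr (o, 0)) : CosetIndex φ p) T with hL
  have hspec : ∀ d : ℕ, (d : ℂ)⁻¹ • T ∈ S2 φ → (ν d : ℂ) = Δ / (d : ℂ) ^ 2 :=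
    fun d hd => discIndex_spec φ hT' hd
  -- Each passage from a discriminant Δ' to p²Δ' costs a factor q⁻¹; one passage is needed for T_o
  -- and two for T/p.
  have key : ∀ Δ' : ℂ, ∀ d, maassTerm k N α Δ' d = q⁻¹ * maassTerm k N α ((p : ℂ) ^ 2 * Δ') (p * d) := by
    intro Δ' d
    rw [maassTerm_mul hpf.out.ne_zero hpN, inv_mul_cancel_left₀ hq0]
  have s1 : HasSum (fun x : ℕ => (divInd φ x ((p : ℂ) • T) : ℂ) * f x)
      (extCoeff c ((p : ℂ) • T)) := by
    have := hc.hasSum (hT'.smul hp0) (smul_ne_zero hp h0)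
    rw [det_smul, Fintype.card_fin, mul_left_comm] at this
    exact this
  have s2 : HasSum (fun d : ℕ => (divInd φ d ((p : ℂ)⁻¹ • T) : ℂ) * f (p * (p * d)))
      (q ^ 2 * extCoeff c ((p : ℂ)⁻¹ • T)) := by
    have := (hc.hasSum (hT'.smul hp1) (smul_ne_zero (inv_ne_zero hp) h0)).mul_left (q ^ 2)
    rw [det_smul, Fintype.card_fin] at this
    refine (congrArg (fun g => HasSum g _) (funext fun d => ?_)).mp this
    have e : (p : ℂ) ^ 2 * (absDisc K * ((p : ℂ)⁻¹ ^ 2 * T.det)) = Δ := by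
      rw [hΔ]; field_simp
    rw [key, e, key Δ]
    field_simp
    rfl
  have s3 : HasSum (fun d : ℕ => ((∑ o, divInd φ d (L o) : ℕ) : ℂ) * f (p * d))
      (q * ∑ o, extCoeff c (L o)) := by
    have := (hasSum_sum fun o (_ : o ∈ Finset.univ) => hc.hasSum
      (posSemidef_indexEquiv (.inr (.inr (o, 0)) : CosetIndex φ p) hT')
      (indexEquiv_ne_zero _ h0)).mul_left q
    refine (congrArg (fun g => HasSum g _) (funext fun d => ?_)).mp this
    simp only [det_indexEquiv_line]
    rw [← Finset.sum_mul, Nat.cast_sum, key, ← hΔ, mul_left_comm, mul_inv_cancel_left₀ hq0]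
  have left := ((s1.mul_left ((p : ℂ) ^ 2)).add (HasSum.comp_div s3 hpp)).add
    (HasSum.comp_div (HasSum.comp_div s2 hpp) hpp)
  have r1 := hasSum_divisors_epsilon hT h0 fun d => (p : ℂ) ^ 2 * f d
  have r2 := hasSum_divisors_epsilon hT h0 fun d =>
    ((p ^ 2 + 1 + if p ∣ ν d then 0 else p : ℕ) : ℂ) * f (p * d)
  have r3 := hasSum_divisors_epsilon hT h0 fun d =>
    ((if p ^ 2 ∣ ν d then 1 else 0 : ℕ) : ℂ) * f (p * (p * d))
  have right := (r1.add (HasSum.comp_div r2 hpp)).add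
    (HasSum.comp_div (HasSum.comp_div r3 hpp) hpp)
  -- Coefficients of f(x) are compared in three cases: p does not divide x, p divides x exactly
  -- once, or p² divides x. The index x = 0 contributes nothing, since `divInd` vanishes there.
  have hpoint : ∀ x : ℕ, (p : ℂ) ^ 2 * ((divInd φ x ((p : ℂ) • T) : ℂ) * f x)
      + (if p ∣ x then ((∑ o, divInd φ (x / p) (L o) : ℕ) : ℂ) * f (p * (x / p)) else 0)
      + (if p ∣ x then if p ∣ x / p then
          (divInd φ (x / p / p) ((p : ℂ)⁻¹ • T) : ℂ) * f (p * (p * (x / p / p))) else 0 else 0)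
      = (divInd φ x T : ℂ) * ((p : ℂ) ^ 2 * f x)
      + (if p ∣ x then (divInd φ (x / p) T : ℂ) *
          (((p ^ 2 + 1 + if p ∣ ν (x / p) then 0 else p : ℕ) : ℂ) * f (p * (x / p))) else 0)
      + (if p ∣ x then if p ∣ x / p then (divInd φ (x / p / p) T : ℂ) *
          (((if p ^ 2 ∣ ν (x / p / p) then 1 else 0 : ℕ) : ℂ) * f (p * (p * (x / p / p))))
          else 0 else 0) := by
    intro x
    by_cases hx : p ∣ x
    · obtain ⟨d, rfl⟩ := hx
      simp only [Nat.dvd_mul_right, if_true, Nat.mul_div_cancel_left _ hpp, divInd_mul_smul hpp]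
      rcases Nat.eq_zero_or_pos d with rfl | hd
      · simp [divInd_zero]
      by_cases hx : p ∣ d
      · obtain ⟨e, rfl⟩ := hx
        have he : 0 < e := Nat.pos_of_mul_pos_left hd
        have id1 := congrArg (Nat.cast (R := ℂ)) (divInd_identity_mul h hspec he)
        simp only [Nat.dvd_mul_right, if_true, Nat.mul_div_cancel_left _ hpp,
          divInd_inv_smul hpp]
        simp only [Nat.cast_add, Nat.cast_mul, Nat.cast_pow] at id1 ⊢
        linear_combination f (p * (p * e)) * id1
      · have id1 := congrArg (Nat.cast (R := ℂ)) (divInd_identity_of_coprime h hT hspec hd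
          ((Nat.Prime.coprime_iff_not_dvd hpf.out).mpr hx))
        simp only [if_neg hx]
        simp only [Nat.cast_add, Nat.cast_mul, Nat.cast_pow] at id1 ⊢
        linear_combination f (p * d) * id1
    -- For x prime to p only the terms of c(pT) and of α(p²n) are present, and x divides pT exactly
    -- if it divides T.
    · simp only [if_neg hx, add_zero]
      rw [divInd_smul_of_coprime ((Nat.Prime.coprime_iff_not_dvd hpf.out).mpr hx) hT]
      ring
  have hsum := left.unique ((congrArg (fun g => HasSum g _) (funext hpoint)).mpr right)
  apply mul_left_cancel₀ (pow_ne_zero 2 hq0)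
  rw [Finset.mul_sum]
  -- The weights match because q²p^{4-2k} = p² and q²p^{1-k} = q.
  have e1 : q ^ 2 * heckeCoeff p k c T = (p : ℂ) ^ 2 * extCoeff c ((p : ℂ) • T)
      + q * ∑ o, extCoeff c (L o) + q ^ 2 * extCoeff c ((p : ℂ)⁻¹ • T) := by
    have hk : q = (p : ℂ) ^ (k : ℤ) * (p : ℂ)⁻¹ := by
      rw [hq, zpow_sub_one₀ hp]
    have hpk : (p : ℂ) ^ (k : ℤ) ≠ 0 := zpow_ne_zero _ hp
    have hpk2 : ((p : ℂ) ^ 2) ^ (-(k : ℤ)) = (((p : ℂ) ^ (k : ℤ)) ^ 2)⁻¹ := by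
      rw [_root_.zpow_neg, ← zpow_natCast, ← zpow_natCast, ← _root_.zpow_mul,
        ← _root_.zpow_mul, mul_comm]
    rw [heckeCoeff, ← Finset.mul_sum, hpk2, _root_.zpow_neg, hk]
    field_simp
    ring
  rw [e1, hsum, ← Finset.sum_add_distrib, ← Finset.sum_add_distrib]
  refine Finset.sum_congr rfl fun d hd => ?_
  rw [maassTerm_heckeAlpha hpN α (hspec d ((mem_divisors_epsilon_iff hT h0).mp hd).2)]

theorem maassRelation_heckeCoeff (h : Prime (p : intRing φ)) {k N : ℕ} (hpN : p.Coprime N)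
    {c : S2 φ → ℂ} {α : ℕ → ℂ} (hc : MaassRelation φ k N c α) :
    MaassRelation φ k N (fun T => heckeCoeff p k c T.val) (heckeAlpha p k α) := by
  intro T hT h0
  rw [sum_divisors_epsilon_eq_sum_maassTerm]
  exact heckeCoeff_eq h hpN hc T.2 hT h0

theorem heckeOperator_eq_sum_rep (h : Prime (p : intRing φ)) {k N : ℕ} (hpN : p.Coprime N)
    {F : HH 2 → ℂ} (hF : ∀ g ∈ Gamma0 φ 2 N, slash k g F = F) :
    heckeOperator k (Gamma0 φ 2 N) (diagElt 2 hpf.out.pos) F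
      = ∑ i, slash k (rep φ hpf.out.pos i) F :=
  heckeOperator_eq_sum _ (bijOn_mk_rep h hpN) hF

end Stability

end

end HermitianMaass

/-- Let `K` be an imaginary quadratic field, embedded in `ℂ` by `φ`, and let the weight `k` be
divisible by the number of units of `K`. If the prime `p` is inert in `K` and does not divide `N`,
then the double coset of `diag(I_2, p I_2)` is a finite union of right cosets, and the Hecke
operator `T_p` which it defines maps the Maass space of weight `k` and level `N` to itself. -/
theorem theorem6p4 {K : Type*} [Field K] [NumberField K] [Algebra.IsQuadraticExtension ℚ K]
    [NumberField.IsTotallyComplex K] (φ : K →+* ℂ) (k N p : ℕ)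
    (hk : Nat.card (NumberField.RingOfIntegers K)ˣ ∣ k) (hN : 0 < N) (hp : p.Prime)
    (hinert : (Ideal.span {(p : NumberField.RingOfIntegers K)}).IsPrime) (hpN : ¬ p ∣ N) :
    (HermitianMaass.heckeCosets (HermitianMaass.Gamma0 φ 2 N)
      (HermitianMaass.diagElt 2 hp.pos)).Finite ∧
    ∀ F ∈ HermitianMaass.maassSpace φ k N,
      HermitianMaass.heckeOperator k (HermitianMaass.Gamma0 φ 2 N)
        (HermitianMaass.diagElt 2 hp.pos) F ∈ HermitianMaass.maassSpace φ k N := by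
  have : Fact p.Prime := ⟨hp⟩
  have h := HermitianMaass.natCast_prime φ p hp.ne_zero hinert
  have hpN' : p.Coprime N := (Nat.Prime.coprime_iff_not_dvd hp).mpr hpN
  have hfin := HermitianMaass.finite_heckeCosets (φ := φ) h hpN'
  refine ⟨hfin, ?_⟩
  rintro F ⟨⟨hol, hF⟩, c, α, hc, hα⟩
  have hsum := HermitianMaass.heckeOperator_eq_sum_rep h hpN' hF
  refine ⟨⟨?_, fun γ hγ => HermitianMaass.slash_heckeOperator hfin hF hγ⟩,
    fun T => HermitianMaass.heckeCoeff p k c T.val, HermitianMaass.heckeAlpha p k α, ?_,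
    HermitianMaass.maassRelation_heckeCoeff h hpN' hα⟩
  · rw [hsum]
    exact HermitianMaass.IsHolomorphic.finset_sum fun i _ =>
      HermitianMaass.IsHolomorphic.slash_of_fromBlocks (HermitianMaass.rep_val φ hp.pos i) hol
  · rw [hsum]
    exact HermitianMaass.hasFourierExpansion_sum_slash hc k
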